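/- Let $q$ be a complex number with $0<|q|<1$. Write $(a;q)_n=\prod_{i=0}^{n-1}(1-aq^i)$ for integers $n\ge 0$, $(a;q)_\infty=\prod_{i\ge0}(1-aq^i)$, $(a_1,\dots,a_m;q)_n=(a_1;q)_n\cdots(a_m;q)_n$ for $0\le n\le\infty$, and $$ {}_8\phi_7\!\left[\begin{matrix}a_0,a_1,\dots,a_7\\ b_1,\dots,b_7\end{matrix}\,\Big|\,q;z\right]=\sum_{k=0}^\infty\frac{(a_0,a_1,\dots,a_7;q)_k}{(q,b_1,\dots,b_7;q)_k}\,z^k . $$ Let $x,y,b,c,d,e,f$ be complex numbers, with $x,y,b,c,e,f$ nonzero, such that $$\max\left\{\left|\frac{bcdef}{qx^2y^4}\right|,\left|\frac{bc}{xy^2}\right|\right\}<1,$$ and put $$ \begin{aligned} S(x,y,b,c,d;e,f)={}&\frac{x^2y}{f}\,\frac{(q,\,qx,\,1/x,\,e,\,qd/e;q)_\infty}{(y,\,b/y,\,c/y,\,d/y,\,e/y;q)_\infty}\\ &\times\frac{(qy/f,\,qxy/f,\,qxy^2/e,\,bc/xy^2,\,be/xy^2,\,ce/xy^2,\,de/xy^2,\,bdf/xy^2,\,cdf/xy^2;q)_\infty}{(xy,\,b/xy,\,c/xy,\,d/xy,\,e/xy,\,e/f,\,qdf/e,\,qxy^2/ef,\,bcdef/qx^2y^4;q)_\infty}\\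 &\times{}_8\phi_7\!\left[\begin{matrix}\frac{df}{e},\,q\sqrt{\frac{df}{e}},\,-q\sqrt{\frac{df}{e}},\,d,\,f,\,\frac{df}{xy^2},\,\frac{qxy^2}{be},\,\frac{qxy^2}{ce}\\[2pt] \sqrt{\frac{df}{e}},\,-\sqrt{\frac{df}{e}},\,\frac{qf}{e},\,\frac{qd}{e},\,\frac{qxy^2}{e},\,\frac{bdf}{xy^2},\,\frac{cdf}{xy^2}\end{matrix}\,\Big|\,q;\frac{bc}{xy^2}\right]. \end{aligned} $$ Here either square root may be taken, as the series does not depend on the choice. In fractions such as $bc/xy^2$, everything after the slash is in the denominator. Assume that no zero factor occurs in any denominator of $S(x,y,b,c,d;e,f)$, of $S(x,y,b,c,d;f,e)$, or of the two series below. Then the two series below and the two ${}_8\phi_7$-series converge absolutely, and $$ \begin{aligned} &\sum_{k=0}^\infty\Big(1-\frac{q^{2k+1}}{x}\Big)\frac{(q/xy,\,q^{-k}b/y,\,q^{-k}c/y,\,q^{-k}d/y,\,q^{-k}e/y,\,q^{-k}f/y;q)_k}{(y,\,b/xy,\,c/xy,\,d/xy,\,e/xy,\,f/xy;q)_{k+1}}\,q^{k(5k+3)/2}\Big(-\frac{y}{x^2}\Big)^k\\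 &\quad-x^2\sum_{k=0}^\infty(1-q^{2k+1}x)\frac{(q/y,\,q^{-k}b/xy,\,q^{-k}c/xy,\,q^{-k}d/xy,\,q^{-k}e/xy,\,q^{-k}f/xy;q)_k}{(xy,\,b/y,\,c/y,\,d/y,\,e/y,\,f/y;q)_{k+1}}\,q^{k(5k+3)/2}(-x^3y)^k\\ &=S(x,y,b,c,d;e,f)+S(x,y,b,c,d;f,e). \end{aligned} $$ -/

import Mathlib

noncomputable section

/-- The `q`-shifted factorial `(a;q)_n = ∏_{i=0}^{n-1} (1 - a q^i)` for `n ≥ 0`. -/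
def qFac (q a : ℂ) (n : ℕ) : ℂ := ∏ i ∈ Finset.range n, (1 - a * q ^ i)

/-- The `q`-shifted factorial of infinite order `(a;q)_∞ = ∏_{k≥0} (1 - a q^k)`, for `|q| < 1`. -/
def qFacInf (q a : ℂ) : ℂ := ∏' k : ℕ, (1 - a * q ^ k)

/-- For `|q| < 1` the infinite product defining `(a;q)_∞` converges. -/
theorem multipliable_qFacInf {q : ℂ} (hq : ‖q‖ < 1) (a : ℂ) :
    Multipliable fun k : ℕ => (1 - a * q ^ k) := by
  have h : Summable fun k : ℕ => ‖-(a * q ^ k)‖ := by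
    simpa [norm_mul, norm_pow] using
      (summable_geometric_of_lt_one (norm_nonneg q) hq).mul_left ‖a‖
  simpa [sub_eq_add_neg] using multipliable_one_add_of_summable h

/-- `(a, b, …, c; q)_n`. -/
def qFacs (q : ℂ) (as : List ℂ) (n : ℕ) : ℂ := (as.map fun a => qFac q a n).prod

/-- `(a, b, …, c; q)_∞`. -/
def qFacsInf (q : ℂ) (as : List ℂ) : ℂ := (as.map fun a => qFacInf q a).prod

/-- The `k`-th term of the unilateral basic hypergeometric series `_{1+r}φ_s` with upper
parameters `as = [a_0, …, a_r]`, lower parameters `bs = [b_1, …, b_s]`, base `q`, argument `z`. -/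
def phiTerm (as bs : List ℂ) (q z : ℂ) (k : ℕ) : ℂ :=
  qFacs q as k / qFacs q (q :: bs) k
    * ((-1) ^ k * q ^ (k.choose 2)) ^ ((bs.length : ℤ) - ((as.length : ℤ) - 1)) * z ^ k

/-- The unilateral basic hypergeometric series. -/
def phi (as bs : List ℂ) (q z : ℂ) : ℂ := ∑' k : ℕ, phiTerm as bs q z k

/-- A square root of a complex number (principal branch). -/
def csqrt (a : ℂ) : ℂ := a ^ (1 / 2 : ℂ)

/-- Upper parameters of the `₈φ₇`-series in `S(x,y,b,c,d;e,f)`. -/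
def upperPar (q x y b c d e f : ℂ) : List ℂ :=
  [d * f / e, q * csqrt (d * f / e), -(q * csqrt (d * f / e)), d, f, d * f / (x * y ^ 2),
    q * x * y ^ 2 / (b * e), q * x * y ^ 2 / (c * e)]

/-- Lower parameters of the `₈φ₇`-series in `S(x,y,b,c,d;e,f)`. -/
def lowerPar (q x y b c d e f : ℂ) : List ℂ :=
  [csqrt (d * f / e), -csqrt (d * f / e), q * f / e, q * d / e, q * x * y ^ 2 / e,
    b * d * f / (x * y ^ 2), c * d * f / (x * y ^ 2)]

/-- The expression `S(x,y,b,c,d;e,f)`. -/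
def S (q x y b c d e f : ℂ) : ℂ :=
  x ^ 2 * y / f
    * (qFacsInf q [q, q * x, 1 / x, e, q * d / e]
        / qFacsInf q [y, b / y, c / y, d / y, e / y])
    * (qFacsInf q [q * y / f, q * x * y / f, q * x * y ^ 2 / e, b * c / (x * y ^ 2),
          b * e / (x * y ^ 2), c * e / (x * y ^ 2), d * e / (x * y ^ 2),
          b * d * f / (x * y ^ 2), c * d * f / (x * y ^ 2)]
        / qFacsInf q [x * y, b / (x * y), c / (x * y), d / (x * y), e / (x * y), e / f,
          q * d * f / e, q * x * y ^ 2 / (e * f), b * c * d * e * f / (q * x ^ 2 * y ^ 4)])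
    * phi (upperPar q x y b c d e f) (lowerPar q x y b c d e f) q (b * c / (x * y ^ 2))

/-- The `k`-th term of the first series on the left-hand side. -/
def firstTerm (q x y b c d e f : ℂ) (k : ℕ) : ℂ :=
  (1 - q ^ (2 * k + 1) / x)
    * (qFacs q [q / (x * y), (q ^ k)⁻¹ * b / y, (q ^ k)⁻¹ * c / y, (q ^ k)⁻¹ * d / y,
          (q ^ k)⁻¹ * e / y, (q ^ k)⁻¹ * f / y] k
        / qFacs q [y, b / (x * y), c / (x * y), d / (x * y), e / (x * y), f / (x * y)] (k + 1))
    * q ^ (k * (5 * k + 3) / 2) * (-y / x ^ 2) ^ k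

/-- The `k`-th term of the second series on the left-hand side (without the factor `x²`). -/
def secondTerm (q x y b c d e f : ℂ) (k : ℕ) : ℂ :=
  (1 - q ^ (2 * k + 1) * x)
    * (qFacs q [q / y, (q ^ k)⁻¹ * b / (x * y), (q ^ k)⁻¹ * c / (x * y),
          (q ^ k)⁻¹ * d / (x * y), (q ^ k)⁻¹ * e / (x * y), (q ^ k)⁻¹ * f / (x * y)] k
        / qFacs q [x * y, b / y, c / y, d / y, e / y, f / y] (k + 1))
    * q ^ (k * (5 * k + 3) / 2) * (-(x ^ 3 * y)) ^ k

end

section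

open Filter Topology

/-! After multiplication by `seriesNorm`, the two series on the left become the halves `k ≥ 0` and
`k < 0` of one bilateral very-well-poised series `wpSum q x 3` with parameters `b/y, c/y, d/y, e/y,
f/y, x*y`. The theorem is then a transformation of such a series with six parameters `b, c, d, e, f,
g` into two `₈φ₇`-parts (`vwpPart`) exchanged by `e ↔ f`, specialized to `g = x*y`; `defect` is the
difference of the two sides.

Each piece `F(b, c)` of the defect satisfies the same contiguous relation `c F(b/q, c) - b F(b, c/q)
= (c - b)(1 - bc/(qx)) F(b, c)` (`wpSum_pair`, `vwpPart_pair`), which comes termwise from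
`c(1-bu)(1-bv) - b(1-cu)(1-cv) = (c-b)(1-bcuv)` with `uv` independent of the summation index. So the
defect vanishes on a grid `b = (x/g)q^M`, `c = (x/d)q^K` as soon as it vanishes on the edges `b =
x/g` and `c = x/d`. The grid accumulates at `(0, 0)`, and the identity theorem in each variable
gives vanishing for all admissible `b, c`.

On an edge the parameters `x/g` and `g` merge into theta functions. The bilateral series reduces to
Bailey's `₆ψ₆`, each `₈φ₇` to a `₆φ₅`, which is again a `₆ψ₆`, and the remaining identity is
Weierstrass' three-term theta relation (`defect_base`).

Bailey's sum (`wpSum_four`) is proved by the same scheme: on the line `b = xq^{-k}`, `c = q^{k+1}`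
the series has a single term, the contiguous relation propagates this, and the identity theorem
concludes. With all parameters zero it gives Jacobi's triple product. This makes products of two
thetas rank-two kernels, and Weierstrass' relation is the vanishing of a Pfaffian.

The genericity and size conditions used on the grid are removed by continuation in `t` along `(d/t²,
et, ft)` (`defect_eq_zero_of_ne_zero`), and `d = 0` is reached as a limit. -/

/-! ### Convergence and holomorphy of series given by their term ratio. -/

/-- The bounds needed for the Weierstrass test of a series whose term ratio is `ρ w (q ^ k)`. -/
theorem exists_majorant_ratio {q : ℂ} (hq1 : ‖q‖ < 1) {ρ g : ℂ → ℂ → ℂ} {w₀ : ℂ}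
    (hρ : ContinuousAt (Function.uncurry ρ) (w₀, 0)) (hρ1 : ‖ρ w₀ 0‖ < 1)
    (hg : ContinuousAt (Function.uncurry g) (w₀, 0))
    (hρc : ∀ i : ℕ, ContinuousAt (fun w => ρ w (q ^ i)) w₀)
    (hgc : ∀ i : ℕ, ContinuousAt (fun w => g w (q ^ i)) w₀) :
    ∃ u : ℕ → ℝ, Summable u ∧ ∀ᶠ w in 𝓝 w₀, ∀ k : ℕ,
      ‖g w (q ^ k) * ∏ i ∈ Finset.range k, ρ w (q ^ i)‖ ≤ u k := by
  obtain ⟨θ, hθ0, hθ1⟩ := exists_between hρ1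
  have hθ : 0 < θ := lt_of_le_of_lt (norm_nonneg _) hθ0
  have h1 : ∀ᶠ z in 𝓝 (w₀, (0 : ℂ)), ‖Function.uncurry ρ z‖ < θ :=
    hρ.norm.eventually_lt continuousAt_const hθ0
  have h2 : ∀ᶠ z in 𝓝 (w₀, (0 : ℂ)), ‖Function.uncurry g z‖ < ‖g w₀ 0‖ + 1 :=
    hg.norm.eventually_lt continuousAt_const (by simp [Function.uncurry])
  have h3 := h1.and h2
  rw [nhds_prod_eq] at h3
  obtain ⟨pa, hpa, pb, hpb, h3⟩ := eventually_prod_iff.1 h3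
  have hlim : Tendsto (fun i : ℕ => q ^ i) atTop (𝓝 0) :=
    tendsto_pow_atTop_nhds_zero_of_norm_lt_one hq1
  obtain ⟨N, hN⟩ := eventually_atTop.1 (hlim.eventually hpb)
  -- From index `N` on, `q ^ i` lies in the neighbourhood of 0 where the joint bounds hold; the
  -- finitely many earlier factors are controlled by continuity at `w₀` and cost only a constant.
  set R : ℕ → ℝ := fun i => if i < N then ‖ρ w₀ (q ^ i)‖ + 1 else θ with hR
  set G : ℕ → ℝ := fun i => if i < N then ‖g w₀ (q ^ i)‖ + 1 else ‖g w₀ 0‖ + 1 with hG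
  have hRpos : ∀ i, 0 < R i := by
    intro i; simp only [hR]; split_ifs <;> positivity
  have hGpos : ∀ i, 0 < G i := by
    intro i; simp only [hG]; split_ifs <;> positivity
  refine ⟨fun k => G k * ∏ i ∈ Finset.range k, R i, ?_, ?_⟩
  · refine summable_of_ratio_norm_eventually_le hθ1 ?_
    filter_upwards [eventually_ge_atTop N] with k hk
    have e1 : G (k + 1) = G k := by
      simp only [hG]; rw [if_neg (by omega), if_neg (by omega)]
    have e2 : R k = θ := by
      simp only [hR]; rw [if_neg (by omega)]
    rw [Finset.prod_range_succ, e1, e2, ← mul_assoc, norm_mul, mul_comm, Real.norm_of_nonneg hθ.le]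
  · have e1 : ∀ᶠ w in 𝓝 w₀, ∀ i ∈ Finset.range N, ‖ρ w (q ^ i)‖ < ‖ρ w₀ (q ^ i)‖ + 1 := by
      rw [Finset.eventually_all]
      intro i _
      exact (hρc i).norm.eventually_lt continuousAt_const (by simp)
    have e2 : ∀ᶠ w in 𝓝 w₀, ∀ i ∈ Finset.range N, ‖g w (q ^ i)‖ < ‖g w₀ (q ^ i)‖ + 1 := by
      rw [Finset.eventually_all]
      intro i _
      exact (hgc i).norm.eventually_lt continuousAt_const (by simp)
    filter_upwards [e1, e2, hpa] with w hw1 hw2 hw3 k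
    rw [norm_mul, norm_prod]
    have a1 : ∀ i, ‖ρ w (q ^ i)‖ ≤ R i := by
      intro i; simp only [hR]; split_ifs with hi
      · exact (hw1 i (Finset.mem_range.2 hi)).le
      · exact (h3 hw3 (hN i (by omega))).1.le
    have a2 : ‖g w (q ^ k)‖ ≤ G k := by
      simp only [hG]; split_ifs with hi
      · exact (hw2 k (Finset.mem_range.2 hi)).le
      · exact (h3 hw3 (hN k (by omega))).2.le
    exact mul_le_mul a2 (Finset.prod_le_prod (fun _ _ => norm_nonneg _) fun i _ => a1 i)
      (Finset.prod_nonneg fun _ _ => norm_nonneg _) (hGpos k).le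

/-- All unilateral series below are brought to this form, in which the ratio of consecutive products
tends to `ρ 0`; convergence then amounts to `‖ρ 0‖ < 1`. -/
theorem summable_ratio {q : ℂ} (hq1 : ‖q‖ < 1) {ρ g : ℂ → ℂ}
    (hρ : ContinuousAt ρ 0) (hρ1 : ‖ρ 0‖ < 1) (hg : ContinuousAt g 0) :
    Summable fun k : ℕ => g (q ^ k) * ∏ i ∈ Finset.range k, ρ (q ^ i) := by
  obtain ⟨u, hu, h⟩ := exists_majorant_ratio (w₀ := 0) hq1 (ρ := fun _ => ρ) (g := fun _ => g)
    (ContinuousAt.comp (x := ((0 : ℂ), (0 : ℂ))) (f := Prod.snd) (g := ρ) hρ continuousAt_snd) hρ1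
    (ContinuousAt.comp (x := ((0 : ℂ), (0 : ℂ))) (f := Prod.snd) (g := g) hg continuousAt_snd)
    (fun _ => continuousAt_const) (fun _ => continuousAt_const)
  exact Summable.of_norm_bounded hu h.self_of_nhds

theorem differentiableOn_ratio {q : ℂ} (hq1 : ‖q‖ < 1) {ρ g : ℂ → ℂ → ℂ} {U : Set ℂ}
    (hU : IsOpen U) (hρ : ∀ w ∈ U, ContinuousAt (Function.uncurry ρ) (w, 0))
    (hρ1 : ∀ w ∈ U, ‖ρ w 0‖ < 1) (hg : ∀ w ∈ U, ContinuousAt (Function.uncurry g) (w, 0))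
    (hρd : ∀ i : ℕ, DifferentiableOn ℂ (fun w => ρ w (q ^ i)) U)
    (hgd : ∀ i : ℕ, DifferentiableOn ℂ (fun w => g w (q ^ i)) U) :
    DifferentiableOn ℂ
      (fun w => ∑' k : ℕ, g w (q ^ k) * ∏ i ∈ Finset.range k, ρ w (q ^ i)) U := by
  intro w₀ hw₀
  have hUn := hU.mem_nhds hw₀
  obtain ⟨u, hu, h⟩ := exists_majorant_ratio hq1 (hρ w₀ hw₀) (hρ1 w₀ hw₀) (hg w₀ hw₀)
    (fun i => ((hρd i).differentiableAt hUn).continuousAt)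
    (fun i => ((hgd i).differentiableAt hUn).continuousAt)
  obtain ⟨V, hV, hVo, hwV⟩ := eventually_nhds_iff.1 (h.and hUn)
  have hVU : V ⊆ U := fun w hw => (hV w hw).2
  refine ((Complex.differentiableOn_tsum_of_summable_norm hu (fun k => ?_) hVo
    (fun k w hw => (hV w hw).1 k)).differentiableAt (hVo.mem_nhds hwV)).differentiableWithinAt
  exact ((hgd k).mono hVU).mul (DifferentiableOn.fun_finsetProd fun i _ => (hρd i).mono hVU)

/-! ### Infinite `q`-products. -/

theorem summable_norm_qpow {q : ℂ} (hq1 : ‖q‖ < 1) (a : ℂ) :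
    Summable fun k : ℕ => ‖-(a * q ^ k)‖ := by
  simpa [norm_mul, norm_pow] using
    (summable_geometric_of_lt_one (norm_nonneg q) hq1).mul_left ‖a‖

theorem qFac_zero (q a : ℂ) : qFac q a 0 = 1 := by simp [qFac]

theorem qFac_succ (q a : ℂ) (n : ℕ) : qFac q a (n + 1) = qFac q a n * (1 - a * q ^ n) := by
  simp [qFac, Finset.prod_range_succ]

theorem qFacInf_eq {q : ℂ} (hq1 : ‖q‖ < 1) (a : ℂ) :
    qFacInf q a = (1 - a) * qFacInf q (a * q) := by
  unfold qFacInf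
  rw [tprod_eq_zero_mul' (f := fun k : ℕ => 1 - a * q ^ k)]
  · simp only [pow_zero, mul_one, pow_succ', mul_assoc]
  · have := multipliable_qFacInf hq1 (a * q)
    simpa only [pow_succ', mul_assoc] using this

theorem qFacInf_eq_qFac_mul {q : ℂ} (hq1 : ‖q‖ < 1) (a : ℂ) (n : ℕ) :
    qFacInf q a = qFac q a n * qFacInf q (a * q ^ n) := by
  induction n with
  | zero => simp [qFac_zero]
  | succ n ih =>
    rw [ih, qFac_succ, qFacInf_eq hq1 (a * q ^ n), pow_succ, mul_assoc, mul_assoc]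

theorem qFacInf_ne_zero {q : ℂ} (hq1 : ‖q‖ < 1) {a : ℂ} (h : ∀ n : ℕ, a * q ^ n ≠ 1) :
    qFacInf q a ≠ 0 := by
  have := tprod_one_add_ne_zero_of_summable (f := fun k : ℕ => -(a * q ^ k))
    (fun k => by rw [← sub_eq_add_neg, sub_ne_zero]; exact (h k).symm) (summable_norm_qpow hq1 a)
  simpa [qFacInf, sub_eq_add_neg] using this

theorem qFacInf_eq_zero {q : ℂ} (hq1 : ‖q‖ < 1) {a : ℂ} {n : ℕ} (h : a * q ^ n = 1) :
    qFacInf q a = 0 := by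
  rw [qFacInf_eq_qFac_mul hq1 a (n + 1), qFac_succ, h]; simp

theorem qFacInf_ne_zero_iff {q : ℂ} (hq1 : ‖q‖ < 1) {a : ℂ} :
    qFacInf q a ≠ 0 ↔ ∀ n : ℕ, a * q ^ n ≠ 1 :=
  ⟨fun h _ hn => h (qFacInf_eq_zero hq1 hn), qFacInf_ne_zero hq1⟩

theorem qFacInf_zero (q : ℂ) : qFacInf q 0 = 1 := by simp [qFacInf]

theorem qFacInf_ne_zero_of_norm_lt {q : ℂ} (hq1 : ‖q‖ < 1) {a : ℂ} (h : ‖a‖ < 1) :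
    qFacInf q a ≠ 0 := by
  refine qFacInf_ne_zero hq1 fun n hn => ?_
  have h1 : ‖a * q ^ n‖ ≤ ‖a‖ * 1 := by
    rw [norm_mul, norm_pow]
    exact mul_le_mul_of_nonneg_left (pow_le_one₀ (norm_nonneg _) hq1.le) (norm_nonneg _)
  rw [hn, norm_one] at h1
  linarith

theorem differentiable_qFacInf {q : ℂ} (hq1 : ‖q‖ < 1) : Differentiable ℂ (qFacInf q) := by
  intro a
  have hU : IsOpen (Metric.ball (0 : ℂ) (‖a‖ + 1)) := Metric.isOpen_ball
  have hu : Summable fun k : ℕ => (‖a‖ + 1) * ‖q‖ ^ k :=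
    (summable_geometric_of_lt_one (norm_nonneg q) hq1).mul_left _
  have H := hu.hasProdLocallyUniformlyOn_nat_one_add (f := fun (k : ℕ) (z : ℂ) => -(z * q ^ k)) hU
    (Eventually.of_forall fun n z hz => by
      rw [norm_neg, norm_mul, norm_pow]
      exact mul_le_mul_of_nonneg_right (by simpa using (Metric.mem_ball.1 hz).le) (by positivity))
    (fun n => by fun_prop)
  rw [hasProdLocallyUniformlyOn_iff_tendstoLocallyUniformlyOn] at H
  have D := H.differentiableOn (Eventually.of_forall fun s => by
    apply DifferentiableOn.fun_finsetProd
    intro i _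
    fun_prop) hU
  have := D.differentiableAt (hU.mem_nhds (show a ∈ Metric.ball (0 : ℂ) (‖a‖ + 1) by simp))
  refine this.congr_of_eventuallyEq (Eventually.of_forall fun z => ?_)
  simp [qFacInf, sub_eq_add_neg]

/-! ### The theta function and its quasi-periodicity. -/

/-- The modified theta function `(z, q/z; q)_∞`. -/
noncomputable def qTheta (q z : ℂ) : ℂ := qFacInf q z * qFacInf q (q / z)

theorem qTheta_mul {q : ℂ} (hq0 : q ≠ 0) (hq1 : ‖q‖ < 1) {z : ℂ} (hz : z ≠ 0) :
    qTheta q (z * q) = -z⁻¹ * qTheta q z := by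
  unfold qTheta
  have e : q / (z * q) = z⁻¹ := by field_simp
  rw [e, qFacInf_eq hq1 z, qFacInf_eq hq1 z⁻¹, show z⁻¹ * q = q / z by field_simp]
  field_simp
  ring

theorem qTheta_inv {q : ℂ} (hq1 : ‖q‖ < 1) {z : ℂ} (hz : z ≠ 0) :
    qTheta q z⁻¹ = -z⁻¹ * qTheta q z := by
  unfold qTheta
  rw [qFacInf_eq hq1 z, qFacInf_eq hq1 z⁻¹, show z⁻¹ * q = q / z by field_simp,
    show q / z⁻¹ = z * q by field_simp]
  field_simp
  ring

/-- Quasi-periodicity of theta over the integers; `T k = k (k - 1) / 2`. -/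
theorem qTheta_mul_zpow {q : ℂ} (hq0 : q ≠ 0) (hq1 : ‖q‖ < 1) {z : ℂ} (hz : z ≠ 0) (k : ℤ) :
    qTheta q (z * q ^ (2 * k)) = q ^ (-(k * (2 * k - 1))) * z ^ (-(2 * k)) * qTheta q z := by
  -- Shifting by two powers of `q` at a time removes the signs and keeps the exponents free of
  -- halves.
  have step : ∀ j : ℤ, qTheta q (z * q ^ (2 * (j + 1)))
      = q ^ (-(4 * j + 1)) * z ^ (-2 : ℤ) * qTheta q (z * q ^ (2 * j)) := by
    intro j
    have e : z * q ^ (2 * (j + 1)) = (z * q ^ (2 * j)) * q * q := by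
      rw [show 2 * (j + 1) = 2 * j + 1 + 1 by ring, zpow_add_one₀ hq0, zpow_add_one₀ hq0]; ring
    have h0 : z * q ^ (2 * j) ≠ 0 := mul_ne_zero hz (zpow_ne_zero _ hq0)
    rw [e, qTheta_mul hq0 hq1 (mul_ne_zero h0 hq0), qTheta_mul hq0 hq1 h0,
      show -(4 * j + 1) = -(2 * j) - (2 * j) - 1 by ring, zpow_sub₀ hq0, zpow_sub₀ hq0, zpow_neg,
      zpow_one, show (-2 : ℤ) = -(1 + 1) by ring, zpow_neg, zpow_add₀ hz, zpow_one]
    have := zpow_ne_zero (2 * j) hq0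
    field_simp
  induction k with
  | zero => simp
  | succ n ih =>
    rw [step, ih]
    have e1 : q ^ (-(((n : ℤ) + 1) * (2 * (n + 1) - 1)))
        = q ^ (-(4 * (n : ℤ) + 1)) * q ^ (-((n : ℤ) * (2 * n - 1))) := by
      rw [← zpow_add₀ hq0]; congr 1; ring
    have e2 : z ^ (-(2 * ((n : ℤ) + 1))) = z ^ (-2 : ℤ) * z ^ (-(2 * (n : ℤ))) := by
      rw [← zpow_add₀ hz]; congr 1; ring
    rw [e1, e2]; ring
  | pred n ih =>
    have s := step (-(n : ℤ) - 1)
    rw [sub_add_cancel, ih] at s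
    have e1 : q ^ (-((-(n : ℤ)) * (2 * (-(n : ℤ)) - 1)))
        = q ^ (-(4 * (-(n : ℤ) - 1) + 1)) * q ^ (-((-(n : ℤ) - 1) * (2 * (-(n : ℤ) - 1) - 1))) := by
      rw [← zpow_add₀ hq0]; congr 1; ring
    have e2 : z ^ (-(2 * (-(n : ℤ)))) = z ^ (-2 : ℤ) * z ^ (-(2 * (-(n : ℤ) - 1))) := by
      rw [← zpow_add₀ hz]; congr 1; ring
    rw [e1, e2] at s
    have h1 : q ^ (-(4 * (-(n : ℤ) - 1) + 1)) * z ^ (-2 : ℤ) ≠ 0 :=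
      mul_ne_zero (zpow_ne_zero _ hq0) (zpow_ne_zero _ hz)
    apply mul_left_cancel₀ h1
    rw [← s]; ring

/-! ### Very-well-poised bilateral series. -/

/-- The factor `(q^{-k} p, q^{k+1} p / x; q)_∞` of a very-well-poised bilateral series. -/
noncomputable def wpFactor (q x p : ℂ) (k : ℤ) : ℂ :=
  qFacInf q (p * q ^ (-k)) * qFacInf q (p * q ^ (k + 1) / x)

/-- The `k`-th term of a very-well-poised bilateral series with `n` parameters. -/
noncomputable def wpTerm (q x : ℂ) (r : ℕ) {n : ℕ} (p : Fin n → ℂ) (k : ℤ) : ℂ :=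
  (1 - q ^ (2 * k + 1) / x) * (q ^ (r * (k * (k + 1)) - k) * x ^ (-(r * k)))
    * ∏ i, wpFactor q x (p i) k

/-- A very-well-poised bilateral series. -/
noncomputable def wpSum (q x : ℂ) (r : ℕ) {n : ℕ} (p : Fin n → ℂ) : ℂ :=
  ∑' k : ℤ, wpTerm q x r p k

theorem wpFactor_div {q : ℂ} (hq0 : q ≠ 0) (hq1 : ‖q‖ < 1) (x p : ℂ) (k : ℤ) :
    wpFactor q x (p / q) k
      = (1 - p * q ^ (-k - 1)) * (1 - p * q ^ k / x) * wpFactor q x p k := by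
  unfold wpFactor
  rw [qFacInf_eq hq1 (p / q * q ^ (-k)), qFacInf_eq hq1 (p / q * q ^ (k + 1) / x)]
  have e1 : p / q * q ^ (-k) = p * q ^ (-k - 1) := by rw [zpow_sub_one₀ hq0]; ring
  have e2 : p / q * q ^ (k + 1) / x = p * q ^ k / x := by
    rw [zpow_add_one₀ hq0]; field_simp
  have e3 : p * q ^ (-k - 1) * q = p * q ^ (-k) := by
    rw [zpow_sub_one₀ hq0]; field_simp
  have e4 : p * q ^ k / x * q = p * q ^ (k + 1) / x := by rw [zpow_add_one₀ hq0]; ring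
  rw [e1, e2, e3, e4]; ring

/-- Dividing a parameter `b` by `q` produces `(1 - bu)(1 - bv)` with `u = q^{-k-1}`, `v = q^k/x`.
The terms in `u + v` cancel in the difference, and `uv = 1/(qx)` does not depend on `k`; hence the
relation survives summation over `k`. -/
theorem wpFactor_pair {q : ℂ} (hq0 : q ≠ 0) (hq1 : ‖q‖ < 1) (x b c : ℂ) (k : ℤ) :
    c * (wpFactor q x (b / q) k * wpFactor q x c k)
      - b * (wpFactor q x b k * wpFactor q x (c / q) k)
      = (c - b) * (1 - b * c / (q * x)) * (wpFactor q x b k * wpFactor q x c k) := by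
  rw [wpFactor_div hq0 hq1, wpFactor_div hq0 hq1]
  have e : q ^ (-k - 1) * (q ^ k / x) = 1 / (q * x) := by
    rw [zpow_sub_one₀ hq0, zpow_neg]
    have := zpow_ne_zero k hq0
    field_simp
  rw [mul_div_assoc b, mul_div_assoc c]
  generalize q ^ (-k - 1) = u at *
  generalize q ^ k / x = v at *
  linear_combination (c - b) * b * c * (wpFactor q x b k * wpFactor q x c k) * (-1) * e

theorem wpFactor_inv {q x : ℂ} (hx : x ≠ 0) (p : ℂ) (k : ℤ) :
    wpFactor q x p (-(k + 1)) = wpFactor q x⁻¹ (p / x) k := by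
  unfold wpFactor
  rw [mul_comm]
  congr 2
  · rw [show -(k + 1) + 1 = -k by ring]; ring
  · rw [neg_neg]; field_simp

/-- The reflection `k ↦ -(k+1)` exchanges the two products in each factor. It makes the negative
half a series of the same kind in `x⁻¹`, the source of the second series of the theorem. -/
theorem wpTerm_neg {q : ℂ} (hq0 : q ≠ 0) {x : ℂ} (hx : x ≠ 0) (r : ℕ) {n : ℕ} (p : Fin n → ℂ)
    (k : ℤ) :
    wpTerm q x r p (-(k + 1))
      = -x ^ ((r : ℤ) - 1) * wpTerm q x⁻¹ r (fun i => p i / x) k := by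
  unfold wpTerm
  simp only [wpFactor_inv hx]
  have e1 : q ^ (r * (-(k + 1) * (-(k + 1) + 1)) - -(k + 1))
      = q ^ (2 * k + 1) * q ^ (r * (k * (k + 1)) - k) := by
    rw [← zpow_add₀ hq0]; congr 1; ring
  have e2 : x ^ (-(r * -(k + 1))) = x * x ^ ((r : ℤ) - 1) * x⁻¹ ^ (-(r * k)) := by
    rw [inv_zpow, ← zpow_neg, mul_assoc, ← zpow_add₀ hx, ← zpow_one_add₀ hx]; congr 1; ring
  have e3 : q ^ (2 * -(k + 1) + 1) = (q ^ (2 * k + 1))⁻¹ := by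
    rw [← zpow_neg]; congr 1; ring
  rw [e1, e2, e3]
  have := zpow_ne_zero (2 * k + 1) hq0
  field_simp
  ring

/-- With `n = 2 * r` parameters the negative powers of `q` released by the shifted products cancel
the quadratic exponent. What is left is a product of ratios in `q ^ j` whose value at 0 is `(∏ p i)
/ (q * x ^ r)`, the quantity that governs convergence. -/
theorem prod_wpFactor_eq {q : ℂ} (hq0 : q ≠ 0) (hq1 : ‖q‖ < 1) {x : ℂ} (hx : x ≠ 0) {r n : ℕ}
    (hn : n = 2 * r) (p : Fin n → ℂ) (k : ℕ) :
    q ^ ((r : ℤ) * (k * (k + 1)) - k) * x ^ (-((r : ℤ) * k)) * ∏ i, qFacInf q (p i * q ^ (-(k : ℤ)))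
      = (∏ i, qFacInf q (p i))
        * ∏ j ∈ Finset.range k, (∏ i, (q * q ^ j - p i)) / (q * x ^ r) := by
  induction k with
  | zero => simp
  | succ k ih =>
    rw [Finset.prod_range_succ, ← mul_assoc (∏ i, qFacInf q (p i)), ← ih]
    have e1 : ∀ i, qFacInf q (p i * q ^ (-((k + 1 : ℕ) : ℤ)))
        = (q * q ^ k - p i) * (q ^ (k + 1))⁻¹ * qFacInf q (p i * q ^ (-(k : ℤ))) := by
      intro i
      rw [qFacInf_eq hq1, zpow_neg, zpow_natCast, zpow_neg, zpow_natCast]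
      congr 1
      · field_simp; ring
      · congr 1; field_simp; ring
    simp only [e1]
    rw [Finset.prod_mul_distrib, Finset.prod_mul_distrib, Finset.prod_const, Finset.card_univ,
      Fintype.card_fin,
      show (q ^ (k + 1))⁻¹ ^ n = (q ^ (k + 1))⁻¹ ^ (2 * r) by rw [hn]]
    have e2 : q ^ ((r : ℤ) * ((k + 1 : ℕ) * ((k + 1 : ℕ) + 1)) - (k + 1 : ℕ))
        = q ^ ((r : ℤ) * (k * (k + 1)) - k) * (q ^ (k + 1)) ^ (2 * r) / q := by
      rw [← pow_mul, ← zpow_natCast q ((k + 1) * (2 * r)), ← zpow_add₀ hq0, div_eq_mul_inv,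
        ← zpow_sub_one₀ hq0]
      congr 1; push_cast; ring
    have e3 : x ^ (-((r : ℤ) * (k + 1 : ℕ))) = x ^ (-((r : ℤ) * k)) / x ^ r := by
      rw [← zpow_natCast x r, ← zpow_sub₀ hx]; congr 1; push_cast; ring
    have e4 : (q ^ (k + 1)) ^ (2 * r) ≠ 0 := pow_ne_zero _ (pow_ne_zero _ hq0)
    rw [e2, e3, inv_pow]
    generalize (q ^ (k + 1)) ^ (2 * r) = Y at *
    generalize (∏ i, qFacInf q (p i * q ^ (-(k : ℤ)))) = Z
    field_simp

theorem wpTerm_natCast {q : ℂ} (hq0 : q ≠ 0) (hq1 : ‖q‖ < 1) {x : ℂ} (hx : x ≠ 0) {r n : ℕ}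
    (hn : n = 2 * r) (p : Fin n → ℂ) (k : ℕ) :
    wpTerm q x r p k = ((1 - q * (q ^ k) ^ 2 / x)
        * ∏ i, (qFacInf q (p i) * qFacInf q (p i * q * q ^ k / x)))
      * ∏ j ∈ Finset.range k, (∏ i, (q * q ^ j - p i)) / (q * x ^ r) := by
  have h := prod_wpFactor_eq hq0 hq1 hx hn p k
  unfold wpTerm wpFactor
  rw [Finset.prod_mul_distrib, Finset.prod_mul_distrib]
  have e1 : q ^ (2 * (k : ℤ) + 1) = q * (q ^ k) ^ 2 := by
    rw [zpow_add_one₀ hq0, ← pow_mul, mul_comm k 2, ← zpow_natCast]; push_cast; ring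
  have e2 : ∀ i, p i * q ^ ((k : ℤ) + 1) / x = p i * q * q ^ k / x := by
    intro i; rw [zpow_add_one₀ hq0, zpow_natCast]; ring
  simp only [e1, e2]
  linear_combination (1 - q * (q ^ k) ^ 2 / x) * (∏ i, qFacInf q (p i * q * q ^ k / x)) * h

theorem summable_wpTerm_nat {q : ℂ} (hq0 : q ≠ 0) (hq1 : ‖q‖ < 1) {x : ℂ} (hx : x ≠ 0) {r n : ℕ}
    (hn : n = 2 * r) (p : Fin n → ℂ) (hp : ‖(∏ i, p i) / (q * x ^ r)‖ < 1) :
    Summable fun k : ℕ => wpTerm q x r p k := by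
  have hP := (differentiable_qFacInf hq1).continuous
  simp only [wpTerm_natCast hq0 hq1 hx hn]
  refine summable_ratio hq1 (ρ := fun s => (∏ i, (q * s - p i)) / (q * x ^ r))
    (g := fun s => (1 - q * s ^ 2 / x) * ∏ i, (qFacInf q (p i) * qFacInf q (p i * q * s / x)))
    (by fun_prop) ?_ (by fun_prop)
  simpa [norm_prod] using hp

/-- The convergence condition is invariant under the reflection, so one bound serves both halves. -/
theorem norm_prod_div {q : ℂ} {x : ℂ} (hx : x ≠ 0) {r n : ℕ}
    (hn : n = 2 * r) (p : Fin n → ℂ) :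
    ‖(∏ i, p i / x) / (q * x⁻¹ ^ r)‖ = ‖(∏ i, p i) / (q * x ^ r)‖ := by
  rw [Finset.prod_div_distrib, Finset.prod_const, Finset.card_univ, Fintype.card_fin]
  congr 1
  have : x ^ n = x ^ r * x ^ r := by rw [← pow_add, hn, two_mul]
  rw [this, inv_pow]
  field_simp

theorem summable_wpTerm_neg {q : ℂ} (hq0 : q ≠ 0) (hq1 : ‖q‖ < 1) {x : ℂ} (hx : x ≠ 0) {r n : ℕ}
    (hn : n = 2 * r) (p : Fin n → ℂ) (hp : ‖(∏ i, p i) / (q * x ^ r)‖ < 1) :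
    Summable fun k : ℕ => wpTerm q x r p (-((k : ℤ) + 1)) := by
  simp only [wpTerm_neg hq0 hx]
  exact (summable_wpTerm_nat hq0 hq1 (inv_ne_zero hx) hn _
    (by rwa [norm_prod_div hx hn])).mul_left _

theorem summable_wpTerm {q : ℂ} (hq0 : q ≠ 0) (hq1 : ‖q‖ < 1) {x : ℂ} (hx : x ≠ 0) {r n : ℕ}
    (hn : n = 2 * r) (p : Fin n → ℂ) (hp : ‖(∏ i, p i) / (q * x ^ r)‖ < 1) :
    Summable (wpTerm q x r p) :=
  Summable.of_nat_of_neg_add_one (summable_wpTerm_nat hq0 hq1 hx hn p hp)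
    (summable_wpTerm_neg hq0 hq1 hx hn p hp)

theorem wpSum_eq {q : ℂ} (hq0 : q ≠ 0) (hq1 : ‖q‖ < 1) {x : ℂ} (hx : x ≠ 0) {r n : ℕ}
    (hn : n = 2 * r) (p : Fin n → ℂ) (hp : ‖(∏ i, p i) / (q * x ^ r)‖ < 1) :
    wpSum q x r p = ∑' k : ℕ, wpTerm q x r p k
      - x ^ ((r : ℤ) - 1) * ∑' k : ℕ, wpTerm q x⁻¹ r (fun i => p i / x) k := by
  unfold wpSum
  rw [tsum_of_nat_of_neg_add_one (summable_wpTerm_nat hq0 hq1 hx hn p hp)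
    (summable_wpTerm_neg hq0 hq1 hx hn p hp)]
  simp only [wpTerm_neg hq0 hx, tsum_mul_left]
  ring

theorem differentiableOn_tsum_wpTerm {q : ℂ} (hq0 : q ≠ 0) (hq1 : ‖q‖ < 1) {x : ℂ} (hx : x ≠ 0)
    {r n : ℕ} (hn : n = 2 * r) {U : Set ℂ} (hU : IsOpen U) (p : Fin n → ℂ → ℂ)
    (hpd : ∀ i, DifferentiableOn ℂ (p i) U)
    (hp : ∀ w ∈ U, ‖(∏ i, p i w) / (q * x ^ r)‖ < 1) :
    DifferentiableOn ℂ (fun w => ∑' k : ℕ, wpTerm q x r (fun i => p i w) k) U := by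
  have hP := differentiable_qFacInf hq1
  have hPc := hP.continuous
  simp only [wpTerm_natCast hq0 hq1 hx hn]
  have hpc : ∀ w ∈ U, ∀ i, ContinuousAt (fun z : ℂ × ℂ => p i z.1) (w, 0) := fun w hw i =>
    ContinuousAt.comp (x := (w, (0 : ℂ))) (f := Prod.fst) (g := p i)
      ((hpd i).differentiableAt (hU.mem_nhds hw)).continuousAt continuousAt_fst
  refine differentiableOn_ratio hq1
    (ρ := fun w s => (∏ i, (q * s - p i w)) / (q * x ^ r))
    (g := fun w s =>
      (1 - q * s ^ 2 / x) * ∏ i, (qFacInf q (p i w) * qFacInf q (p i w * q * s / x)))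
    hU ?_ ?_ ?_ ?_ ?_
  · intro w hw
    have := hpc w hw
    exact ContinuousAt.div_const (tendsto_finsetProd _ fun i _ =>
      ((continuousAt_const.mul continuousAt_snd).sub (this i))) _
  · intro w hw
    simpa [norm_prod] using hp w hw
  · intro w hw
    have := hpc w hw
    refine ContinuousAt.mul (f := fun z : ℂ × ℂ => 1 - q * z.2 ^ 2 / x) (by fun_prop) ?_
    refine tendsto_finsetProd _ fun i _ => ?_
    exact (hPc.continuousAt.comp (this i)).mul (hPc.continuousAt.comp
      (f := fun z : ℂ × ℂ => p i z.1 * q * z.2 / x)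
      (((this i).mul_const q).mul continuousAt_snd |>.div_const x))
  · intro j
    fun_prop
  · intro j
    fun_prop

theorem differentiableOn_wpSum {q : ℂ} (hq0 : q ≠ 0) (hq1 : ‖q‖ < 1) {x : ℂ} (hx : x ≠ 0)
    {r n : ℕ} (hn : n = 2 * r) {U : Set ℂ} (hU : IsOpen U) (p : Fin n → ℂ → ℂ)
    (hpd : ∀ i, DifferentiableOn ℂ (p i) U)
    (hp : ∀ w ∈ U, ‖(∏ i, p i w) / (q * x ^ r)‖ < 1) :
    DifferentiableOn ℂ (fun w => wpSum q x r (fun i => p i w)) U := by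
  have h1 := differentiableOn_tsum_wpTerm hq0 hq1 hx hn hU p hpd hp
  have h2 := differentiableOn_tsum_wpTerm hq0 hq1 (inv_ne_zero hx) hn hU (fun i w => p i w / x)
    (fun i => (hpd i).div_const x) (fun w hw => by
      rw [norm_prod_div hx hn (fun i => p i w)]; exact hp w hw)
  exact (h1.sub (h2.const_mul (x ^ ((r : ℤ) - 1)))).congr fun w hw =>
    wpSum_eq hq0 hq1 hx hn _ (hp w hw)

/-! ### The identity theorem on geometric grids. -/

theorem isOpen_norm_mul_lt (κ : ℂ) : IsOpen {b : ℂ | ‖b * κ‖ < 1} :=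
  isOpen_lt (by fun_prop) continuous_const

theorem convex_norm_mul_lt (κ : ℂ) : Convex ℝ {b : ℂ | ‖b * κ‖ < 1} := by
  have := (convex_ball (0 : ℂ) 1).linear_preimage ((LinearMap.mulRight ℂ κ).restrictScalars ℝ)
  have e : {b : ℂ | ‖b * κ‖ < 1}
      = ((LinearMap.mulRight ℂ κ).restrictScalars ℝ) ⁻¹' Metric.ball (0 : ℂ) 1 := by
    ext b; simp
  rw [e]
  exact this

theorem tendsto_geometric_nhdsNE {q : ℂ} (hq0 : q ≠ 0) (hq1 : ‖q‖ < 1) {β : ℂ} (hβ : β ≠ 0) :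
    Tendsto (fun M : ℕ => β * q ^ M) atTop (𝓝[≠] 0) := by
  refine tendsto_nhdsWithin_iff.2 ⟨?_, Eventually.of_forall fun M =>
    mul_ne_zero hβ (pow_ne_zero _ hq0)⟩
  simpa using (tendsto_pow_atTop_nhds_zero_of_norm_lt_one hq1).const_mul β

/-- The zeros `β * q ^ M` accumulate at the interior point 0. -/
theorem eqOn_zero_of_geometric {q : ℂ} (hq0 : q ≠ 0) (hq1 : ‖q‖ < 1) {F : ℂ → ℂ} {U : Set ℂ}
    (hU : IsOpen U) (hUc : IsPreconnected U) (h0 : (0 : ℂ) ∈ U) (hF : DifferentiableOn ℂ F U)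
    {β : ℂ} (hβ : β ≠ 0) (h : ∀ᶠ M : ℕ in atTop, F (β * q ^ M) = 0) : Set.EqOn F 0 U :=
  (hF.analyticOnNhd hU).eqOn_of_preconnected_of_frequently_eq analyticOnNhd_const hUc h0
    ((tendsto_geometric_nhdsNE hq0 hq1 hβ).frequently h.frequently)

/-- The domain depends only on the product `bc`, so each slice is convex and contains 0.
Continuation in `c` at every fixed `b = β * q ^ M` comes before continuation in `b` at fixed `c`. -/
theorem eq_zero_of_geometric_grid {q : ℂ} (hq0 : q ≠ 0) (hq1 : ‖q‖ < 1) {D : ℂ → ℂ → ℂ}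
    {κ μ : ℂ}
    (hb : ∀ c, DifferentiableOn ℂ (fun b => D b c) {b | ‖b * (c * κ)‖ < 1 ∧ ‖b * (c * μ)‖ < 1})
    (hc : ∀ b, DifferentiableOn ℂ (fun c => D b c) {c | ‖c * (b * κ)‖ < 1 ∧ ‖c * (b * μ)‖ < 1})
    {β γ : ℂ} (hβ : β ≠ 0) (hγ : γ ≠ 0)
    (h : ∀ M K : ℕ, 1 ≤ M → 1 ≤ K → D (β * q ^ M) (γ * q ^ K) = 0)
    {b c : ℂ} (h1 : ‖b * c * κ‖ < 1) (h2 : ‖b * c * μ‖ < 1) : D b c = 0 := by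
  have hset : ∀ a : ℂ, {b : ℂ | ‖b * (a * κ)‖ < 1 ∧ ‖b * (a * μ)‖ < 1}
      = {b : ℂ | ‖b * (a * κ)‖ < 1} ∩ {b : ℂ | ‖b * (a * μ)‖ < 1} := fun a => rfl
  have hopen : ∀ a : ℂ, IsOpen {b : ℂ | ‖b * (a * κ)‖ < 1 ∧ ‖b * (a * μ)‖ < 1} := fun a => by
    rw [hset]; exact (isOpen_norm_mul_lt _).inter (isOpen_norm_mul_lt _)
  have hconn : ∀ a : ℂ, IsPreconnected {b : ℂ | ‖b * (a * κ)‖ < 1 ∧ ‖b * (a * μ)‖ < 1} :=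
    fun a => by
      rw [hset]; exact ((convex_norm_mul_lt _).inter (convex_norm_mul_lt _)).isPreconnected
  have step : ∀ M : ℕ, 1 ≤ M → ∀ c', ‖c' * ((β * q ^ M) * κ)‖ < 1 →
      ‖c' * ((β * q ^ M) * μ)‖ < 1 → D (β * q ^ M) c' = 0 := by
    intro M hM c' h1 h2
    exact eqOn_zero_of_geometric hq0 hq1 (hopen _) (hconn _) (by simp) (hc (β * q ^ M)) hγ
      ((eventually_ge_atTop 1).mono fun K hK => h M K hM hK) ⟨h1, h2⟩
  refine eqOn_zero_of_geometric hq0 hq1 (hopen _) (hconn _) (by simp) (hb c) hβ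
    ?_ (show b ∈ _ from ⟨by rwa [← mul_assoc], by rwa [← mul_assoc]⟩)
  have hlim := (tendsto_geometric_nhdsNE hq0 hq1 hβ).mono_right nhdsWithin_le_nhds
  -- The point `(β * q ^ M, c)` need not lie in the domain for small `M`; only large `M` matter.
  filter_upwards [eventually_ge_atTop 1, hlim.eventually ((hopen c).mem_nhds (by simp))]
    with M hM hM2
  refine step M hM c ?_ ?_
  · rw [mul_left_comm]; exact hM2.1
  · rw [mul_left_comm]; exact hM2.2

/-! ### Bailey's `₆ψ₆` summation. -/

theorem qFacInf_div {q : ℂ} (hq0 : q ≠ 0) (hq1 : ‖q‖ < 1) (a : ℂ) :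
    qFacInf q (a / q) = (1 - a / q) * qFacInf q a := by
  rw [qFacInf_eq hq1, div_mul_cancel₀ _ hq0]

theorem qFacInf_zpow {q : ℂ} (hq0 : q ≠ 0) (hq1 : ‖q‖ < 1) {m : ℤ} (hm : m ≤ 0) :
    qFacInf q (q ^ m) = 0 := by
  obtain ⟨n, hn⟩ := Int.eq_ofNat_of_zero_le (neg_nonneg.2 hm)
  refine qFacInf_eq_zero hq1 (n := n) ?_
  rw [← zpow_natCast, ← zpow_add₀ hq0, ← hn]
  simp

theorem qTheta_zpow {q : ℂ} (hq0 : q ≠ 0) (hq1 : ‖q‖ < 1) (m : ℤ) : qTheta q (q ^ m) = 0 := by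
  unfold qTheta
  rcases le_or_gt m 0 with h | h
  · rw [qFacInf_zpow hq0 hq1 h, zero_mul]
  · rw [show q / q ^ m = q ^ (1 - m) by rw [zpow_sub₀ hq0, zpow_one],
      qFacInf_zpow hq0 hq1 (m := 1 - m) (by omega), mul_zero]

/-- For `x = q ^ j` the reflection `k ↦ j - 1 - k` fixes each `wpFactor` and changes the sign of the
rest of the term, so the sum equals its own negative. -/
theorem wpSum_zpow {q : ℂ} (hq0 : q ≠ 0) (j : ℤ) (r : ℕ) {n : ℕ}
    (p : Fin n → ℂ) : wpSum q (q ^ j) r p = 0 := by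
  have key : ∀ k : ℤ, wpTerm q (q ^ j) r p ((j - 1) - k) = - wpTerm q (q ^ j) r p k := by
    intro k
    unfold wpTerm
    have hF : ∀ i, wpFactor q (q ^ j) (p i) ((j - 1) - k) = wpFactor q (q ^ j) (p i) k := by
      intro i
      unfold wpFactor
      rw [mul_comm]
      congr 2
      · rw [mul_div_assoc, ← zpow_sub₀ hq0]; congr 2; ring
      · rw [mul_div_assoc, ← zpow_sub₀ hq0]; congr 2; ring
    simp only [hF]
    have e : (1 - q ^ (2 * (j - 1 - k) + 1) / q ^ j)
        * (q ^ (r * ((j - 1 - k) * (j - 1 - k + 1)) - (j - 1 - k)) * (q ^ j) ^ (-(r * (j - 1 - k))))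
        = - ((1 - q ^ (2 * k + 1) / q ^ j) * (q ^ (r * (k * (k + 1)) - k) * (q ^ j) ^ (-(r * k)))) := by
      rw [← zpow_mul, ← zpow_mul, ← zpow_add₀ hq0, ← zpow_add₀ hq0, ← zpow_sub₀ hq0,
        ← zpow_sub₀ hq0, one_sub_mul, one_sub_mul, ← zpow_add₀ hq0, ← zpow_add₀ hq0,
        neg_sub]
      congr 2 <;> ring
    rw [e]; ring
  have h := Equiv.tsum_eq (Equiv.subLeft (j - 1)) (wpTerm q (q ^ j) r p)
  simp only [Equiv.subLeft_apply, key, tsum_neg] at h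
  unfold wpSum
  linear_combination (-1 / 2 : ℂ) * h

open Matrix in
theorem wpSum_pair {q : ℂ} (hq0 : q ≠ 0) (hq1 : ‖q‖ < 1) {x : ℂ} (hx : x ≠ 0) {r n : ℕ}
    (hn : n + 2 = 2 * r) (b c : ℂ) (p : Fin n → ℂ)
    (hp : ‖b * c * (∏ i, p i) / (q * (q * x ^ r))‖ < 1) :
    c * wpSum q x r (vecCons (b / q) (vecCons c p))
      - b * wpSum q x r (vecCons b (vecCons (c / q) p))
      = (c - b) * (1 - b * c / (q * x)) * wpSum q x r (vecCons b (vecCons c p)) := by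
  -- The hypothesis concerns the two shifted series; the ratio of the unshifted one is smaller by
  -- the factor `q`.
  have hq : ‖b * c * (∏ i, p i) / (q * x ^ r)‖ < 1 := by
    have : b * c * (∏ i, p i) / (q * x ^ r) = b * c * (∏ i, p i) / (q * (q * x ^ r)) * q := by
      field_simp
    rw [this, norm_mul]
    exact mul_lt_one_of_nonneg_of_lt_one_left (norm_nonneg _) hp hq1.le
  have s1 := summable_wpTerm hq0 hq1 hx hn (vecCons (b / q) (vecCons c p)) (by
    convert hp using 2
    simp [Fin.prod_univ_succ]
    field_simp)
  have s2 := summable_wpTerm hq0 hq1 hx hn (vecCons b (vecCons (c / q) p)) (by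
    convert hp using 2
    simp [Fin.prod_univ_succ]
    field_simp)
  have s3 := summable_wpTerm hq0 hq1 hx hn (vecCons b (vecCons c p)) (by
    convert hq using 2
    simp [Fin.prod_univ_succ]
    field_simp)
  unfold wpSum
  rw [← tsum_mul_left, ← tsum_mul_left, ← tsum_mul_left,
    ← (s1.mul_left c).tsum_sub (s2.mul_left b)]
  congr 1
  funext k
  unfold wpTerm
  have := wpFactor_pair hq0 hq1 x b c k
  simp only [Fin.prod_univ_succ, cons_val_zero, cons_val_succ]
  linear_combination (1 - q ^ (2 * k + 1) / x) * (q ^ (r * (k * (k + 1)) - k) * x ^ (-(r * k)))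
    * (∏ i, wpFactor q x (p i) k) * this

/-- The product side of Bailey's `₆ψ₆` summation. -/
noncomputable def baileyProd (q x b c e f : ℂ) : ℂ :=
  qFacInf q q * qTheta q x * (qFacInf q (b * c / x) * (qFacInf q (b * e / x) * qFacInf q (b * f / x))
    * (qFacInf q (c * e / x) * qFacInf q (c * f / x)) * qFacInf q (e * f / x))
    / qFacInf q (b * c * e * f / (q * x ^ 2))

/-- Both shifts change the `bc`-product and the denominator in the same way. What remains is the
elementary identity behind `wpFactor_pair`, now with `u = e/(qx)` and `v = f/(qx)`. -/
theorem baileyProd_pair {q : ℂ} (hq0 : q ≠ 0) (hq1 : ‖q‖ < 1) {x : ℂ} (hx : x ≠ 0) (b c e f : ℂ)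
    (h : ‖b * c * e * f / (q * (q * x ^ 2))‖ < 1) :
    c * baileyProd q x (b / q) c e f - b * baileyProd q x b (c / q) e f
      = (c - b) * (1 - b * c / (q * x)) * baileyProd q x b c e f := by
  unfold baileyProd
  have d : qFacInf q (b * c * e * f / (q * (q * x ^ 2)))
      = (1 - b * c * e * f / (q * (q * x ^ 2))) * qFacInf q (b * c * e * f / (q * x ^ 2)) := by
    have e : b * c * e * f / (q * (q * x ^ 2)) = b * c * e * f / (q * x ^ 2) / q := by field_simp
    rw [e, qFacInf_div hq0 hq1]
  have hd := qFacInf_ne_zero_of_norm_lt hq1 h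
  rw [d] at hd
  obtain ⟨hd1, hd2⟩ := mul_ne_zero_iff.1 hd
  have sh : ∀ u v : ℂ, qFacInf q (u / q * v / x) = (1 - u * v / (q * x)) * qFacInf q (u * v / x) := by
    intro u v
    rw [show u / q * v / x = u * v / x / q by field_simp, qFacInf_div hq0 hq1]
    congr 2; field_simp
  have sh' : qFacInf q (b * (c / q) / x) = (1 - b * c / (q * x)) * qFacInf q (b * c / x) := by
    rw [show b * (c / q) = b / q * c by field_simp, sh]
  have d1 : qFacInf q (b / q * c * e * f / (q * x ^ 2))
      = (1 - b * c * e * f / (q * (q * x ^ 2))) * qFacInf q (b * c * e * f / (q * x ^ 2)) := by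
    rw [← d]; congr 1; field_simp
  have d2 : qFacInf q (b * (c / q) * e * f / (q * x ^ 2))
      = (1 - b * c * e * f / (q * (q * x ^ 2))) * qFacInf q (b * c * e * f / (q * x ^ 2)) := by
    rw [← d]; congr 1; field_simp
  rw [d1, d2, sh', sh, sh, sh, sh, sh]
  have hd3 : q ^ 2 * x ^ 2 - b * c * e * f ≠ 0 := by
    intro h0
    apply hd1
    rw [sub_eq_zero] at h0 ⊢
    rw [← h0]
    field_simp
  generalize qFacInf q (b * c * e * f / (q * x ^ 2)) = Y at *
  generalize qFacInf q (b * c / x) = P1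
  generalize qFacInf q (b * e / x) = P2
  generalize qFacInf q (b * f / x) = P3
  generalize qFacInf q (c * e / x) = P4
  generalize qFacInf q (c * f / x) = P5
  generalize qFacInf q (e * f / x) = P6
  have e1 : 1 - b * c * e * f / (q * (q * x ^ 2))
      = (q ^ 2 * x ^ 2 - b * c * e * f) / (q ^ 2 * x ^ 2) := by field_simp
  rw [e1]
  generalize hW : q ^ 2 * x ^ 2 - b * c * e * f = W at *
  field_simp
  rw [← hW]
  ring

theorem baileyProd_comm (q x b c e f : ℂ) : baileyProd q x b c e f = baileyProd q x c b e f := by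
  unfold baileyProd
  rw [mul_comm b c]
  ring

theorem baileyProd_swap (q x b c e f : ℂ) : baileyProd q x b c e f = baileyProd q x e f b c := by
  unfold baileyProd
  rw [mul_comm b c, mul_comm b e, mul_comm b f, mul_comm c e, mul_comm c f,
    show c * b * e * f = e * f * b * c by ring, mul_comm c b]
  ring

theorem wpSum_four_comm (q x : ℂ) (r : ℕ) (b c e f : ℂ) :
    wpSum q x r ![b, c, e, f] = wpSum q x r ![c, b, e, f] := by
  unfold wpSum wpTerm
  congr 1; funext k
  simp only [Fin.prod_univ_four, Matrix.cons_val_zero, Matrix.cons_val_one, Matrix.cons_val]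
  ring

theorem wpSum_four_swap (q x : ℂ) (r : ℕ) (b c e f : ℂ) :
    wpSum q x r ![b, c, e, f] = wpSum q x r ![e, f, b, c] := by
  unfold wpSum wpTerm
  congr 1; funext k
  simp only [Fin.prod_univ_four, Matrix.cons_val_zero, Matrix.cons_val_one, Matrix.cons_val]
  ring

/-- The parameter `x * q ^ (-k)` kills all terms of index below `k`, and `q ^ (k + 1)` all those
above. Quasi-periodicity of theta evaluates the surviving term. -/
theorem wpSum_single {q : ℂ} (hq0 : q ≠ 0) (hq1 : ‖q‖ < 1) {x : ℂ} (hx : x ≠ 0) (e f : ℂ)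
    (k : ℤ) (hef : ‖e * f / x‖ < 1) :
    wpSum q x 2 ![x * q ^ (-k), q ^ (k + 1), e, f]
      = baileyProd q x (x * q ^ (-k)) (q ^ (k + 1)) e f := by
  have hP := qFacInf_ne_zero_of_norm_lt hq1 hef
  have z : ∀ m : ℤ, q ^ m ≠ 0 := fun m => zpow_ne_zero m hq0
  unfold wpSum
  rw [tsum_eq_single k]
  · unfold wpTerm baileyProd
    simp only [Fin.prod_univ_four, Matrix.cons_val_zero, Matrix.cons_val_one, Matrix.cons_val]
    have h1 : wpFactor q x (x * q ^ (-k)) k = qFacInf q (x * q ^ (2 * (-k))) * qFacInf q q := by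
      unfold wpFactor
      congr 2
      · rw [mul_assoc, ← zpow_add₀ hq0]; congr 2; ring
      · rw [mul_assoc, ← zpow_add₀ hq0, neg_add_cancel_left, zpow_one]; field_simp
    have h2 : wpFactor q x (q ^ (k + 1)) k = qFacInf q q * qFacInf q (q ^ (2 * k + 1) / x * q) := by
      unfold wpFactor
      congr 2
      · rw [← zpow_add₀ hq0, add_neg_cancel_comm, zpow_one]
      · rw [← zpow_add₀ hq0, div_mul_eq_mul_div, ← zpow_add_one₀ hq0]; congr 2; ring
    have h3 := qFacInf_eq hq1 (q ^ (2 * k + 1) / x)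
    have h4 := qTheta_mul_zpow hq0 hq1 hx (-k)
    have h5 : q / (x * q ^ (2 * (-k))) = q ^ (2 * k + 1) / x := by
      rw [show 2 * -k = -(2 * k) by ring, zpow_neg, zpow_add_one₀ hq0]
      have := z (2 * k)
      field_simp
    have h6 : q ^ (-(-k * (2 * -k - 1))) * x ^ (-(2 * -k))
        * (q ^ (((2 : ℕ) : ℤ) * (k * (k + 1)) - k) * x ^ (-(((2 : ℕ) : ℤ) * k))) = 1 := by
      rw [mul_mul_mul_comm, ← zpow_add₀ hq0, ← zpow_add₀ hx]
      rw [show -(-k * (2 * -k - 1)) + (((2 : ℕ) : ℤ) * (k * (k + 1)) - k) = 0 by push_cast; ring,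
        show -(2 * -k) + -(((2 : ℕ) : ℤ) * k) = 0 by push_cast; ring]
      simp
    have a1 : x * q ^ (-k) * q ^ (k + 1) / x = q := by
      rw [mul_assoc, ← zpow_add₀ hq0, neg_add_cancel_left, zpow_one]; field_simp
    have a2 : ∀ e, x * q ^ (-k) * e / x = e * q ^ (-k) := by intro e; field_simp
    have a3 : ∀ e, q ^ (k + 1) * e / x = e * q ^ (k + 1) / x := by intro e; ring
    have a4 : x * q ^ (-k) * q ^ (k + 1) * e * f / (q * x ^ 2) = e * f / x := by
      rw [mul_assoc x, ← zpow_add₀ hq0, neg_add_cancel_left, zpow_one]; field_simp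
    rw [a1, a2, a2, a3, a3, a4, h1, h2]
    unfold qTheta at h4 ⊢
    rw [h5] at h4
    unfold wpFactor
    rw [mul_div_assoc _ (_ * qFacInf q (e * f / x)), mul_div_cancel_right₀ _ hP]
    generalize qFacInf q (q ^ (2 * k + 1) / x * q) = Y at *
    generalize qFacInf q (x * q ^ (2 * -k)) = Z at *
    generalize q ^ (-(-k * (2 * -k - 1))) * x ^ (-(2 * -k)) = W at *
    generalize q ^ (((2 : ℕ) : ℤ) * (k * (k + 1)) - k) * x ^ (-(((2 : ℕ) : ℤ) * k)) = V at *
    generalize qFacInf q (q ^ (2 * k + 1) / x) = Q at *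
    generalize qFacInf q x * qFacInf q (q / x) = T at *
    generalize qFacInf q (e * q ^ (-k)) = Y1
    generalize qFacInf q (f * q ^ (-k)) = Y2
    generalize qFacInf q (e * q ^ (k + 1) / x) = Y3
    generalize qFacInf q (f * q ^ (k + 1) / x) = Y4
    generalize qFacInf q q = Pq
    linear_combination Pq ^ 2 * Y1 * Y2 * Y3 * Y4 * (V * h4 - V * Z * h3 + T * h6)
  · intro m hm
    unfold wpTerm
    rcases lt_or_gt_of_ne hm with h | h
    · have : wpFactor q x (x * q ^ (-k)) m = 0 := by
        unfold wpFactor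
        rw [show x * q ^ (-k) * q ^ (m + 1) / x = q ^ (-k + (m + 1)) by
          rw [mul_assoc x, ← zpow_add₀ hq0 (-k), mul_div_cancel_left₀ _ hx], qFacInf_zpow hq0 hq1 (m := -k + (m + 1)) (by omega),
          mul_zero]
      simp only [Fin.prod_univ_four, Matrix.cons_val_zero, Matrix.cons_val_one, this, zero_mul,
        mul_zero]
    · have : wpFactor q x (q ^ (k + 1)) m = 0 := by
        unfold wpFactor
        rw [← zpow_add₀ hq0, qFacInf_zpow hq0 hq1 (m := k + 1 + -m) (by omega), zero_mul]
      simp only [Fin.prod_univ_four, Matrix.cons_val_zero, Matrix.cons_val_one, this, zero_mul,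
        mul_zero]

/-- The grid is `b = x q^M`, `c = q^N`, with induction on `M + N ≥ 1`. That `x` is no power of `q`
gives `b ≠ c` there, so the contiguous relation can be solved for the unshifted value. -/
theorem wpSum_four_of_norm {q : ℂ} (hq0 : q ≠ 0) (hq1 : ‖q‖ < 1) {x : ℂ} (hx : x ≠ 0)
    (hxq : ∀ j : ℤ, x ≠ q ^ j) {b c e f : ℂ} (h : ‖b * c * e * f / (q * x ^ 2)‖ < 1)
    (hef : ‖e * f / x‖ < 1) :
    wpSum q x 2 ![b, c, e, f] = baileyProd q x b c e f := by
  set D : ℂ → ℂ → ℂ := fun b c => wpSum q x 2 ![b, c, e, f] - baileyProd q x b c e f with hD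
  -- Integer exponents are needed: solving the relation repeatedly leads down to points of the line
  -- `M + N = 1`, where one exponent may be nonpositive.
  have grid : ∀ s : ℕ, ∀ M N : ℤ, M + N = s + 1 → D (x * q ^ M) (q ^ N) = 0 := by
    intro s
    induction s with
    | zero =>
      intro M N hMN
      obtain rfl : M = -(N - 1) := by push_cast at hMN; omega
      have := wpSum_single hq0 hq1 hx e f (N - 1) hef
      rw [sub_add_cancel] at this
      simp only [hD]
      rw [this, sub_self]
    | succ s ih =>
      intro M N hMN
      -- On the grid the convergence ratio is `q^s · ef/x`, so `‖e * f / x‖ < 1` suffices for every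
      -- step.
      have e0 : x * q ^ M * q ^ N * e * f / (q * (q * x ^ 2)) = q ^ s * (e * f / x) := by
        rw [mul_assoc x, ← zpow_add₀ hq0, hMN, zpow_add_one₀ hq0, zpow_natCast]; field_simp; ring
      have e1 : ‖x * q ^ M * q ^ N * e * f / (q * (q * x ^ 2))‖ < 1 := by
        rw [e0, norm_mul, norm_pow]
        exact mul_lt_one_of_nonneg_of_lt_one_right (pow_le_one₀ (norm_nonneg _) hq1.le)
          (norm_nonneg _) hef
      have r1 := wpSum_pair hq0 hq1 hx (r := 2) (by norm_num) (x * q ^ M) (q ^ N) ![e, f] (by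
        simpa [Fin.prod_univ_succ, mul_assoc] using e1)
      have r2 := baileyProd_pair hq0 hq1 hx (x * q ^ M) (q ^ N) e f e1
      have b1 : x * q ^ M / q = x * q ^ (M - 1) := by rw [zpow_sub_one₀ hq0]; ring
      have b2 : q ^ N / q = q ^ (N - 1) := by rw [zpow_sub_one₀ hq0]; ring
      have i1 := ih (M - 1) N (by push_cast at hMN; omega)
      have i2 := ih M (N - 1) (by push_cast at hMN; omega)
      simp only [hD] at i1 i2 ⊢
      rw [b1, b2] at r1 r2
      have n1 : q ^ N - x * q ^ M ≠ 0 := by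
        intro h0
        apply hxq (N - M)
        rw [zpow_sub₀ hq0, eq_div_iff (zpow_ne_zero _ hq0)]
        exact (sub_eq_zero.1 h0).symm
      have n2 : 1 - x * q ^ M * q ^ N / (q * x) ≠ 0 := by
        have : x * q ^ M * q ^ N / (q * x) = q ^ (s + 1) := by
          rw [mul_assoc x, ← zpow_add₀ hq0, hMN, zpow_add_one₀ hq0]
          field_simp
          norm_cast
        rw [this, sub_ne_zero]
        intro h0
        have : ‖q ^ (s + 1)‖ < 1 := by
          rw [norm_pow]; exact pow_lt_one₀ (norm_nonneg _) hq1 (by omega)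
        rw [← h0, norm_one] at this
        exact lt_irrefl _ this
      apply mul_left_cancel₀ (mul_ne_zero n1 n2)
      linear_combination -r1 + r2 + q ^ N * i1 - x * q ^ M * i2
  have hdiff : ∀ c, DifferentiableOn ℂ (fun b => D b c)
      {b | ‖b * (c * (e * f / (q * x ^ 2)))‖ < 1 ∧ ‖b * (c * 0)‖ < 1} := by
    intro c
    have hU : IsOpen {b | ‖b * (c * (e * f / (q * x ^ 2)))‖ < 1 ∧ ‖b * (c * 0)‖ < 1} :=
      (isOpen_norm_mul_lt _).inter (isOpen_norm_mul_lt _)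
    have hP := differentiable_qFacInf hq1
    refine DifferentiableOn.sub ?_ ?_
    · refine differentiableOn_wpSum hq0 hq1 hx (r := 2) (by norm_num) hU
        (fun i b => ![b, c, e, f] i) ?_ ?_
      · intro i; fin_cases i <;> (simp [-differentiableOn_const]; try fun_prop)
      · intro b hb
        have := hb.1
        simp only [Fin.prod_univ_four, Matrix.cons_val_zero, Matrix.cons_val_one, Matrix.cons_val]
        convert this using 2
        ring
    · unfold baileyProd
      refine DifferentiableOn.div (by fun_prop) (by fun_prop) ?_
      intro b hb
      refine qFacInf_ne_zero_of_norm_lt hq1 ?_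
      convert hb.1 using 2
      ring
  have key := eq_zero_of_geometric_grid hq0 hq1 (D := D) (κ := e * f / (q * x ^ 2)) (μ := 0)
    (β := x) (γ := 1) hdiff (fun b => (hdiff b).congr fun c _ => by
      simp only [hD]; rw [wpSum_four_comm, baileyProd_comm]) hx one_ne_zero
    (fun M K hM hK => by
      have := grid (M + K - 1) M K (by push_cast [Nat.cast_sub (show 1 ≤ M + K by omega)]; ring)
      simpa using this) (b := b) (c := c)
    (by convert h using 2; ring) (by simp)
  exact sub_eq_zero.1 key

/-- Bailey's `₆ψ₆` summation. -/
theorem wpSum_four {q : ℂ} (hq0 : q ≠ 0) (hq1 : ‖q‖ < 1) {x : ℂ} (hx : x ≠ 0)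
    {b c e f : ℂ} (h : ‖b * c * e * f / (q * x ^ 2)‖ < 1) :
    wpSum q x 2 ![b, c, e, f] = baileyProd q x b c e f := by
  by_cases hxq : ∀ j : ℤ, x ≠ q ^ j
  · by_cases hef : ‖e * f / x‖ < 1
    · exact wpSum_four_of_norm hq0 hq1 hx hxq h hef
    -- The product of `bc/x` and `ef/x` has norm below 1, so at least one of them does; the pairs
    -- may be exchanged.
    · have hbc : ‖b * c / x‖ < 1 := by
        by_contra hbc
        push Not at hef hbc
        have h1 : b * c * e * f / (q * x ^ 2) * q = (b * c / x) * (e * f / x) := by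
          field_simp
        have h2 : ‖b * c * e * f / (q * x ^ 2) * q‖ < 1 := by
          rw [norm_mul]
          exact mul_lt_one_of_nonneg_of_lt_one_left (norm_nonneg _) h hq1.le
        rw [h1, norm_mul] at h2
        nlinarith
      rw [wpSum_four_swap, baileyProd_swap]
      exact wpSum_four_of_norm hq0 hq1 hx hxq (by convert h using 2; ring) hbc
  -- When `x` is a power of `q` both sides vanish, the right one through its factor `qTheta q x`.
  · push Not at hxq
    obtain ⟨j, rfl⟩ := hxq
    rw [wpSum_zpow hq0, baileyProd, qTheta_zpow hq0 hq1]
    simp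

/-! ### Jacobi's triple product and Weierstrass' theta relation. -/

/-- The bilateral Gaussian series `∑ p^{n²} c^n`. -/
noncomputable def gaussSeries (p c : ℂ) : ℂ := ∑' n : ℤ, p ^ (n * n) * c ^ n

theorem summable_gauss_nat {p : ℂ} (hp1 : ‖p‖ < 1) (c : ℂ) :
    Summable fun n : ℕ => p ^ (n * n) * c ^ n := by
  have h : ∀ n : ℕ, p ^ (n * n) * c ^ n
      = 1 * ∏ i ∈ Finset.range n, (p * c * (p ^ i) ^ 2) := by
    intro n
    induction n with
    | zero => simp
    | succ n ih => rw [Finset.prod_range_succ, ← mul_assoc, ← ih]; ring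
  simp only [h]
  exact summable_ratio hp1 (ρ := fun s => p * c * s ^ 2) (g := fun _ => 1) (by fun_prop) (by simp)
    (by fun_prop)

theorem summable_gauss {p : ℂ} (hp1 : ‖p‖ < 1) (c : ℂ) :
    Summable fun n : ℤ => p ^ (n * n) * c ^ n := by
  refine Summable.of_nat_of_neg_add_one ?_ ?_
  · refine (summable_gauss_nat hp1 c).congr fun n => ?_
    norm_cast
  · refine ((summable_nat_add_iff 1).2 (summable_gauss_nat hp1 c⁻¹)).congr fun n => ?_
    rw [neg_mul_neg, zpow_neg, inv_pow]
    norm_cast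

theorem hasSum_gaussSeries_mul {p : ℂ} (hp1 : ‖p‖ < 1) (a b : ℂ) : HasSum
    (fun z : ℤ × ℤ => (p ^ (z.1 * z.1) * a ^ z.1) * (p ^ (z.2 * z.2) * b ^ z.2))
    (gaussSeries p a * gaussSeries p b) := by
  have h := summable_mul_of_summable_norm (f := fun n : ℤ => p ^ (n * n) * a ^ n)
    (g := fun n : ℤ => p ^ (n * n) * b ^ n) (summable_gauss hp1 a).norm (summable_gauss hp1 b).norm
  have e := tsum_mul_tsum_of_summable_norm (f := fun n : ℤ => p ^ (n * n) * a ^ n)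
    (g := fun n : ℤ => p ^ (n * n) * b ^ n) (summable_gauss hp1 a).norm (summable_gauss hp1 b).norm
  unfold gaussSeries
  rw [e]
  exact h.hasSum

/-- The lattice `ℤ × ℤ` is split by the parity of the coordinate sum. On each class the rotation
`(i, j) ↦ (i - j, i + j)`, shifted by one in the odd class, diagonalizes `m² + n²`. -/
theorem gaussSeries_mul {p : ℂ} (hp0 : p ≠ 0) (hp1 : ‖p‖ < 1) {c d : ℂ} (hc : c ≠ 0) (hd : d ≠ 0) :
    gaussSeries p c * gaussSeries p d = gaussSeries (p ^ 2) (c * d) * gaussSeries (p ^ 2) (d / c)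
      + p * d * (gaussSeries (p ^ 2) (p ^ 2 * (c * d)) * gaussSeries (p ^ 2) (p ^ 2 * (d / c))) := by
  have hp2 : ‖p ^ 2‖ < 1 := by rw [norm_pow]; exact pow_lt_one₀ (norm_nonneg _) hp1 two_ne_zero
  set F : ℤ × ℤ → ℂ := fun z => (p ^ (z.1 * z.1) * c ^ z.1) * (p ^ (z.2 * z.2) * d ^ z.2) with hF
  have hsum : HasSum F _ := hasSum_gaussSeries_mul hp1 c d
  set φ₀ : ℤ × ℤ → ℤ × ℤ := fun z => (z.1 - z.2, z.1 + z.2)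
  set φ₁ : ℤ × ℤ → ℤ × ℤ := fun z => (z.1 - z.2, z.1 + z.2 + 1)
  have i₀ : Function.Injective φ₀ := by
    rintro ⟨a, b⟩ ⟨a', b'⟩ h
    simp only [φ₀, Prod.mk.injEq] at h ⊢
    omega
  have i₁ : Function.Injective φ₁ := by
    rintro ⟨a, b⟩ ⟨a', b'⟩ h
    simp only [φ₁, Prod.mk.injEq] at h ⊢
    omega
  have hc2 : IsCompl (Set.range φ₀) (Set.range φ₁) := by
    constructor
    · rw [Set.disjoint_iff_inter_eq_empty, Set.eq_empty_iff_forall_notMem]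
      rintro _ ⟨⟨⟨a, b⟩, rfl⟩, ⟨⟨a', b'⟩, h⟩⟩
      simp only [φ₀, φ₁, Prod.mk.injEq] at h
      omega
    · rw [codisjoint_iff_le_sup]
      rintro ⟨m, n⟩ -
      rcases Int.even_or_odd' (m + n) with ⟨s, hs | hs⟩
      · left; exact ⟨(s, s - m), by simp only [φ₀, Prod.mk.injEq]; omega⟩
      · right; exact ⟨(s, s - m), by simp only [φ₁, Prod.mk.injEq]; omega⟩
  have sq : ∀ n : ℤ, (p ^ 2) ^ n = p ^ (2 * n) := fun n => by
    rw [zpow_mul]; norm_cast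
  have h₀ : HasSum (F ∘ φ₀) (gaussSeries (p ^ 2) (c * d) * gaussSeries (p ^ 2) (d / c)) := by
    convert hasSum_gaussSeries_mul hp2 (c * d) (d / c) using 1
    funext ⟨i, j⟩
    simp only [hF, φ₀, Function.comp]
    have e : p ^ ((i - j) * (i - j)) * p ^ ((i + j) * (i + j))
        = (p ^ 2) ^ (i * i) * (p ^ 2) ^ (j * j) := by
      rw [sq, sq, ← zpow_add₀ hp0, ← zpow_add₀ hp0]; congr 1; ring
    rw [zpow_sub₀ hc, zpow_add₀ hd, mul_zpow, div_zpow]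
    linear_combination (c ^ i / c ^ j * (d ^ i * d ^ j)) * e
  have h₁ : HasSum (F ∘ φ₁) (p * d * (gaussSeries (p ^ 2) (p ^ 2 * (c * d))
      * gaussSeries (p ^ 2) (p ^ 2 * (d / c)))) := by
    have h := HasSum.mul_left (p * d)
      (hasSum_gaussSeries_mul hp2 (p ^ 2 * (c * d)) (p ^ 2 * (d / c)))
    refine HasSum.congr_fun h ?_
    rintro ⟨i, j⟩
    simp only [hF, φ₁, Function.comp]
    have e : p ^ ((i - j) * (i - j)) * p ^ ((i + j + 1) * (i + j + 1))
        = p * ((p ^ 2) ^ (i * i) * (p ^ 2) ^ i) * ((p ^ 2) ^ (j * j) * (p ^ 2) ^ j) := by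
      rw [sq, sq, sq, sq, ← zpow_add₀ hp0, ← zpow_add₀ hp0, ← zpow_one_add₀ hp0, ← zpow_add₀ hp0,
        ← zpow_add₀ hp0]
      congr 1; ring
    rw [zpow_sub₀ hc, zpow_add_one₀ hd, zpow_add₀ hd, mul_zpow, mul_zpow, mul_zpow, div_zpow]
    linear_combination (c ^ i / c ^ j * (d ^ i * d ^ j * d)) * e
  exact hsum.unique
    ((i₀.hasSum_range_iff.mpr h₀).add_isCompl hc2 (i₁.hasSum_range_iff.mpr h₁))

/-- Jacobi's triple product identity, in base `q = p²`. -/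
theorem qTheta_eq_gaussSeries {p : ℂ} (hp0 : p ≠ 0) (hp1 : ‖p‖ < 1) {z : ℂ} (hz : z ≠ 0) :
    qFacInf (p ^ 2) (p ^ 2) * qTheta (p ^ 2) z = gaussSeries p (-p / z) := by
  have hq0 : p ^ 2 ≠ 0 := pow_ne_zero _ hp0
  have hq1 : ‖p ^ 2‖ < 1 := by rw [norm_pow]; exact pow_lt_one₀ (norm_nonneg _) hp1 two_ne_zero
  -- With all four parameters zero the `₆ψ₆` keeps only its elementary factors, and its `k`-th term
  -- is the sum of the Gaussian terms of index `2k` and `2k + 1`.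
  have h := wpSum_four hq0 hq1 hz (b := 0) (c := 0) (e := 0) (f := 0) (by simp)
  have hR : baileyProd (p ^ 2) z 0 0 0 0 = qFacInf (p ^ 2) (p ^ 2) * qTheta (p ^ 2) z := by
    simp [baileyProd, qFacInf_zero]
  rw [← hR, ← h]
  have hF : ∀ k : ℤ, wpFactor (p ^ 2) z 0 k = 1 := by simp [wpFactor, qFacInf_zero]
  have hT : ∀ k : ℤ, wpTerm (p ^ 2) z 2 ![0, 0, 0, 0] k
      = p ^ ((2 * k) * (2 * k)) * (-p / z) ^ (2 * k)
        + p ^ ((2 * k + 1) * (2 * k + 1)) * (-p / z) ^ (2 * k + 1) := by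
    intro k
    have sq : ∀ n : ℤ, (p ^ 2) ^ n = p ^ (2 * n) := fun n => by rw [zpow_mul]; norm_cast
    have hpz : -p / z ≠ 0 := div_ne_zero (neg_ne_zero.2 hp0) hz
    have e1 : (-p / z) ^ (2 * k) = p ^ (2 * k) * z ^ (-(2 * k)) := by
      rw [div_zpow, zpow_neg, (even_two_mul k).neg_zpow, div_eq_mul_inv]
    unfold wpTerm
    simp only [Fin.prod_univ_four, Matrix.cons_val_zero, Matrix.cons_val_one, Matrix.cons_val, hF]
    have a1 : (p ^ 2) ^ (((2 : ℕ) : ℤ) * (k * (k + 1)) - k)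
        = p ^ ((2 * k) * (2 * k)) * p ^ (2 * k) := by
      rw [sq, ← zpow_add₀ hp0]; congr 1; push_cast; ring
    have a2 : p ^ ((2 * k + 1) * (2 * k + 1)) * p
        = p ^ ((2 * k) * (2 * k)) * (p ^ 2) ^ (2 * k + 1) := by
      rw [sq, ← zpow_add_one₀ hp0, ← zpow_add₀ hp0]; congr 1; ring
    rw [zpow_add_one₀ hpz, e1, a1]
    push_cast
    linear_combination (p ^ (2 * k) * z ^ (-(2 * k)) / z) * a2
  unfold wpSum gaussSeries
  simp only [hT]
  have hs := summable_gauss hp1 (-p / z)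
  have hc2 : IsCompl (Set.range fun k : ℤ => 2 * k) (Set.range fun k : ℤ => 2 * k + 1) := by
    constructor
    · rw [Set.disjoint_iff_inter_eq_empty, Set.eq_empty_iff_forall_notMem]
      rintro _ ⟨⟨a, rfl⟩, ⟨b, h⟩⟩
      simp only at h
      omega
    · rw [codisjoint_iff_le_sup]
      rintro n -
      rcases Int.even_or_odd' n with ⟨s, hs | hs⟩
      · left; exact ⟨s, hs.symm⟩
      · right; exact ⟨s, hs.symm⟩
  have i₀ : Function.Injective fun k : ℤ => 2 * k := fun a b h => by simpa using h
  have i₁ : Function.Injective fun k : ℤ => 2 * k + 1 := fun a b h => by simpa using h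
  have s₀ := hs.comp_injective i₀
  have s₁ := hs.comp_injective i₁
  have := HasSum.add_isCompl (f := fun n : ℤ => p ^ (n * n) * (-p / z) ^ n) hc2
    (i₀.hasSum_range_iff.mpr s₀.hasSum) (i₁.hasSum_range_iff.mpr s₁.hasSum)
  rw [this.tsum_eq, ← s₀.tsum_add s₁]
  rfl

/-- By the triple product both thetas are Gaussian series. In `gaussSeries_mul` the product of their
arguments depends on `u` alone and the quotient on `v` alone, so each of the two summands separates.
-/
theorem qTheta_rank_two {q : ℂ} (hq0 : q ≠ 0) (hq1 : ‖q‖ < 1) {x : ℂ} (hx : x ≠ 0) :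
    ∃ α β γ δ : ℂ → ℂ, ∀ u v : ℂ, u ≠ 0 → v ≠ 0 →
      v * (qTheta q (u * v / x) * qTheta q (u / v)) = α u * β v + γ u * δ v := by
  obtain ⟨p, hp⟩ := IsAlgClosed.exists_pow_nat_eq q (show 0 < 2 by norm_num)
  have hp0 : p ≠ 0 := by rintro rfl; exact hq0 (by simp [← hp])
  have hp1 : ‖p‖ < 1 := by
    rw [← hp, norm_pow] at hq1
    exact (pow_lt_one_iff_of_nonneg (norm_nonneg _) two_ne_zero).1 hq1
  have hP : qFacInf q q ≠ 0 := qFacInf_ne_zero_of_norm_lt hq1 hq1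
  refine ⟨fun u => gaussSeries q (q * x / u ^ 2) / qFacInf q q ^ 2, fun v => v * gaussSeries q (v ^ 2 / x),
    fun u => gaussSeries q (q * (q * x / u ^ 2)) / qFacInf q q ^ 2 / u,
    fun v => - q * v ^ 2 * gaussSeries q (q * (v ^ 2 / x)), fun u v hu hv => ?_⟩
  beta_reduce
  have h1 := qTheta_eq_gaussSeries hp0 hp1 (z := u * v / x) (div_ne_zero (mul_ne_zero hu hv) hx)
  have h2 := qTheta_eq_gaussSeries hp0 hp1 (z := u / v) (div_ne_zero hu hv)
  have h3 := gaussSeries_mul hp0 hp1 (c := -p / (u * v / x)) (d := -p / (u / v))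
    (div_ne_zero (neg_ne_zero.2 hp0) (div_ne_zero (mul_ne_zero hu hv) hx))
    (div_ne_zero (neg_ne_zero.2 hp0) (div_ne_zero hu hv))
  have e1 : -p / (u * v / x) * (-p / (u / v)) = q * x / u ^ 2 := by rw [← hp]; field_simp
  have e2 : -p / (u / v) / (-p / (u * v / x)) = v ^ 2 / x := by field_simp
  have e3 : p * (-p / (u / v)) = - q * v / u := by rw [← hp]; field_simp
  rw [← h1, ← h2, e1, e2, e3, hp] at h3
  generalize qTheta q (u * v / x) = T₁ at *
  generalize qTheta q (u / v) = T₂ at *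
  generalize gaussSeries q (q * x / u ^ 2) = G₁ at *
  generalize gaussSeries q (v ^ 2 / x) = G₂ at *
  generalize gaussSeries q (q * (q * x / u ^ 2)) = G₃ at *
  generalize gaussSeries q (q * (v ^ 2 / x)) = G₄ at *
  field_simp at h3 ⊢
  linear_combination h3

/-- A matrix of rank at most two has vanishing `3 × 3` minors. By antisymmetry the minor used here
is an entry times the Pfaffian, and a combination of three such minors is the square of the
Pfaffian, so no entry has to be nonzero. -/
theorem pfaffian_eq_zero {ι : Type*} {α β γ δ : ι → ℂ} {M : ι → ι → ℂ}
    (hM : ∀ i j, M i j = α i * β j + γ i * δ j) (hanti : ∀ i j, M j i = -M i j) (i j k l : ι) :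
    M i j * M k l - M i k * M j l + M i l * M j k = 0 := by
  have h0 : ∀ i, M i i = 0 := fun i => by linear_combination (1 / 2 : ℂ) * hanti i i
  have minor : ∀ a b c d : ι, M a b * (M a b * M c d - M a c * M b d + M a d * M b c) = 0 := by
    intro a b c d
    have det : M a a * (M b b * M c d - M b d * M c b) - M a b * (M b a * M c d - M b d * M c a)
        + M a d * (M b a * M c b - M b b * M c a) = 0 := by
      simp only [hM]; ring
    rw [h0, h0, hanti a b, hanti a c, hanti b c] at det
    linear_combination det
  have m1 := minor i j k l
  have m2 := minor i k j l
  have m3 := minor i l j k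
  rw [hanti j k] at m2
  rw [hanti j l, hanti k l] at m3
  apply pow_eq_zero_iff two_ne_zero |>.1
  linear_combination M k l * m1 + M j l * m2 + M j k * m3

/-- Weierstrass' three-term relation for theta functions. -/
theorem qTheta_weierstrass {q : ℂ} (hq0 : q ≠ 0) (hq1 : ‖q‖ < 1) {x e f g : ℂ} (hx : x ≠ 0)
    (he : e ≠ 0) (hf : f ≠ 0) (hg : g ≠ 0) :
    f * (qTheta q (e * f / x) * qTheta q (e / f)) * (qTheta q (g / x) * qTheta q g)
      - g * (qTheta q (e * g / x) * qTheta q (e / g)) * (qTheta q (f / x) * qTheta q f)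
      + (qTheta q (e / x) * qTheta q e) * (g * (qTheta q (f * g / x) * qTheta q (f / g))) = 0 := by
  obtain ⟨α, β, γ, δ, h⟩ := qTheta_rank_two hq0 hq1 hx
  -- The kernel is antisymmetric by `qTheta_inv`; the four indices are `e, f, g, 1`.
  have := pfaffian_eq_zero (ι := {u : ℂ // u ≠ 0}) (α := fun u => α u) (β := fun u => β u)
    (γ := fun u => γ u) (δ := fun u => δ u)
    (M := fun u v => v * (qTheta q (u * v / x) * qTheta q (u / v)))
    (fun u v => h u v u.2 v.2) (fun u v => by
      have := qTheta_inv hq1 (div_ne_zero u.2 v.2)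
      rw [inv_div] at this
      rw [this, mul_comm (v : ℂ) u]
      have := v.2
      field_simp [u.2]) ⟨e, he⟩ ⟨f, hf⟩ ⟨g, hg⟩ ⟨1, one_ne_zero⟩
  simpa using this

/-! ### The normalized `₈φ₇`-series and its contiguous relation. -/

/-- Head factor of the normalized very-well-poised `₈φ₇`-series. -/
noncomputable def vwpHead (q x b c d e f g s : ℂ) : ℂ :=
  (1 - d * f * g / (e * x) * s ^ 2)
    * (qFacInf q (q * d / e * s) * qFacInf q (q * g / e * s)
      * (qFacInf q (b * (d * f * g / x ^ 2) * s) * qFacInf q (c * (d * f * g / x ^ 2) * s))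
      * (qFacInf q (b * (e / x)) * qFacInf q (c * (e / x))))

/-- Term ratio of the normalized very-well-poised `₈φ₇`-series. -/
noncomputable def vwpRatio (q x b c d e f g s : ℂ) : ℂ :=
  (1 - d * f * g / (e * x) * s) * (1 - d * g / x * s) * (1 - f * g / x * s) * (1 - d * f / x * s)
      / ((1 - q * s) * (1 - q * f / e * s))
    * ((q * s - b * (e / x)) * (q * s - c * (e / x)) * (x / e ^ 2))

/-- The normalized very-well-poised `₈φ₇`-series. -/
noncomputable def vwpSum (q x b c d e f g : ℂ) : ℂ :=
  ∑' k : ℕ, vwpHead q x b c d e f g (q ^ k)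
    * ∏ i ∈ Finset.range k, vwpRatio q x b c d e f g (q ^ i)

/-- The part of the prefactor that does not depend on `b` and `c`. -/
noncomputable def vwpConst (q x d e f g : ℂ) : ℂ :=
  x ^ 2 / f * (qFacInf q q * qTheta q (1 / x) * (qFacInf q (e * g / x) * qFacInf q (d * e / x))
      * (qTheta q f * qTheta q (f / x)))
    / (qFacInf q (e / f) * qFacInf q (d * f * g / (e * x)) * qFacInf q (q * x / (e * f)))

/-- The normalized `₈φ₇`-part of the transformation of a very-well-poised `₈ψ₈`-series. -/
noncomputable def vwpPart (q x b c d e f g : ℂ) : ℂ :=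
  vwpConst q x d e f g * (qFacInf q (b * c / x) / qFacInf q (b * c * d * e * f * g / (q * x ^ 3)))
    * vwpSum q x b c d e f g

theorem vwpRatio_zero {x e : ℂ} (hx : x ≠ 0) (he : e ≠ 0) (q b c d f g : ℂ) :
    vwpRatio q x b c d e f g 0 = b * c / x := by
  unfold vwpRatio
  simp only [mul_zero, sub_zero, zero_sub, mul_one, div_one, one_mul]
  field_simp

theorem summable_vwp {q : ℂ} (hq1 : ‖q‖ < 1) {x e : ℂ} (hx : x ≠ 0) (he : e ≠ 0)
    (b c d f g : ℂ) (h : ‖b * c / x‖ < 1) :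
    Summable fun k : ℕ => vwpHead q x b c d e f g (q ^ k)
      * ∏ i ∈ Finset.range k, vwpRatio q x b c d e f g (q ^ i) := by
  have hP := (differentiable_qFacInf hq1).continuous
  refine summable_ratio hq1 (ρ := vwpRatio q x b c d e f g) (g := vwpHead q x b c d e f g) ?_ ?_ ?_
  · unfold vwpRatio
    refine ContinuousAt.mul (ContinuousAt.div (by fun_prop) (by fun_prop) (by simp)) (by fun_prop)
  · rwa [vwpRatio_zero hx he]
  · unfold vwpHead
    exact Continuous.continuousAt (by fun_prop)

/-- All dependence on `b` and `c` is collected in products at `bu, bv` and `cu, cv`, where `uv =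
defg/x³` is free of `k`. This is the shape required by `qFacInf_pair`. -/
theorem vwpSum_term {q : ℂ} (hq0 : q ≠ 0) (hq1 : ‖q‖ < 1) (x b c d e f g : ℂ) (k : ℕ) :
    vwpHead q x b c d e f g (q ^ k) * ∏ i ∈ Finset.range k, vwpRatio q x b c d e f g (q ^ i)
      = ((1 - d * f * g / (e * x) * (q ^ k) ^ 2)
          * (qFacInf q (q * d / e * q ^ k) * qFacInf q (q * g / e * q ^ k))
          * (qFac q (d * f * g / (e * x)) k * qFac q (d * g / x) k * qFac q (f * g / x) k
            * qFac q (d * f / x) k / (qFac q q k * qFac q (q * f / e) k))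
          * ((x / e ^ 2) ^ k * q ^ (k * (k + 1))))
        * ((qFacInf q (b * (e / x * (q ^ k)⁻¹)) * qFacInf q (b * (d * f * g / x ^ 2 * q ^ k)))
          * (qFacInf q (c * (e / x * (q ^ k)⁻¹)) * qFacInf q (c * (d * f * g / x ^ 2 * q ^ k)))) := by
  have h := prod_wpFactor_eq hq0 hq1 (inv_ne_zero hq0) (r := 1) (n := 2) (by norm_num)
    ![b * (e / x), c * (e / x)] k
  simp only [Fin.prod_univ_two, Matrix.cons_val_zero, Matrix.cons_val_one] at h
  have e1 : q ^ (((1 : ℕ) : ℤ) * (k * (k + 1)) - k) * q⁻¹ ^ (-(((1 : ℕ) : ℤ) * k))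
      = q ^ (k * (k + 1)) := by
    rw [inv_zpow, ← zpow_neg, ← zpow_add₀ hq0, ← zpow_natCast]; congr 1; push_cast; ring
  have e2 : q * q⁻¹ ^ 1 = 1 := by rw [pow_one, mul_inv_cancel₀ hq0]
  simp only [e1, e2, div_one] at h
  simp only [zpow_neg, zpow_natCast] at h
  unfold vwpHead vwpRatio
  have a1 : ∀ b : ℂ, b * (e / x * (q ^ k)⁻¹) = b * (e / x) * (q ^ k)⁻¹ := fun b => by ring
  have a2 : ∀ b : ℂ, b * (d * f * g / x ^ 2 * q ^ k) = b * (d * f * g / x ^ 2) * q ^ k :=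
    fun b => by ring
  rw [a1, a1, a2, a2]
  simp only [Finset.prod_mul_distrib, Finset.prod_div_distrib, Finset.prod_const,
    Finset.card_range, qFac] at h ⊢
  linear_combination (1 - d * f * g / (e * x) * (q ^ k) ^ 2)
          * (qFacInf q (q * d / e * q ^ k) * qFacInf q (q * g / e * q ^ k))
          * (((∏ i ∈ Finset.range k, (1 - d * f * g / (e * x) * q ^ i)) *
            (∏ i ∈ Finset.range k, (1 - d * g / x * q ^ i)) *
            (∏ i ∈ Finset.range k, (1 - f * g / x * q ^ i)) *
            (∏ i ∈ Finset.range k, (1 - d * f / x * q ^ i)))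
            / ((∏ i ∈ Finset.range k, (1 - q * q ^ i)) *
              (∏ i ∈ Finset.range k, (1 - q * f / e * q ^ i))))
          * (x / e ^ 2) ^ k * qFacInf q (b * (d * f * g / x ^ 2) * q ^ k)
          * qFacInf q (c * (d * f * g / x ^ 2) * q ^ k) * (-1) * h

theorem qFacInf_pair {q : ℂ} (hq0 : q ≠ 0) (hq1 : ‖q‖ < 1) (b c u v : ℂ) :
    c * ((qFacInf q (b / q * u) * qFacInf q (b / q * v)) * (qFacInf q (c * u) * qFacInf q (c * v)))
      - b * ((qFacInf q (b * u) * qFacInf q (b * v))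
        * (qFacInf q (c / q * u) * qFacInf q (c / q * v)))
      = (c - b) * (1 - b * c * (u * v) / q ^ 2)
        * ((qFacInf q (b * u) * qFacInf q (b * v)) * (qFacInf q (c * u) * qFacInf q (c * v))) := by
  have e : ∀ b u : ℂ, qFacInf q (b / q * u) = (1 - b * u / q) * qFacInf q (b * u) := by
    intro b u
    rw [div_mul_eq_mul_div, qFacInf_div hq0 hq1]
  rw [e, e, e, e]
  field_simp
  ring

theorem vwpSum_pair {q : ℂ} (hq0 : q ≠ 0) (hq1 : ‖q‖ < 1) {x e : ℂ} (hx : x ≠ 0) (he : e ≠ 0)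
    (b c d f g : ℂ) (h : ‖b * c / (q * x)‖ < 1) :
    c * vwpSum q x (b / q) c d e f g - b * vwpSum q x b (c / q) d e f g
      = (c - b) * (1 - b * c * d * e * f * g / (q * (q * x ^ 3))) * vwpSum q x b c d e f g := by
  have h' : ‖b * c / x‖ < 1 := by
    have : b * c / x = b * c / (q * x) * q := by field_simp
    rw [this, norm_mul]
    exact mul_lt_one_of_nonneg_of_lt_one_left (norm_nonneg _) h hq1.le
  have s1 := summable_vwp hq1 hx he (b / q) c d f g (by convert h using 2; field_simp)
  have s2 := summable_vwp hq1 hx he b (c / q) d f g (by convert h using 2; field_simp)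
  have s3 := summable_vwp hq1 hx he b c d f g h'
  unfold vwpSum
  rw [← tsum_mul_left, ← tsum_mul_left, ← tsum_mul_left,
    ← (s1.mul_left c).tsum_sub (s2.mul_left b)]
  congr 1
  funext k
  rw [vwpSum_term hq0 hq1, vwpSum_term hq0 hq1, vwpSum_term hq0 hq1]
  have hp := qFacInf_pair hq0 hq1 b c (e / x * (q ^ k)⁻¹) (d * f * g / x ^ 2 * q ^ k)
  have e1 : b * c * (e / x * (q ^ k)⁻¹ * (d * f * g / x ^ 2 * q ^ k)) / q ^ 2
      = b * c * d * e * f * g / (q * (q * x ^ 3)) := by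
    have := pow_ne_zero k hq0
    field_simp
  rw [e1] at hp
  linear_combination ((1 - d * f * g / (e * x) * (q ^ k) ^ 2)
          * (qFacInf q (q * d / e * q ^ k) * qFacInf q (q * g / e * q ^ k))
          * (qFac q (d * f * g / (e * x)) k * qFac q (d * g / x) k * qFac q (f * g / x) k
            * qFac q (d * f / x) k / (qFac q q k * qFac q (q * f / e) k))
          * ((x / e ^ 2) ^ k * q ^ (k * (k + 1)))) * hp

/-- Under either shift the quotient of infinite products in `vwpPart` gains `(1 - bc/(qx)) / (1 -
bcdefg/(q²x³))`. This trades the constant of `vwpSum_pair` for that of `wpSum_pair`, so series and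
parts obey one relation. -/
theorem vwpPart_pair {q : ℂ} (hq0 : q ≠ 0) (hq1 : ‖q‖ < 1) {x e : ℂ} (hx : x ≠ 0) (he : e ≠ 0)
    (b c d f g : ℂ) (h : ‖b * c / (q * x)‖ < 1)
    (h2 : ‖b * c * d * e * f * g / (q * (q * x ^ 3))‖ < 1) :
    c * vwpPart q x (b / q) c d e f g - b * vwpPart q x b (c / q) d e f g
      = (c - b) * (1 - b * c / (q * x)) * vwpPart q x b c d e f g := by
  have hs := vwpSum_pair hq0 hq1 hx he b c d f g h
  have hd : qFacInf q (b * c * d * e * f * g / (q * (q * x ^ 3)))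
      = (1 - b * c * d * e * f * g / (q * (q * x ^ 3)))
        * qFacInf q (b * c * d * e * f * g / (q * x ^ 3)) := by
    have e1 : b * c * d * e * f * g / (q * (q * x ^ 3)) = b * c * d * e * f * g / (q * x ^ 3) / q := by
      field_simp
    rw [e1, qFacInf_div hq0 hq1]
  have hne := qFacInf_ne_zero_of_norm_lt hq1 h2
  rw [hd] at hne
  obtain ⟨n1, n2⟩ := mul_ne_zero_iff.1 hne
  have d1 : qFacInf q (b / q * c * d * e * f * g / (q * x ^ 3))
      = (1 - b * c * d * e * f * g / (q * (q * x ^ 3)))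
        * qFacInf q (b * c * d * e * f * g / (q * x ^ 3)) := by rw [← hd]; congr 1; field_simp
  have d2 : qFacInf q (b * (c / q) * d * e * f * g / (q * x ^ 3))
      = (1 - b * c * d * e * f * g / (q * (q * x ^ 3)))
        * qFacInf q (b * c * d * e * f * g / (q * x ^ 3)) := by rw [← hd]; congr 1; field_simp
  have n3 : qFacInf q (b * c / x / q) = (1 - b * c / (q * x)) * qFacInf q (b * c / x) := by
    rw [qFacInf_div hq0 hq1]; congr 2; field_simp
  have n4 : b / q * c / x = b * c / x / q := by field_simp
  have n5 : b * (c / q) / x = b * c / x / q := by field_simp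
  unfold vwpPart
  rw [d1, d2, n4, n5, n3]
  generalize qFacInf q (b * c * d * e * f * g / (q * x ^ 3)) = Y at *
  generalize 1 - b * c * d * e * f * g / (q * (q * x ^ 3)) = W at *
  generalize 1 - b * c / (q * x) = V at *
  generalize qFacInf q (b * c / x) = Q at *
  generalize vwpSum q x (b / q) c d e f g = S1 at *
  generalize vwpSum q x b (c / q) d e f g = S2 at *
  generalize vwpSum q x b c d e f g = S3 at *
  field_simp
  linear_combination (vwpConst q x d e f g * V * Q) * hs

theorem continuousAt_vwpHead {q : ℂ} (hq1 : ‖q‖ < 1) {x : ℂ} (hx : x ≠ 0) {X : Type*}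
    [TopologicalSpace X] {b c d e f g s : X → ℂ} {z : X} (hb : ContinuousAt b z)
    (hc : ContinuousAt c z) (hd : ContinuousAt d z) (he : ContinuousAt e z)
    (hf : ContinuousAt f z) (hg : ContinuousAt g z) (hs : ContinuousAt s z) (he0 : e z ≠ 0) :
    ContinuousAt (fun z => vwpHead q x (b z) (c z) (d z) (e z) (f z) (g z) (s z)) z := by
  have hP : ∀ z, ContinuousAt (qFacInf q) z := fun z =>
    (differentiable_qFacInf hq1).continuous.continuousAt
  unfold vwpHead
  fun_prop (disch := simp [he0, hx])

theorem continuousAt_vwpRatio {q x : ℂ} (hx : x ≠ 0) {X : Type*}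
    [TopologicalSpace X] {b c d e f g s : X → ℂ} {z : X} (hb : ContinuousAt b z)
    (hc : ContinuousAt c z) (hd : ContinuousAt d z) (he : ContinuousAt e z)
    (hf : ContinuousAt f z) (hg : ContinuousAt g z) (hs : ContinuousAt s z) (he0 : e z ≠ 0)
    (hs0 : s z = 0) :
    ContinuousAt (fun z => vwpRatio q x (b z) (c z) (d z) (e z) (f z) (g z) (s z)) z := by
  unfold vwpRatio
  refine ContinuousAt.mul (ContinuousAt.div ?_ ?_ (by simp [hs0])) ?_
  · fun_prop (disch := simp [he0, hx])
  · fun_prop (disch := exact he0)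
  · fun_prop (disch := simp [he0])

/-- All parameters may move with `w`, because continuation takes place in `b`, in `d`, and along a
curve moving `d, e, f` together. -/
theorem differentiableOn_vwpPart {q : ℂ} (hq1 : ‖q‖ < 1) {x : ℂ} (hx : x ≠ 0)
    {b c d e f g : ℂ → ℂ} {U : Set ℂ} (hU : IsOpen U) (hb : DifferentiableOn ℂ b U)
    (hc : DifferentiableOn ℂ c U) (hd : DifferentiableOn ℂ d U) (he : DifferentiableOn ℂ e U)
    (hf : DifferentiableOn ℂ f U) (hg : DifferentiableOn ℂ g U)
    (he0 : ∀ w ∈ U, e w ≠ 0) (hf0 : ∀ w ∈ U, f w ≠ 0)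
    (h1 : ∀ w ∈ U, ‖b w * c w / x‖ < 1)
    (h2 : ∀ w ∈ U, ‖b w * c w * d w * e w * f w * g w / (q * x ^ 3)‖ < 1)
    (h3 : ∀ w ∈ U, qFacInf q (e w / f w) ≠ 0) (h4 : ∀ w ∈ U, qFacInf q (f w / e w) ≠ 0)
    (h5 : ∀ w ∈ U, qFacInf q (d w * f w * g w / (e w * x)) ≠ 0)
    (h6 : ∀ w ∈ U, qFacInf q (q * x / (e w * f w)) ≠ 0) :
    DifferentiableOn ℂ (fun w => vwpPart q x (b w) (c w) (d w) (e w) (f w) (g w)) U := by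
  have hP := differentiable_qFacInf hq1
  have hPc : ∀ z, ContinuousAt (qFacInf q) z := fun z => hP.continuous.continuousAt
  unfold vwpPart
  refine DifferentiableOn.mul (DifferentiableOn.mul ?_ ?_) ?_
  · unfold vwpConst qTheta
    refine DifferentiableOn.div ?_ ?_ fun w hw =>
      mul_ne_zero (mul_ne_zero (h3 w hw) (h5 w hw)) (h6 w hw)
    · fun_prop (disch := first | assumption | (intro w hw; simp [hf0 w hw, hx]))
    · fun_prop (disch := first | assumption | (intro w hw; simp [he0 w hw, hf0 w hw, hx]))
  · refine DifferentiableOn.div (by fun_prop) (by fun_prop) fun w hw =>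
      qFacInf_ne_zero_of_norm_lt hq1 (h2 w hw)
  · unfold vwpSum
    have cc : ∀ {F : ℂ → ℂ}, DifferentiableOn ℂ F U → ∀ w ∈ U,
        ContinuousAt (fun z : ℂ × ℂ => F z.1) (w, 0) := fun hF w hw =>
      ContinuousAt.comp (x := (w, (0 : ℂ))) (f := Prod.fst)
        ((hF.differentiableAt (hU.mem_nhds hw)).continuousAt) continuousAt_fst
    refine differentiableOn_ratio hq1
      (ρ := fun w s => vwpRatio q x (b w) (c w) (d w) (e w) (f w) (g w) s)
      (g := fun w s => vwpHead q x (b w) (c w) (d w) (e w) (f w) (g w) s) hU ?_ ?_ ?_ ?_ ?_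
    · intro w hw
      exact continuousAt_vwpRatio hx (cc hb w hw) (cc hc w hw) (cc hd w hw) (cc he w hw)
        (cc hf w hw) (cc hg w hw) continuousAt_snd (he0 w hw) rfl
    · intro w hw
      rw [vwpRatio_zero hx (he0 w hw)]
      exact h1 w hw
    · intro w hw
      exact continuousAt_vwpHead hq1 hx (cc hb w hw) (cc hc w hw) (cc hd w hw) (cc he w hw)
        (cc hf w hw) (cc hg w hw) continuousAt_snd (he0 w hw)
    · intro i
      unfold vwpRatio
      refine DifferentiableOn.mul (DifferentiableOn.div ?_ ?_ ?_) ?_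
      · fun_prop (disch := first | assumption | (intro w hw; simp [he0 w hw, hx]))
      · fun_prop (disch := first | assumption | (intro w hw; simp [he0 w hw, hf0 w hw, hx]))
      · intro w hw
        refine mul_ne_zero ?_ ?_
        · have := (qFacInf_ne_zero_iff hq1).1 (qFacInf_ne_zero_of_norm_lt hq1 hq1) i
          rw [sub_ne_zero]; exact this.symm
        -- The denominators are those of `(qf/e; q)_k`, the factors of `(f/e; q)_∞` with index
        -- shifted by one.
        · have := (qFacInf_ne_zero_iff hq1).1 (h4 w hw) (i + 1)
          rw [sub_ne_zero]
          intro h0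
          apply this
          rw [h0, pow_succ]; ring
      · fun_prop (disch := first | assumption | (intro w hw; simp [he0 w hw]))
    · intro i
      unfold vwpHead
      fun_prop (disch := first | assumption | (intro w hw; simp [he0 w hw, hx]))

/-! ### The edge `b = x/g`. -/

/-- For two thetas shifted together the signs cancel and the triangular exponents double, so a
closed form over the integers needs no parity distinction. -/
theorem qTheta_mul_zpow_pair {q : ℂ} (hq0 : q ≠ 0) (hq1 : ‖q‖ < 1) {z w : ℂ} (hz : z ≠ 0)
    (hw : w ≠ 0) (k : ℤ) :
    qTheta q (z * q ^ (-k)) * qTheta q (w * q ^ (-k))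
      = q ^ (-(k * (k + 1))) * (z * w) ^ k * (qTheta q z * qTheta q w) := by
  have step : ∀ j : ℤ, qTheta q (z * q ^ (-j)) * qTheta q (w * q ^ (-j))
      = q ^ (2 * (j + 1)) * (z * w)⁻¹
        * (qTheta q (z * q ^ (-(j + 1))) * qTheta q (w * q ^ (-(j + 1)))) := by
    intro j
    have e : ∀ z : ℂ, z * q ^ (-j) = z * q ^ (-(j + 1)) * q := fun z => by
      rw [mul_assoc, ← zpow_add_one₀ hq0]; congr 2; ring
    have n := zpow_ne_zero (-(j + 1)) hq0
    rw [e z, e w, qTheta_mul hq0 hq1 (mul_ne_zero hz n), qTheta_mul hq0 hq1 (mul_ne_zero hw n),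
      two_mul, zpow_add₀ hq0, zpow_neg]
    have := zpow_ne_zero (j + 1) hq0
    field_simp
  have hzw := mul_ne_zero hz hw
  induction k with
  | zero => simp
  | succ n ih =>
    have s := step n
    rw [ih] at s
    have n1 : q ^ (2 * ((n : ℤ) + 1)) * (z * w)⁻¹ ≠ 0 :=
      mul_ne_zero (zpow_ne_zero _ hq0) (inv_ne_zero hzw)
    apply mul_left_cancel₀ n1
    rw [← s, show -((n : ℤ) * (n + 1)) = 2 * ((n : ℤ) + 1) + -(((n : ℤ) + 1) * (n + 1 + 1)) by ring,
      zpow_add₀ hq0, zpow_add_one₀ hzw]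
    field_simp
  | pred n ih =>
    have e : q ^ (-((-(n : ℤ) - 1) * -(n : ℤ))) = q ^ (2 * -(n : ℤ)) * q ^ (-(-(n : ℤ) * (-n + 1))) := by
      rw [← zpow_add₀ hq0]; congr 1; ring
    rw [step, sub_add_cancel, ih, e, zpow_sub_one₀ hzw]
    ring

theorem wpFactor_mul {q : ℂ} (hq0 : q ≠ 0) (hq1 : ‖q‖ < 1) {x g : ℂ} (hx : x ≠ 0) (hg : g ≠ 0)
    (k : ℤ) : wpFactor q x (x / g) k * wpFactor q x g k
      = q ^ (-(k * (k + 1))) * x ^ k * (qTheta q g * qTheta q (x / g)) := by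
  have h := qTheta_mul_zpow_pair hq0 hq1 hg (div_ne_zero hx hg) k
  rw [mul_div_cancel₀ _ hg] at h
  rw [← h]
  unfold wpFactor qTheta
  have e1 : x / g * q ^ (k + 1) / x = q / (g * q ^ (-k)) := by
    rw [zpow_add_one₀ hq0, zpow_neg]; have := zpow_ne_zero k hq0; field_simp
  have e2 : g * q ^ (k + 1) / x = q / (x / g * q ^ (-k)) := by
    rw [zpow_add_one₀ hq0, zpow_neg]; have := zpow_ne_zero k hq0; field_simp
  rw [e1, e2]; ring

/-- The factors of `g` and `x/g` combine into two shifted thetas whose dependence on `k` is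
elementary and lowers `r` from 3 to 2. This turns the series into a `₆ψ₆`. -/
theorem wpSum_six_eq {q : ℂ} (hq0 : q ≠ 0) (hq1 : ‖q‖ < 1) {x g : ℂ} (hx : x ≠ 0) (hg : g ≠ 0)
    (c d e f : ℂ) : wpSum q x 3 ![x / g, c, d, e, f, g]
      = qTheta q g * qTheta q (x / g) * wpSum q x 2 ![c, d, e, f] := by
  unfold wpSum
  rw [← tsum_mul_left]
  congr 1; funext k
  have h := wpFactor_mul hq0 hq1 hx hg k
  have e1 : q ^ (((3 : ℕ) : ℤ) * (k * (k + 1)) - k) * q ^ (-(k * (k + 1)))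
      = q ^ (((2 : ℕ) : ℤ) * (k * (k + 1)) - k) := by
    rw [← zpow_add₀ hq0]; congr 1; push_cast; ring
  have e2 : x ^ (-(((3 : ℕ) : ℤ) * k)) * x ^ k = x ^ (-(((2 : ℕ) : ℤ) * k)) := by
    rw [← zpow_add₀ hx]; congr 1; push_cast; ring
  unfold wpTerm
  simp only [Fin.prod_univ_four, Fin.prod_univ_six, Matrix.cons_val_zero, Matrix.cons_val_one,
    Matrix.cons_val]
  rw [← e1, ← e2]
  linear_combination ((1 - q ^ (2 * k + 1) / x) * (q ^ (((3 : ℕ) : ℤ) * (k * (k + 1)) - k)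
    * x ^ (-(((3 : ℕ) : ℤ) * k))) * (wpFactor q x c k * wpFactor q x d k * wpFactor q x e k
    * wpFactor q x f k)) * h

/-- Reversal of a finite `q`-product. The triangular power of `q` is kept as `∏ q ^ i` to avoid
division by two. -/
theorem qFacInf_shift_down {q : ℂ} (hq0 : q ≠ 0) (hq1 : ‖q‖ < 1) {z : ℂ} (hz : z ≠ 0) (j : ℕ) :
    qFacInf q (q / z * (q ^ j)⁻¹) * ∏ i ∈ Finset.range j, q ^ i
      = qFacInf q (q / z) * qFac q z j * (-1 / z) ^ j := by
  induction j with
  | zero => simp [qFac_zero]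
  | succ j ih =>
    have e : q / z * (q ^ (j + 1))⁻¹ * q = q / z * (q ^ j)⁻¹ := by field_simp; ring
    rw [qFacInf_eq hq1, e, Finset.prod_range_succ, qFac_succ]
    have e2 : (1 - q / z * (q ^ (j + 1))⁻¹) * q ^ j = (-1 / z) * (1 - z * q ^ j) := by
      field_simp; ring
    linear_combination (qFacInf q (q / z * (q ^ j)⁻¹) * ∏ i ∈ Finset.range j, q ^ i) * e2
      + (-1 / z) * (1 - z * q ^ j) * ih

theorem qTheta_shift_down {q : ℂ} (hq0 : q ≠ 0) (hq1 : ‖q‖ < 1) {z : ℂ} (hz : z ≠ 0) (j : ℕ) :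
    qTheta q (z * (q ^ j)⁻¹) * ((∏ i ∈ Finset.range j, q ^ i) * q ^ j) = (-z) ^ j * qTheta q z := by
  induction j with
  | zero => simp
  | succ j ih =>
    have e : z * (q ^ j)⁻¹ = z * (q ^ (j + 1))⁻¹ * q := by field_simp; ring
    have n : z * (q ^ (j + 1))⁻¹ ≠ 0 := mul_ne_zero hz (inv_ne_zero (pow_ne_zero _ hq0))
    rw [e, qTheta_mul hq0 hq1 n] at ih
    rw [Finset.prod_range_succ, pow_succ (-z), mul_right_comm ((-z) ^ j), ← ih]
    field_simp

theorem prod_pow_range_sq (q : ℂ) (j : ℕ) :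
    (∏ i ∈ Finset.range j, q ^ i) ^ 2 * q ^ j = q ^ (j * j) := by
  induction j with
  | zero => simp
  | succ j ih =>
    rw [Finset.prod_range_succ, show (j + 1) * (j + 1) = j * j + (2 * j + 1) by ring,
      pow_add q (j * j), ← ih]
    ring

/-- At `b = x/g` one product of `b` joins `(q^{j+1}g/e; q)_∞` to form a shifted theta, and the other
cancels the numerator `(df/x; q)_j`. The `₈φ₇` becomes a `₆φ₅`, written as a bilateral series with
base `X = qex/(dfg)`; one of its parameters is `X` itself. -/
theorem vwpSum_base_term {q : ℂ} (hq0 : q ≠ 0) (hq1 : ‖q‖ < 1) {x c d e f g : ℂ} (hx : x ≠ 0)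
    (hd : d ≠ 0) (he : e ≠ 0) (hf : f ≠ 0) (hg : g ≠ 0) (hfe : qFacInf q (f / e) ≠ 0) (j : ℕ) :
    qFacInf q q * qFacInf q (q * (e * x) / (d * f * g)) * qFacInf q (q * x / (d * g))
        * qFacInf q (q * x / (f * g)) * qFacInf q (q * f / e)
        * (vwpHead q x (x / g) c d e f g (q ^ j)
          * ∏ i ∈ Finset.range j, vwpRatio q x (x / g) c d e f g (q ^ i))
      = qFacInf q (d * f / x) * qTheta q (e / g)
        * wpTerm q (q * (e * x) / (d * f * g)) 2
          ![q * (e * x) / (d * f * g), q * x / (d * g), q * x / (f * g), c * (e / x)] j := by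
  rw [vwpSum_term hq0 hq1]
  unfold wpTerm wpFactor
  simp only [Fin.prod_univ_four, Matrix.cons_val_zero, Matrix.cons_val_one, Matrix.cons_val]
  have hqj : q ^ j ≠ 0 := pow_ne_zero _ hq0
  have hzp : q ^ ((j : ℤ) + 1) = q ^ j * q := by rw [zpow_add_one₀ hq0, zpow_natCast]
  have hzn : q ^ (-(j : ℤ)) = (q ^ j)⁻¹ := by rw [zpow_neg, zpow_natCast]
  have hz2 : q ^ (2 * (j : ℤ) + 1) = (q ^ j) ^ 2 * q := by
    rw [zpow_add_one₀ hq0, ← pow_mul, mul_comm j 2, ← zpow_natCast]; push_cast; ring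
  have hw : q ^ (((2 : ℕ) : ℤ) * (j * (j + 1)) - j)
      = q ^ (j * j) * q ^ (j * j) * q ^ j := by
    rw [← pow_add, ← pow_add, ← zpow_natCast]; congr 1; push_cast; ring
  have hxw : (q * (e * x) / (d * f * g)) ^ (-(((2 : ℕ) : ℤ) * j))
      = ((d * f * g / (e * x)) ^ j / q ^ j) ^ 2 := by
    have h0 : q * (e * x) / (d * f * g) = ((d * f * g / (e * x)) / q)⁻¹ := by field_simp
    rw [h0, inv_zpow, ← zpow_neg, neg_neg, mul_comm (((2 : ℕ)) : ℤ), zpow_mul, zpow_natCast, zpow_natCast, div_pow]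
  rw [hzp, hzn, hz2, hw, hxw]
  have hA : d * f * g / (e * x) ≠ 0 :=
    div_ne_zero (mul_ne_zero (mul_ne_zero hd hf) hg) (mul_ne_zero he hx)
  have hB : d * g / x ≠ 0 := div_ne_zero (mul_ne_zero hd hg) hx
  have hC : f * g / x ≠ 0 := div_ne_zero (mul_ne_zero hf hg) hx
  have I1 := qFacInf_shift_down hq0 hq1 hA j
  have I2 := qFacInf_shift_down hq0 hq1 hB j
  have I3 := qFacInf_shift_down hq0 hq1 hC j
  have I4 := qTheta_shift_down hq0 hq1 (div_ne_zero he hg) j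
  have I5 := prod_pow_range_sq q j
  have H1 := qFacInf_eq_qFac_mul hq1 (d * f / x) j
  have H2 := qFacInf_eq_qFac_mul hq1 q j
  have H3 := qFacInf_eq_qFac_mul hq1 (q * f / e) j
  have nq : qFac q q j ≠ 0 := by
    intro h0; rw [h0, zero_mul] at H2
    exact qFacInf_ne_zero_of_norm_lt hq1 hq1 H2
  have nf : qFac q (q * f / e) j ≠ 0 := by
    intro h0; rw [h0, zero_mul] at H3
    apply hfe
    rw [qFacInf_eq hq1, show f / e * q = q * f / e by ring, H3, mul_zero]
  have hT : qTheta q (e / g * (q ^ j)⁻¹)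
      = qFacInf q (x / g * (e / x * (q ^ j)⁻¹)) * qFacInf q (q * g / e * q ^ j) := by
    unfold qTheta
    congr 2 <;> field_simp
  rw [hT] at I4
  have r1 : x / g * (d * f * g / x ^ 2 * q ^ j) = d * f / x * q ^ j := by field_simp
  have r2 : q * (e * x) / (d * f * g) = q / (d * f * g / (e * x)) := by field_simp
  have r3 : q * x / (d * g) = q / (d * g / x) := by field_simp
  have r4 : q * x / (f * g) = q / (f * g / x) := by field_simp
  have r5 : q / (d * f * g / (e * x)) * (q ^ j * q) / (q / (d * f * g / (e * x))) = q * q ^ j := by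
    field_simp
  have r6 : q / (d * g / x) * (q ^ j * q) / (q / (d * f * g / (e * x))) = q * f / e * q ^ j := by
    field_simp
  have r7 : q / (f * g / x) * (q ^ j * q) / (q / (d * f * g / (e * x))) = q * d / e * q ^ j := by
    field_simp
  have r8 : c * (e / x) * (q ^ j * q) / (q / (d * f * g / (e * x)))
      = c * (d * f * g / x ^ 2 * q ^ j) := by field_simp
  have r9 : c * (e / x) * (q ^ j)⁻¹ = c * (e / x * (q ^ j)⁻¹) := by ring
  have r10 : 1 - (q ^ j) ^ 2 * q / (q / (d * f * g / (e * x)))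
      = 1 - d * f * g / (e * x) * (q ^ j) ^ 2 := by field_simp
  have r11 : q ^ (j * (j + 1)) = q ^ (j * j) * q ^ j := by rw [← pow_add]; congr 1
  have pw : (-(e / g)) ^ j * (x / e ^ 2) ^ j = ((d * f * g / (e * x)) ^ j) ^ 2
      * ((-1 / (d * f * g / (e * x))) ^ j * (-1 / (d * g / x)) ^ j * (-1 / (f * g / x)) ^ j) := by
    rw [← pow_mul, mul_comm j 2, pow_mul, ← mul_pow, ← mul_pow, ← mul_pow, ← mul_pow]
    congr 1
    field_simp
  rw [r1, r2, r3, r4, r5, r6, r7, r8, r9, r10, r11, H1, H2, H3]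
  have hQ : (∏ i ∈ Finset.range j, q ^ i) ≠ 0 :=
    Finset.prod_ne_zero_iff.2 fun i _ => pow_ne_zero _ hq0
  clear r1 r2 r3 r4 r5 r6 r7 r8 r9 r10 r11 hT hzp hzn hz2 hw hxw H1 H2 H3 hfe hA hB hC
  generalize (∏ i ∈ Finset.range j, q ^ i) = Q at *
  generalize qFacInf q (q / (d * f * g / (e * x)) * (q ^ j)⁻¹) = X0 at *
  generalize qFacInf q (q / (d * g / x) * (q ^ j)⁻¹) = X2 at *
  generalize qFacInf q (q / (f * g / x) * (q ^ j)⁻¹) = X4 at *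
  generalize qFacInf q (q / (d * f * g / (e * x))) = Y0 at *
  generalize qFacInf q (q / (d * g / x)) = Y2 at *
  generalize qFacInf q (q / (f * g / x)) = Y4 at *
  generalize (-1 / (d * f * g / (e * x))) ^ j = w1 at *
  generalize (-1 / (d * g / x)) ^ j = w2 at *
  generalize (-1 / (f * g / x)) ^ j = w3 at *
  generalize (-(e / g)) ^ j = w4 at *
  generalize (x / e ^ 2) ^ j = w5 at *
  generalize qFacInf q (x / g * (e / x * (q ^ j)⁻¹)) = Z1 at *
  generalize qFacInf q (q * g / e * q ^ j) = Z2 at *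
  generalize qFac q (d * f * g / (e * x)) j = F1 at *
  generalize qFac q (d * g / x) j = F2 at *
  generalize qFac q (f * g / x) j = F3 at *
  generalize qFac q (d * f / x) j = F4 at *
  generalize qFac q q j = F5 at *
  generalize qFac q (q * f / e) j = F6 at *
  generalize qTheta q (e / g) = T at *
  generalize (d * f * g / (e * x)) ^ j = w6 at *
  generalize q ^ (j * j) = N at *
  generalize 1 - d * f * g / (e * x) * (q ^ j) ^ 2 = E at *
  generalize qFacInf q (d * f / x * q ^ j) = G1 at *
  generalize qFacInf q (q * q ^ j) = G2 at *
  generalize qFacInf q (q * f / e * q ^ j) = G3 at *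
  generalize qFacInf q (q * d / e * q ^ j) = G4 at *
  generalize qFacInf q (c * (e / x * (q ^ j)⁻¹)) = G5 at *
  generalize qFacInf q (c * (d * f * g / x ^ 2 * q ^ j)) = G6 at *
  generalize q ^ j = t at *
  -- The reversal formulas all carry `Q = ∏ q ^ i`; multiplying by `Q ^ 3 * t` lets them be used
  -- without division.
  have core : Y0 * Y2 * Y4 * (F1 * F2 * F3) * (Z1 * Z2) * (w5 * (N * t))
      = T * (N * N * t * (w6 / t) ^ 2) * (X0 * X2 * X4) := by
    apply mul_right_cancel₀ (mul_ne_zero (pow_ne_zero 3 hQ) hqj)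
    calc Y0 * Y2 * Y4 * (F1 * F2 * F3) * (Z1 * Z2) * (w5 * (N * t)) * (Q ^ 3 * t)
        = Y0 * Y2 * Y4 * (F1 * F2 * F3) * (Z1 * Z2 * (Q * t)) * w5 * N * (Q ^ 2 * t) := by ring
      _ = Y0 * Y2 * Y4 * (F1 * F2 * F3) * T * (w4 * w5) * N * N := by rw [I4, I5]; ring
      _ = T * N * N * w6 ^ 2 * ((Y0 * F1 * w1) * (Y2 * F2 * w2) * (Y4 * F3 * w3)) := by
        rw [pw]; ring
      _ = T * N * N * w6 ^ 2 * ((X0 * Q) * (X2 * Q) * (X4 * Q)) := by rw [I1, I2, I3]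
      _ = T * (N * N * t * (w6 / t) ^ 2) * (X0 * X2 * X4) * (Q ^ 3 * t) := by field_simp
  have cq : F5 * F6 * (F1 * F2 * F3 * F4 / (F5 * F6)) = F1 * F2 * F3 * F4 := by field_simp
  linear_combination (G1 * G2 * G3 * E * G4 * G5 * G6 * F4) * core
    + (G2 * Y0 * Y2 * Y4 * G3 * E * G4 * Z2 * w5 * N * t * Z1 * G1 * G5 * G6) * cq

theorem wpTerm_neg_eq_zero {q : ℂ} (hq0 : q ≠ 0) (hq1 : ‖q‖ < 1) {x : ℂ} (hx : x ≠ 0) (r : ℕ)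
    {n : ℕ} (p : Fin n → ℂ) {i : Fin n} (hi : p i = x) (j : ℕ) :
    wpTerm q x r p (-((j : ℤ) + 1)) = 0 := by
  have h : wpFactor q x (p i) (-((j : ℤ) + 1)) = 0 := by
    unfold wpFactor
    rw [hi, mul_div_right_comm, div_self hx, one_mul, show -((j : ℤ) + 1) + 1 = -j by ring,
      (qFacInf_eq_zero hq1 (a := q ^ (-(j : ℤ))) (n := j) (by
        rw [zpow_neg, zpow_natCast, inv_mul_cancel₀ (pow_ne_zero _ hq0)])), mul_zero]
  unfold wpTerm
  rw [Finset.prod_eq_zero (Finset.mem_univ i) h, mul_zero]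

/-- A parameter equal to `x` annihilates every term of negative index, so the bilateral sum is
unilateral. -/
theorem tsum_wpTerm_nat_of_eq {q : ℂ} (hq0 : q ≠ 0) (hq1 : ‖q‖ < 1) {x : ℂ} (hx : x ≠ 0) (r : ℕ)
    {n : ℕ} (p : Fin n → ℂ) {i : Fin n} (hi : p i = x) :
    ∑' j : ℕ, wpTerm q x r p j = wpSum q x r p := by
  unfold wpSum
  rw [← Function.Injective.tsum_eq (f := wpTerm q x r p) Nat.cast_injective]
  intro k hk
  rcases lt_or_ge k 0 with h | h
  · exfalso
    apply hk
    obtain ⟨j, rfl⟩ : ∃ j : ℕ, k = -((j : ℤ) + 1) := ⟨(-k - 1).toNat, by omega⟩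
    exact wpTerm_neg_eq_zero hq0 hq1 hx r p hi j
  · exact ⟨k.toNat, by simp [h]⟩

theorem vwpSum_base {q : ℂ} (hq0 : q ≠ 0) (hq1 : ‖q‖ < 1) {x c d e f g : ℂ} (hx : x ≠ 0)
    (hd : d ≠ 0) (he : e ≠ 0) (hf : f ≠ 0) (hg : g ≠ 0) (hfe : qFacInf q (f / e) ≠ 0)
    (hc : ‖c / g‖ < 1) (h1 : qFacInf q (q * (e * x) / (d * f * g)) ≠ 0)
    (h2 : qFacInf q (q * x / (d * g)) ≠ 0) (h3 : qFacInf q (q * x / (f * g)) ≠ 0) :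
    qFacInf q (q * f / e) * vwpSum q x (x / g) c d e f g
      = qFacInf q (d * f / x) * qTheta q (e / g) * qFacInf q (d * f * g / (e * x))
        * (qFacInf q (c * e / x) * qFacInf q (q * x / (e * g)) * qFacInf q (c * f / x)
          * qFacInf q (c * d / x)) / qFacInf q (c / g) := by
  have hX : q * (e * x) / (d * f * g) ≠ 0 :=
    div_ne_zero (mul_ne_zero hq0 (mul_ne_zero he hx)) (mul_ne_zero (mul_ne_zero hd hf) hg)
  have key := congrArg (fun F : ℕ → ℂ => ∑' j, F j)
    (funext fun j => vwpSum_base_term hq0 hq1 hx hd he hf hg (c := c) hfe j)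
  simp only [tsum_mul_left] at key
  have e1 : q * (e * x) / (d * f * g) * (q * x / (d * g)) * (q * x / (f * g)) * (c * (e / x))
      / (q * (q * (e * x) / (d * f * g)) ^ 2) = c / g := by field_simp
  rw [tsum_wpTerm_nat_of_eq hq0 hq1 hX 2 _ (i := 0) rfl, wpSum_four hq0 hq1 hX (by rwa [e1])] at key
  unfold baileyProd at key
  have r1 : ∀ z, q * (e * x) / (d * f * g) * z / (q * (e * x) / (d * f * g)) = z :=
    fun z => mul_div_cancel_left₀ z hX
  have r2 : q * x / (d * g) * (q * x / (f * g)) / (q * (e * x) / (d * f * g)) = q * x / (e * g) := by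
    field_simp
  have r3 : q * x / (d * g) * (c * e / x) / (q * (e * x) / (d * f * g)) = c * f / x := by
    field_simp
  have r4 : q * x / (f * g) * (c * e / x) / (q * (e * x) / (d * f * g)) = c * d / x := by
    field_simp
  have r5 : qTheta q (q * (e * x) / (d * f * g))
      = qFacInf q (q * (e * x) / (d * f * g)) * qFacInf q (d * f * g / (e * x)) := by
    unfold qTheta; congr 2; field_simp
  have r6 : c * (e / x) = c * e / x := by ring
  rw [e1] at key
  simp only [r6] at key
  simp only [r1, r2, r3, r4, r5] at key
  have hqq := qFacInf_ne_zero_of_norm_lt hq1 hq1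
  apply mul_left_cancel₀ (mul_ne_zero (mul_ne_zero (mul_ne_zero hqq h1) h2) h3)
  unfold vwpSum
  rw [← mul_assoc]
  rw [key]
  ring

/-- The multiplier is, up to sign and a power of the parameters, symmetric in `e` and `f`; it serves
as common denominator when the two parts are added. -/
theorem vwpPart_base {q : ℂ} (hq0 : q ≠ 0) (hq1 : ‖q‖ < 1) {x c d e f g : ℂ} (hx : x ≠ 0)
    (hd : d ≠ 0) (he : e ≠ 0) (hf : f ≠ 0) (hg : g ≠ 0) (hfe : qFacInf q (f / e) ≠ 0)
    (hef : qFacInf q (e / f) ≠ 0) (ha : qFacInf q (d * f * g / (e * x)) ≠ 0)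
    (hxef : qFacInf q (q * x / (e * f)) ≠ 0)
    (hc : ‖c / g‖ < 1) (hn : ‖c * d * e * f / (q * x ^ 2)‖ < 1)
    (h1 : qFacInf q (q * (e * x) / (d * f * g)) ≠ 0)
    (h2 : qFacInf q (q * x / (d * g)) ≠ 0) (h3 : qFacInf q (q * x / (f * g)) ≠ 0) :
    vwpPart q x (x / g) c d e f g * (qTheta q (e / f) * qFacInf q (q * x / (e * f))
        * qFacInf q (c * d * e * f / (q * x ^ 2)))
      = x ^ 2 / f * (qFacInf q q * qTheta q (1 / x) * (qTheta q (e * g / x) * qTheta q (e / g)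
          * (qTheta q (f / x) * qTheta q f)))
        * (qFacInf q (c * d / x) * qFacInf q (c * e / x) * qFacInf q (c * f / x)
          * qFacInf q (d * e / x) * qFacInf q (d * f / x)) := by
  have L := vwpSum_base hq0 hq1 hx hd he hf hg hfe hc h1 h2 h3
  have n1 := qFacInf_ne_zero_of_norm_lt hq1 hc
  have n2 := qFacInf_ne_zero_of_norm_lt hq1 hn
  have r1 : x / g * c / x = c / g := by field_simp
  have r2 : x / g * c * d * e * f * g / (q * x ^ 3) = c * d * e * f / (q * x ^ 2) := by field_simp
  have t1 : qTheta q (e / f) = qFacInf q (e / f) * qFacInf q (q * f / e) := by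
    unfold qTheta; congr 2; field_simp
  have t2 : qTheta q (e * g / x) = qFacInf q (e * g / x) * qFacInf q (q * x / (e * g)) := by
    unfold qTheta; congr 2; field_simp
  have L' : qFacInf q (q * f / e) * vwpSum q x (x / g) c d e f g * qFacInf q (c / g)
      = qFacInf q (d * f / x) * qTheta q (e / g) * qFacInf q (d * f * g / (e * x))
        * (qFacInf q (c * e / x) * qFacInf q (q * x / (e * g)) * qFacInf q (c * f / x)
          * qFacInf q (c * d / x)) := by
    rw [L, div_mul_cancel₀ _ n1]
  unfold vwpPart vwpConst
  rw [r1, r2, t1, t2]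
  clear L r1 r2 t1 t2 n1
  generalize vwpSum q x (x / g) c d e f g = V at *
  generalize qFacInf q (q * x / (e * f)) = A1 at *
  generalize qFacInf q (q * x / (e * g)) = A2 at *
  generalize qFacInf q (d * f * g / (e * x)) = A3 at *
  generalize qFacInf q (c * d * e * f / (q * x ^ 2)) = A4 at *
  generalize qFacInf q (e / f) = A5 at *
  generalize qFacInf q (c / g) = A6 at *
  generalize qFacInf q (q * f / e) = A7 at *
  generalize qFacInf q (d * f / x) = A8 at *
  generalize qFacInf q (c * d / x) = A9 at *
  generalize qFacInf q (c * e / x) = B1 at *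
  generalize qFacInf q (c * f / x) = B2 at *
  generalize qFacInf q (d * e / x) = B3 at *
  generalize qFacInf q (e * g / x) = B4 at *
  generalize qTheta q (e / g) = T1 at *
  generalize qTheta q (1 / x) = T2 at *
  generalize qTheta q (f / x) = T3 at *
  field_simp
  linear_combination (qFacInf q q * T2 * B4 * B3 * T3 * qTheta q f) * L'

/-! ### Vanishing of the defect. -/

/-- The difference of the two sides of the transformation formula. -/
noncomputable def defect (q x b c d e f g : ℂ) : ℂ :=
  wpSum q x 3 ![b, c, d, e, f, g] - vwpPart q x b c d e f g - vwpPart q x b c d f e g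

/-- Once both kinds of series are summed, a common factor splits off and the three remaining theta
products are those of `qTheta_weierstrass`. -/
theorem defect_base {q : ℂ} (hq0 : q ≠ 0) (hq1 : ‖q‖ < 1) {x c d e f g : ℂ} (hx : x ≠ 0)
    (hd : d ≠ 0) (he : e ≠ 0) (hf : f ≠ 0) (hg : g ≠ 0) (hfe : qFacInf q (f / e) ≠ 0)
    (hef : qFacInf q (e / f) ≠ 0) (ha : qFacInf q (d * f * g / (e * x)) ≠ 0)
    (ha' : qFacInf q (d * e * g / (f * x)) ≠ 0) (hxef : qFacInf q (q * x / (e * f)) ≠ 0)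
    (hc : ‖c / g‖ < 1) (hn : ‖c * d * e * f / (q * x ^ 2)‖ < 1)
    (h1 : qFacInf q (q * (e * x) / (d * f * g)) ≠ 0)
    (h1' : qFacInf q (q * (f * x) / (d * e * g)) ≠ 0)
    (h2 : qFacInf q (q * x / (d * g)) ≠ 0) (h3 : qFacInf q (q * x / (f * g)) ≠ 0)
    (h3' : qFacInf q (q * x / (e * g)) ≠ 0) :
    defect q x (x / g) c d e f g = 0 := by
  have v1 := vwpPart_base hq0 hq1 hx hd he hf hg hfe hef ha hxef hc hn h1 h2 h3
  have v2 := vwpPart_base hq0 hq1 hx hd hf he hg hef hfe ha' (by rwa [mul_comm f e]) hc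
    (by rwa [show c * d * f * e = c * d * e * f by ring]) h1' h2 h3'
  have n2 := qFacInf_ne_zero_of_norm_lt hq1 hn
  have hw := qTheta_weierstrass hq0 hq1 hx he hf hg
  have tfe : qTheta q (f / e) = -(f / e) * qTheta q (e / f) := by
    rw [← inv_div e f, qTheta_inv hq1 (div_ne_zero he hf), inv_div]
  have tgx : qTheta q (x / g) = -(x / g) * qTheta q (g / x) := by
    rw [← inv_div g x, qTheta_inv hq1 (div_ne_zero hg hx), inv_div]
  have tx : qTheta q x = -x * qTheta q (1 / x) := by
    have := qTheta_inv hq1 (inv_ne_zero hx)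
    rw [inv_inv] at this
    rw [this, one_div]
  have tef : qTheta q (e * f / x) = qFacInf q (e * f / x) * qFacInf q (q * x / (e * f)) := by
    unfold qTheta; congr 2; field_simp
  have nef : qTheta q (e / f) ≠ 0 := by
    unfold qTheta
    refine mul_ne_zero hef ?_
    rw [qFacInf_eq hq1] at hfe
    convert right_ne_zero_of_mul hfe using 2
    field_simp
  unfold defect
  rw [wpSum_six_eq hq0 hq1 hx hg, wpSum_four hq0 hq1 hx hn]
  unfold baileyProd
  rw [tgx, tx]
  rw [tfe, mul_comm f e, show c * d * f * e = c * d * e * f by ring] at v2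
  rw [tef] at hw
  apply mul_right_cancel₀ (mul_ne_zero (mul_ne_zero nef hxef) n2)
  rw [zero_mul, sub_mul, sub_mul, v1]
  have v2' : vwpPart q x (x / g) c d f e g * (qTheta q (e / f) * qFacInf q (q * x / (e * f))
        * qFacInf q (c * d * e * f / (q * x ^ 2)))
      = - (x ^ 2 / f * (qFacInf q q * qTheta q (1 / x) * (qTheta q (f * g / x) * qTheta q (f / g)
          * (qTheta q (e / x) * qTheta q e)))
        * (qFacInf q (c * d / x) * qFacInf q (c * e / x) * qFacInf q (c * f / x)
          * qFacInf q (d * e / x) * qFacInf q (d * f / x))) := by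
    generalize qTheta q (e / f) = T at *
    generalize qFacInf q (c * d * e * f / (q * x ^ 2)) = A4 at *
    generalize qFacInf q (q * x / (e * f)) = A1 at *
    generalize qTheta q (1 / x) = T1 at *
    field_simp at v2 ⊢
    linear_combination (-1) * v2
  rw [v2']
  clear v1 v2 v2' tfe tgx tx tef
  generalize qTheta q (e / f) = T at *
  generalize qFacInf q (c * d * e * f / (q * x ^ 2)) = A4 at *
  generalize qFacInf q (q * x / (e * f)) = A1 at *
  generalize qTheta q (1 / x) = T1 at *
  generalize qTheta q (g / x) = T2 at *
  generalize qFacInf q (e * f / x) = A2 at *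
  generalize qTheta q (f / x) = T3 at *
  generalize qTheta q (e / x) = T4 at *
  generalize qTheta q (f / g) = T5 at *
  generalize qTheta q (e / g) = T6 at *
  generalize qTheta q (f * g / x) = T7 at *
  generalize qTheta q (e * g / x) = T8 at *
  generalize qFacInf q (c * d / x) = B1 at *
  generalize qFacInf q (c * e / x) = B2 at *
  generalize qFacInf q (c * f / x) = B3 at *
  generalize qFacInf q (d * e / x) = B4 at *
  generalize qFacInf q (d * f / x) = B5 at *
  field_simp
  linear_combination (x ^ 2 * qFacInf q q * T1 * B1 * B2 * B3 * B4 * B5) * hw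

theorem defect_comm (q x b c d e f g : ℂ) : defect q x b c d e f g = defect q x c b d e f g := by
  have h : wpSum q x 3 ![b, c, d, e, f, g] = wpSum q x 3 ![c, b, d, e, f, g] := by
    unfold wpSum wpTerm
    congr 1; funext k
    simp only [Fin.prod_univ_six, Matrix.cons_val_zero, Matrix.cons_val_one, Matrix.cons_val]
    ring
  have hv : ∀ e f, vwpPart q x b c d e f g = vwpPart q x c b d e f g := by
    intro e f
    unfold vwpPart vwpSum
    congr 1
    · congr 3 <;> ring
    · congr 1; funext k; unfold vwpHead vwpRatio
      congr 1
      · ring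
      · congr 1; funext i; ring
  unfold defect
  rw [h, hv, hv]

/-- Together with `defect_comm` this symmetry carries the edge `b = x/g` to the edge `c = x/d`. -/
theorem defect_swap (q x b c d e f g : ℂ) : defect q x b c d e f g = defect q x b c g e f d := by
  have h : wpSum q x 3 ![b, c, d, e, f, g] = wpSum q x 3 ![b, c, g, e, f, d] := by
    unfold wpSum wpTerm
    congr 1; funext k
    simp only [Fin.prod_univ_six, Matrix.cons_val_zero, Matrix.cons_val_one, Matrix.cons_val]
    ring
  have hv : ∀ e f, vwpPart q x b c d e f g = vwpPart q x b c g e f d := by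
    intro e f
    have e1 : d * f * g = g * f * d := by ring
    unfold vwpPart vwpSum vwpConst
    congr 1
    · congr 1
      · rw [e1, mul_comm e g, mul_comm d e]; ring
      · congr 2; ring
    · congr 1; funext k; unfold vwpHead vwpRatio
      rw [e1]
      congr 1
      · ring
      · congr 1; funext i; ring
  unfold defect
  rw [h, hv, hv]

theorem defect_pair {q : ℂ} (hq0 : q ≠ 0) (hq1 : ‖q‖ < 1) {x e f : ℂ} (hx : x ≠ 0) (he : e ≠ 0)
    (hf : f ≠ 0) (b c d g : ℂ) (h : ‖b * c / (q * x)‖ < 1)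
    (h2 : ‖b * c * d * e * f * g / (q * (q * x ^ 3))‖ < 1) :
    c * defect q x (b / q) c d e f g - b * defect q x b (c / q) d e f g
      = (c - b) * (1 - b * c / (q * x)) * defect q x b c d e f g := by
  have h1 := wpSum_pair hq0 hq1 hx (r := 3) (n := 4) (by norm_num) b c ![d, e, f, g] (by
    simp only [Fin.prod_univ_four, Matrix.cons_val_zero, Matrix.cons_val_one, Matrix.cons_val]
    convert h2 using 2; ring)
  have v1 := vwpPart_pair hq0 hq1 hx he b c d f g h h2
  have v2 := vwpPart_pair hq0 hq1 hx hf b c d e g h (by convert h2 using 2; ring)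
  unfold defect
  linear_combination h1 - v1 - v2

theorem differentiableOn_defect {q : ℂ} (hq0 : q ≠ 0) (hq1 : ‖q‖ < 1) {x : ℂ} (hx : x ≠ 0)
    {b c d e f g : ℂ → ℂ} {U : Set ℂ} (hU : IsOpen U) (hb : DifferentiableOn ℂ b U)
    (hc : DifferentiableOn ℂ c U) (hd : DifferentiableOn ℂ d U) (he : DifferentiableOn ℂ e U)
    (hf : DifferentiableOn ℂ f U) (hg : DifferentiableOn ℂ g U)
    (he0 : ∀ w ∈ U, e w ≠ 0) (hf0 : ∀ w ∈ U, f w ≠ 0)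
    (h1 : ∀ w ∈ U, ‖b w * c w / x‖ < 1)
    (h2 : ∀ w ∈ U, ‖b w * c w * d w * e w * f w * g w / (q * x ^ 3)‖ < 1)
    (h3 : ∀ w ∈ U, qFacInf q (e w / f w) ≠ 0) (h4 : ∀ w ∈ U, qFacInf q (f w / e w) ≠ 0)
    (h5 : ∀ w ∈ U, qFacInf q (d w * f w * g w / (e w * x)) ≠ 0)
    (h5' : ∀ w ∈ U, qFacInf q (d w * e w * g w / (f w * x)) ≠ 0)
    (h6 : ∀ w ∈ U, qFacInf q (q * x / (e w * f w)) ≠ 0) :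
    DifferentiableOn ℂ (fun w => defect q x (b w) (c w) (d w) (e w) (f w) (g w)) U := by
  unfold defect
  refine (DifferentiableOn.sub ?_ (differentiableOn_vwpPart hq1 hx hU hb hc hd he hf hg he0 hf0
    h1 h2 h3 h4 h5 h6)).sub (differentiableOn_vwpPart hq1 hx hU hb hc hd hf he hg hf0 he0
    h1 ?_ h4 h3 h5' ?_)
  · have key := differentiableOn_wpSum hq0 hq1 hx (r := 3) (n := 6) (by norm_num) hU ![b, c, d, e, f, g]
      (by intro i; fin_cases i <;> assumption) (by
        intro w hw
        simp only [Fin.prod_univ_six, Matrix.cons_val_zero, Matrix.cons_val_one, Matrix.cons_val]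
        exact h2 w hw)
    refine key.congr fun w _ => congrArg _ ?_
    funext i
    fin_cases i <;> rfl
  · intro w hw
    convert h2 w hw using 2; ring
  · intro w hw
    rw [mul_comm (f w)]; exact h6 w hw

theorem qFacInf_ne_zero_of_ne_zpow {q : ℂ} (hq1 : ‖q‖ < 1) {z : ℂ}
    (h : ∀ n : ℤ, z ≠ q ^ n) : qFacInf q z ≠ 0 := by
  refine qFacInf_ne_zero hq1 fun n hn => h (-n) ?_
  rw [zpow_neg, zpow_natCast]
  exact eq_inv_of_mul_eq_one_left hn

theorem qFacInf_div_ne_zero_of_ne_zpow {q : ℂ} (hq0 : q ≠ 0) (hq1 : ‖q‖ < 1) {z : ℂ}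
    (h : ∀ n : ℤ, z ≠ q ^ n) : qFacInf q (q / z) ≠ 0 := by
  rcases eq_or_ne z 0 with rfl | hz
  · simp [qFacInf_zero]
  refine qFacInf_ne_zero hq1 fun n hn => h (n + 1) ?_
  rw [zpow_add_one₀ hq0, zpow_natCast]
  field_simp at hn
  rw [← hn]; ring

theorem qFacInf_inv_ne_zero_of_ne_zpow {q : ℂ} (hq1 : ‖q‖ < 1) {z : ℂ}
    (h : ∀ n : ℤ, z ≠ q ^ n) : qFacInf q z⁻¹ ≠ 0 := by
  refine qFacInf_ne_zero_of_ne_zpow hq1 fun n hn => h (-n) ?_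
  rw [zpow_neg, ← hn, inv_inv]

/-- The quotients of parameters that must avoid the powers of `q` in the generic case. -/
noncomputable def genericPar (x d e f g : ℂ) : List ℂ :=
  [e / f, d * f * g / (e * x), d * e * g / (f * x), e * f / x, d * g / x, f * g / x, e * g / x,
    d * f / x, d * e / x, g / d]

theorem defect_base_of_generic {q : ℂ} (hq0 : q ≠ 0) (hq1 : ‖q‖ < 1) {x c d e f g : ℂ} (hx : x ≠ 0)
    (hd : d ≠ 0) (he : e ≠ 0) (hf : f ≠ 0) (hg : g ≠ 0)
    (hgen : ∀ z ∈ genericPar x d e f g, ∀ n : ℤ, z ≠ q ^ n)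
    (hc : ‖c / g‖ < 1) (hn : ‖c * d * e * f / (q * x ^ 2)‖ < 1) :
    defect q x (x / g) c d e f g = 0 := by
  simp only [genericPar, List.mem_cons, List.not_mem_nil, or_false, forall_eq_or_imp,
    forall_eq] at hgen
  obtain ⟨g1, g2, g3, g4, g5, g6, g7, -, -, -⟩ := hgen
  have inv := @qFacInf_div_ne_zero_of_ne_zpow q hq0 hq1
  refine defect_base hq0 hq1 hx hd he hf hg ?_ (qFacInf_ne_zero_of_ne_zpow hq1 g1)
    (qFacInf_ne_zero_of_ne_zpow hq1 g2) (qFacInf_ne_zero_of_ne_zpow hq1 g3) ?_ hc hn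
    ?_ ?_ ?_ ?_ ?_
  · rw [← inv_div]; exact qFacInf_inv_ne_zero_of_ne_zpow hq1 g1
  · convert inv g4 using 2; field_simp
  · convert inv g2 using 2; field_simp
  · convert inv g3 using 2; field_simp
  · convert inv g5 using 2; field_simp
  · convert inv g6 using 2; field_simp
  · convert inv g7 using 2; field_simp

/-- The edges are covered by the base case, and the contiguous relation gives each interior point
from its two lower neighbours. The two norm conditions ensure convergence at all points other than
the corner `M = K = 0`, which is left out; `g/d` not being a power of `q` keeps `c - b` nonzero. -/
theorem defect_grid {q : ℂ} (hq0 : q ≠ 0) (hq1 : ‖q‖ < 1) {x d e f g : ℂ} (hx : x ≠ 0)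
    (hd : d ≠ 0) (he : e ≠ 0) (hf : f ≠ 0) (hg : g ≠ 0)
    (hgen : ∀ z ∈ genericPar x d e f g, ∀ n : ℤ, z ≠ q ^ n)
    (h1 : ‖q * x / (d * g)‖ < 1) (h2 : ‖e * f / x‖ < 1) (N : ℕ) :
    ∀ M K : ℕ, M + K = N + 1 → defect q x (x / g * q ^ M) (x / d * q ^ K) d e f g = 0 := by
  have small : ∀ {z : ℂ} (n : ℕ), ‖z‖ < 1 → ‖z * q ^ n‖ < 1 := by
    intro z n hz
    rw [norm_mul, norm_pow]
    exact mul_lt_one_of_nonneg_of_lt_one_left (norm_nonneg _) hz (pow_le_one₀ (norm_nonneg _) hq1.le)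
  have hgen' : ∀ z ∈ genericPar x g e f d, ∀ n : ℤ, z ≠ q ^ n := by
    simp only [genericPar, List.mem_cons, List.not_mem_nil, or_false, forall_eq_or_imp,
      forall_eq] at hgen ⊢
    obtain ⟨g1, g2, g3, g4, g5, g6, g7, g8, g9, g10⟩ := hgen
    refine ⟨g1, ?_, ?_, g4, ?_, ?_, ?_, ?_, ?_, ?_⟩
    · convert g2 using 3; ring
    · convert g3 using 3; ring
    · convert g5 using 3; ring
    · convert g8 using 3; ring
    · convert g9 using 3; ring
    · convert g6 using 3; ring
    · convert g7 using 3; ring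
    · intro n hn
      apply g10 (-n)
      rw [zpow_neg, ← hn, inv_div]
  have bd1 : ∀ K : ℕ, defect q x (x / g) (x / d * q ^ (K + 1)) d e f g = 0 := by
    intro K
    refine defect_base_of_generic hq0 hq1 hx hd he hf hg hgen ?_ ?_
    · convert small K h1 using 2; field_simp; ring
    · convert small K h2 using 2; field_simp; ring
  have bd2 : ∀ M : ℕ, defect q x (x / g * q ^ (M + 1)) (x / d) d e f g = 0 := by
    intro K
    rw [defect_comm, defect_swap]
    refine defect_base_of_generic hq0 hq1 hx hg he hf hd hgen' ?_ ?_
    · convert small K h1 using 2; field_simp; ring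
    · convert small K h2 using 2; field_simp; ring
  induction N with
  | zero =>
    intro M K hMK
    obtain ⟨rfl, rfl⟩ | ⟨rfl, rfl⟩ : (M = 0 ∧ K = 1) ∨ (M = 1 ∧ K = 0) := by omega
    · simpa using bd1 0
    · simpa using bd2 0
  | succ N ih =>
    intro M K hMK
    rcases M with _ | M
    · obtain rfl : K = N + 1 + 1 := by omega
      simpa using bd1 (N + 1)
    rcases K with _ | K
    · obtain rfl : M = N + 1 := by omega
      simpa using bd2 (N + 1)
    have i1 := ih M (K + 1) (by omega)
    have i2 := ih (M + 1) K (by omega)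
    have hN : q ^ (M + 1) * q ^ (K + 1) = q ^ N * q ^ 2 := by
      rw [← pow_add, ← pow_add, show M + 1 + (K + 1) = N + 2 by omega]
    have n1 : ‖x / g * q ^ (M + 1) * (x / d * q ^ (K + 1)) / (q * x)‖ < 1 := by
      rw [show x / g * q ^ (M + 1) * (x / d * q ^ (K + 1)) / (q * x)
        = x / g * (x / d) * (q ^ (M + 1) * q ^ (K + 1)) / (q * x) by ring, hN]
      convert small N h1 using 2; field_simp
    have n2 : ‖x / g * q ^ (M + 1) * (x / d * q ^ (K + 1)) * d * e * f * g / (q * (q * x ^ 3))‖ < 1 := by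
      rw [show x / g * q ^ (M + 1) * (x / d * q ^ (K + 1)) * d * e * f * g / (q * (q * x ^ 3))
        = x / g * (x / d) * (q ^ (M + 1) * q ^ (K + 1)) * d * e * f * g / (q * (q * x ^ 3)) by ring, hN]
      convert small N h2 using 2; field_simp
    have hp := defect_pair hq0 hq1 hx he hf _ _ d g n1 n2
    rw [show x / g * q ^ (M + 1) / q = x / g * q ^ M by rw [pow_succ]; field_simp, i1,
      show x / d * q ^ (K + 1) / q = x / d * q ^ K by rw [pow_succ]; field_simp, i2] at hp
    rw [mul_zero, mul_zero, sub_zero] at hp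
    have m1 : 1 - x / g * q ^ (M + 1) * (x / d * q ^ (K + 1)) / (q * x) ≠ 0 := by
      intro h0
      rw [← sub_eq_zero.1 h0, norm_one] at n1
      exact lt_irrefl _ n1
    have m2 : x / d * q ^ (K + 1) - x / g * q ^ (M + 1) ≠ 0 := by
      intro h0
      apply hgen (g / d) (by simp [genericPar]) ((M : ℤ) - K)
      rw [zpow_sub₀ hq0, zpow_natCast, zpow_natCast]
      rw [sub_eq_zero, pow_succ, pow_succ] at h0
      field_simp at h0 ⊢
      linear_combination h0
    exact (mul_eq_zero.1 hp.symm).resolve_left (mul_ne_zero m2 m1)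

theorem defect_eq_zero_of_generic {q : ℂ} (hq0 : q ≠ 0) (hq1 : ‖q‖ < 1) {x b c d e f g : ℂ}
    (hx : x ≠ 0) (hd : d ≠ 0) (he : e ≠ 0) (hf : f ≠ 0) (hg : g ≠ 0)
    (hgen : ∀ z ∈ genericPar x d e f g, ∀ n : ℤ, z ≠ q ^ n)
    (h1 : ‖q * x / (d * g)‖ < 1) (h2 : ‖e * f / x‖ < 1)
    (h3 : ‖b * c / x‖ < 1) (h4 : ‖b * c * d * e * f * g / (q * x ^ 3)‖ < 1) :
    defect q x b c d e f g = 0 := by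
  have hdiff : ∀ c, DifferentiableOn ℂ (fun b => defect q x b c d e f g)
      {b | ‖b * (c * (1 / x))‖ < 1 ∧ ‖b * (c * (d * e * f * g / (q * x ^ 3)))‖ < 1} := by
    intro c
    have hgen' := hgen
    simp only [genericPar, List.mem_cons, List.not_mem_nil, or_false, forall_eq_or_imp,
      forall_eq] at hgen'
    obtain ⟨g1, g2, g3, g4, -⟩ := hgen'
    refine differentiableOn_defect (b := fun b => b) (c := fun _ => c) (d := fun _ => d)
      (e := fun _ => e) (f := fun _ => f) (g := fun _ => g) hq0 hq1 hx
      ((isOpen_norm_mul_lt _).inter (isOpen_norm_mul_lt _)) differentiableOn_id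
      (by fun_prop) (by fun_prop) (by fun_prop) (by fun_prop) (by fun_prop)
      (fun _ _ => he) (fun _ _ => hf) ?_ ?_
      (fun _ _ => qFacInf_ne_zero_of_ne_zpow hq1 g1) ?_
      (fun _ _ => qFacInf_ne_zero_of_ne_zpow hq1 g2)
      (fun _ _ => qFacInf_ne_zero_of_ne_zpow hq1 g3) ?_
    · intro b hb
      convert hb.1 using 2; ring
    · intro b hb
      convert hb.2 using 2; ring
    · intro _ _
      rw [← inv_div]; exact qFacInf_inv_ne_zero_of_ne_zpow hq1 g1
    · intro _ _
      convert qFacInf_div_ne_zero_of_ne_zpow hq0 hq1 g4 using 2; field_simp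
  refine eq_zero_of_geometric_grid hq0 hq1 (D := fun b c => defect q x b c d e f g) hdiff
    (fun b => (hdiff b).congr fun c _ => defect_comm _ _ _ _ _ _ _ _)
    (div_ne_zero hx hg) (div_ne_zero hx hd)
    (fun M K hM hK => defect_grid hq0 hq1 hx hd he hf hg hgen h1 h2 (M + K - 1) M K (by omega))
    (by convert h3 using 2; ring) (by convert h4 using 2; ring)

theorem countable_sq_eq_zpow (κ q : ℂ) : {t : ℂ | ∃ n : ℤ, t ^ 2 = κ * q ^ n}.Countable := by
  rw [Set.ofPred_exists]
  refine Set.countable_iUnion fun n => Set.Finite.countable ?_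
  obtain ⟨s, hs⟩ := IsAlgClosed.exists_pow_nat_eq (κ * q ^ n) (n := 2) (by norm_num)
  refine (Set.toFinite {s, -s}).subset fun t ht => ?_
  rw [Set.mem_ofPred_eq, ← hs] at ht
  exact sq_eq_sq_iff_eq_or_eq_neg.1 ht

/-- The deformation `(d/t², et, ft)` fixes `e/f` and the product `def`, hence both convergence
conditions. For small `t` the extra bounds of the generic case hold, outside a countable set of `t`
all genericity conditions hold, and `t = 1` is the given point. -/
theorem defect_eq_zero_of_ne_zero {q : ℂ} (hq0 : q ≠ 0) (hq1 : ‖q‖ < 1) {x b c d e f g : ℂ}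
    (hx : x ≠ 0) (hd : d ≠ 0) (he : e ≠ 0) (hf : f ≠ 0) (hg : g ≠ 0)
    (h1 : ‖b * c / x‖ < 1) (h2 : ‖b * c * d * e * f * g / (q * x ^ 3)‖ < 1)
    (h3 : qFacInf q (e / f) ≠ 0) (h4 : qFacInf q (f / e) ≠ 0)
    (h5 : qFacInf q (d * f * g / (e * x)) ≠ 0) (h5' : qFacInf q (d * e * g / (f * x)) ≠ 0)
    (h6 : qFacInf q (q * x / (e * f)) ≠ 0) : defect q x b c d e f g = 0 := by
  have hef : ∀ n : ℤ, e / f ≠ q ^ n := by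
    intro n hn
    rcases le_total n 0 with h | h
    · exact h3 (by rw [hn, qFacInf_zpow hq0 hq1 h])
    · refine h4 ?_
      rw [← inv_div, hn, ← zpow_neg, qFacInf_zpow hq0 hq1 (by omega)]
  -- Every condition reads `t² ≠ κ qⁿ`: quantities linear in `t` or `1/t` enter through their
  -- squares, and `κ = 0` excludes `t = 0`.
  let L : Set ℂ := {0, d * f * g / (e * x), d * e * g / (f * x), x / (e * f), d * g / x,
    (x / (f * g)) ^ 2, (x / (e * g)) ^ 2, (d * f / x) ^ 2, (d * e / x) ^ 2, d / g}
  let C : Set ℂ := ⋃ κ ∈ L, {t : ℂ | ∃ n : ℤ, t ^ 2 = κ * q ^ n}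
  have hC : C.Countable :=
    (Set.toFinite L).countable.biUnion fun κ _ => countable_sq_eq_zpow κ q
  have hCmem : ∀ t ∉ C, ∀ κ ∈ L, ∀ n : ℤ, t ^ 2 ≠ κ * q ^ n := by
    intro t ht κ hκ n hn
    exact ht (Set.mem_biUnion hκ ⟨n, hn⟩)
  have hC0 : ∀ t ∉ C, t ≠ 0 := by
    rintro t ht rfl
    exact hCmem 0 ht 0 (by simp [L]) 0 (by simp)
  have zi : ∀ n : ℤ, q ^ n ≠ 0 := fun n => zpow_ne_zero n hq0
  have down : ∀ t ∉ C, ∀ κ ∈ L, ∀ n : ℤ, κ / t ^ 2 ≠ q ^ n := by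
    intro t ht κ hκ n hn
    apply hCmem t ht κ hκ (-n)
    have := hC0 t ht
    have := zi n
    rw [zpow_neg, ← hn]
    have : κ ≠ 0 := by
      rintro rfl
      rw [zero_div] at hn
      exact zi n hn.symm
    field_simp
  have up : ∀ t ∉ C, ∀ κ ∈ L, ∀ n : ℤ, t ^ 2 / κ ≠ q ^ n := by
    intro t ht κ hκ n hn
    apply hCmem t ht κ hκ n
    rw [← hn]
    have : κ ≠ 0 := by
      rintro rfl
      rw [div_zero] at hn
      exact zi n hn.symm
    field_simp
  have sqr : ∀ {z : ℂ} {n : ℤ}, z = q ^ n → z ^ 2 = q ^ (n * 2) := by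
    intro z n hz
    rw [hz, zpow_mul]; norm_cast
  have gen : ∀ t ∉ C, ∀ z ∈ genericPar x (d / t ^ 2) (e * t) (f * t) g, ∀ n : ℤ, z ≠ q ^ n := by
    intro t ht
    have t0 := hC0 t ht
    simp only [genericPar, List.mem_cons, List.not_mem_nil, or_false, forall_eq_or_imp, forall_eq]
    refine ⟨fun n => ?_, fun n => ?_, fun n => ?_, fun n => ?_, fun n => ?_, fun n h => ?_,
      fun n h => ?_, fun n h => ?_, fun n h => ?_, fun n => ?_⟩
    · rw [mul_div_mul_right _ _ t0]; exact hef n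
    · convert down t ht (d * f * g / (e * x)) (by simp [L]) n using 1; field_simp
    · convert down t ht (d * e * g / (f * x)) (by simp [L]) n using 1; field_simp
    · convert up t ht (x / (e * f)) (by simp [L]) n using 1; field_simp
    · convert down t ht (d * g / x) (by simp [L]) n using 1; field_simp
    · apply up t ht ((x / (f * g)) ^ 2) (by simp [L]) (n * 2)
      rw [← sqr h]; field_simp
    · apply up t ht ((x / (e * g)) ^ 2) (by simp [L]) (n * 2)
      rw [← sqr h]; field_simp
    · apply down t ht ((d * f / x) ^ 2) (by simp [L]) (n * 2)
      rw [← sqr h]; field_simp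
    · apply down t ht ((d * e / x) ^ 2) (by simp [L]) (n * 2)
      rw [← sqr h]; field_simp
    · convert up t ht (d / g) (by simp [L]) n using 1; field_simp
  let U : Set ℂ := {t | t ≠ 0 ∧ qFacInf q (d * f * g / (e * x) / t ^ 2) ≠ 0
    ∧ qFacInf q (d * e * g / (f * x) / t ^ 2) ≠ 0 ∧ qFacInf q (q * x / (e * f) / t ^ 2) ≠ 0}
  have hP : ∀ z, ContinuousAt (qFacInf q) z := fun z =>
    (differentiable_qFacInf hq1).continuous.continuousAt
  have hU : IsOpen U := by
    refine isOpen_iff_mem_nhds.2 fun t ht => ?_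
    have hc : ∀ κ : ℂ, ContinuousAt (fun t => qFacInf q (κ / t ^ 2)) t := fun κ =>
      ContinuousAt.comp (g := qFacInf q) (hP _)
        (continuousAt_const.div (by fun_prop) (pow_ne_zero 2 ht.1))
    filter_upwards [eventually_ne_nhds ht.1, (hc _).eventually_ne ht.2.1,
      (hc _).eventually_ne ht.2.2.1, (hc _).eventually_ne ht.2.2.2] with s a1 a2 a3 a4
    exact ⟨a1, a2, a3, a4⟩
  have hCU : ∀ t ∉ C, t ∈ U := by
    intro t ht
    have t0 := hC0 t ht
    refine ⟨t0, qFacInf_ne_zero_of_ne_zpow hq1 (down t ht _ (by simp [L])),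
      qFacInf_ne_zero_of_ne_zpow hq1 (down t ht _ (by simp [L])), ?_⟩
    convert qFacInf_div_ne_zero_of_ne_zpow hq0 hq1 (up t ht (x / (e * f)) (by simp [L])) using 2
    field_simp
  -- The complement of a countable subset of the plane is path connected.
  have hconn : IsPreconnected U := by
    have h : Uᶜ.Countable := hC.mono fun t ht => by
      by_contra hn
      exact ht (hCU t hn)
    have := (h.isPathConnected_compl_of_one_lt_rank (by
      rw [Complex.rank_real_complex]; norm_num)).isConnected.isPreconnected
    rwa [compl_compl] at this
  have hF : DifferentiableOn ℂ (fun t => defect q x b c (d / t ^ 2) (e * t) (f * t) g) U := by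
    refine differentiableOn_defect (b := fun _ => b) (c := fun _ => c) (d := fun t => d / t ^ 2)
      (e := fun t => e * t) (f := fun t => f * t) (g := fun _ => g) hq0 hq1 hx hU
      (by fun_prop) (by fun_prop) ?_ (by fun_prop) (by fun_prop) (by fun_prop)
      (fun t ht => mul_ne_zero he ht.1) (fun t ht => mul_ne_zero hf ht.1)
      (fun _ _ => h1) ?_ ?_ ?_ ?_ ?_ ?_
    · exact (differentiableOn_const _).div (by fun_prop) fun t ht => pow_ne_zero 2 ht.1
    · intro t ht
      have := ht.1
      convert h2 using 2; field_simp
    · intro t ht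
      rwa [mul_div_mul_right _ _ ht.1]
    · intro t ht
      rwa [mul_div_mul_right _ _ ht.1]
    · intro t ht
      have := ht.1
      convert ht.2.1 using 2; field_simp
    · intro t ht
      have := ht.1
      convert ht.2.2.1 using 2; field_simp
    · intro t ht
      have := ht.1
      convert ht.2.2.2 using 2; field_simp
  let W : Set ℂ := {t | ‖q * x * t ^ 2 / (d * g)‖ < 1 ∧ ‖e * f * t ^ 2 / x‖ < 1}
  have hW : IsOpen W := by
    have e1 : Continuous fun t : ℂ => ‖q * x * t ^ 2 / (d * g)‖ := by fun_prop
    have e2 : Continuous fun t : ℂ => ‖e * f * t ^ 2 / x‖ := by fun_prop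
    exact (isOpen_lt e1 continuous_const).inter (isOpen_lt e2 continuous_const)
  have hzero : ∀ t ∈ W, t ∉ C → defect q x b c (d / t ^ 2) (e * t) (f * t) g = 0 := by
    intro t ht htC
    have t0 := hC0 t htC
    refine defect_eq_zero_of_generic hq0 hq1 hx (div_ne_zero hd (pow_ne_zero 2 t0))
      (mul_ne_zero he t0) (mul_ne_zero hf t0) hg (gen t htC) ?_ ?_ h1 ?_
    · convert ht.1 using 2; field_simp
    · convert ht.2 using 2; field_simp
    · convert h2 using 2; field_simp
  -- `W` is an open neighbourhood of 0 and countable sets have dense complement, so generic zeros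
  -- accumulate at some `z` in `U`.
  obtain ⟨z, hzW, hzC⟩ := (hC.dense_compl ℂ).inter_open_nonempty W hW ⟨0, by simp [W]⟩
  have hfreq : ∃ᶠ t in 𝓝[≠] z, defect q x b c (d / t ^ 2) (e * t) (f * t) g = 0 := by
    rw [frequently_nhdsWithin_iff]
    have hd' : Dense (C ∪ {z})ᶜ := (hC.union (Set.countable_singleton z)).dense_compl ℂ
    refine ((mem_closure_iff_frequently.1 (hd' z)).and_eventually (hW.mem_nhds hzW)).mono ?_
    rintro t ⟨ht, htW⟩
    rw [Set.compl_union] at ht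
    exact ⟨hzero t htW ht.1, ht.2⟩
  have key := (hF.analyticOnNhd hU).eqOn_zero_of_preconnected_of_frequently_eq_zero hconn
    (hCU z hzC) hfreq
  have h1U : (1 : ℂ) ∈ U := by simp [U, h5, h5', h6]
  simpa using key h1U

theorem defect_eq_zero {q : ℂ} (hq0 : q ≠ 0) (hq1 : ‖q‖ < 1) {x b c d e f g : ℂ}
    (hx : x ≠ 0) (he : e ≠ 0) (hf : f ≠ 0) (hg : g ≠ 0)
    (h1 : ‖b * c / x‖ < 1) (h2 : ‖b * c * d * e * f * g / (q * x ^ 3)‖ < 1)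
    (h3 : qFacInf q (e / f) ≠ 0) (h4 : qFacInf q (f / e) ≠ 0)
    (h5 : qFacInf q (d * f * g / (e * x)) ≠ 0) (h5' : qFacInf q (d * e * g / (f * x)) ≠ 0)
    (h6 : qFacInf q (q * x / (e * f)) ≠ 0) : defect q x b c d e f g = 0 := by
  rcases eq_or_ne d 0 with rfl | hd
  swap
  · exact defect_eq_zero_of_ne_zero hq0 hq1 hx hd he hf hg h1 h2 h3 h4 h5 h5' h6
  let U : Set ℂ := {w | ‖b * c * w * e * f * g / (q * x ^ 3)‖ < 1
    ∧ qFacInf q (w * f * g / (e * x)) ≠ 0 ∧ qFacInf q (w * e * g / (f * x)) ≠ 0}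
  have hP := (differentiable_qFacInf hq1).continuous
  have hU : IsOpen U := by
    have e1 : Continuous fun w : ℂ => ‖b * c * w * e * f * g / (q * x ^ 3)‖ := by fun_prop
    have e2 : Continuous fun w : ℂ => qFacInf q (w * f * g / (e * x)) := by fun_prop
    have e3 : Continuous fun w : ℂ => qFacInf q (w * e * g / (f * x)) := by fun_prop
    exact (isOpen_lt e1 continuous_const).inter ((isOpen_ne_fun e2 continuous_const).inter
      (isOpen_ne_fun e3 continuous_const))
  have h0 : (0 : ℂ) ∈ U := ⟨h2, h5, h5'⟩
  have hF : DifferentiableOn ℂ (fun w => defect q x b c w e f g) U :=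
    differentiableOn_defect (b := fun _ => b) (c := fun _ => c) (d := fun w => w)
      (e := fun _ => e) (f := fun _ => f) (g := fun _ => g) hq0 hq1 hx hU
      (by fun_prop) (by fun_prop) differentiableOn_id (by fun_prop) (by fun_prop) (by fun_prop)
      (fun _ _ => he) (fun _ _ => hf) (fun _ _ => h1) (fun w hw => hw.1) (fun _ _ => h3)
      (fun _ _ => h4) (fun w hw => hw.2.1) (fun w hw => hw.2.2) (fun _ _ => h6)
  -- The case `d = 0` is the limit of nonzero `d`, the defect being continuous in `d` there.
  have hc : Tendsto (fun w => defect q x b c w e f g) (𝓝[≠] 0) (𝓝 (defect q x b c 0 e f g)) :=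
    ((hF.differentiableAt (hU.mem_nhds h0)).continuousAt.tendsto).mono_left nhdsWithin_le_nhds
  refine tendsto_nhds_unique hc (tendsto_const_nhds.congr' ?_)
  filter_upwards [mem_nhdsWithin_of_mem_nhds (hU.mem_nhds h0), self_mem_nhdsWithin] with w hw hw0
  exact (defect_eq_zero_of_ne_zero hq0 hq1 hx hw0 he hf hg h1 hw.1 h3 h4 hw.2.1 hw.2.2 h6).symm

/-! ### The two series of the left-hand side as one bilateral series. -/

theorem wpFactor_natCast {q : ℂ} (hq0 : q ≠ 0) (hq1 : ‖q‖ < 1) {x p : ℂ}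
    (h : qFacInf q (p / x) ≠ 0) (k : ℕ) : wpFactor q x p k
      = qFac q ((q ^ k)⁻¹ * p) k / qFac q (p / x) (k + 1) * (qFacInf q p * qFacInf q (p / x)) := by
  have hk := pow_ne_zero k hq0
  have h1 := qFacInf_eq_qFac_mul hq1 ((q ^ k)⁻¹ * p) k
  rw [show (q ^ k)⁻¹ * p * q ^ k = p by field_simp] at h1
  have h2 := qFacInf_eq_qFac_mul hq1 (p / x) (k + 1)
  rw [h2] at h
  have h3 := left_ne_zero_of_mul h
  unfold wpFactor
  rw [h2, zpow_neg, zpow_natCast, mul_comm p, h1, ← Nat.cast_succ, zpow_natCast,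
    show p * q ^ (k + 1) / x = p / x * q ^ (k + 1) by ring]
  field_simp

/-- The product of the infinite products that normalizes both series on the left-hand side. -/
noncomputable def seriesNorm (q x y b c d e f : ℂ) : ℂ :=
  (qFacInf q (b / y) * qFacInf q (b / (x * y))) * (qFacInf q (c / y) * qFacInf q (c / (x * y)))
    * (qFacInf q (d / y) * qFacInf q (d / (x * y))) * (qFacInf q (e / y) * qFacInf q (e / (x * y)))
    * (qFacInf q (f / y) * qFacInf q (f / (x * y))) * (qFacInf q (x * y) * qFacInf q y)

/-- The five parameters over `y` match factor by factor. The sixth, `x * y`, needs the reversal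
`qFacInf_shift_down` to become `(q/xy; q)_k / (y; q)_{k+1}`, which also supplies the sign in
`(-y/x²)^k`. -/
theorem firstTerm_mul {q : ℂ} (hq0 : q ≠ 0) (hq1 : ‖q‖ < 1) {x y : ℂ} (hx : x ≠ 0) (hy : y ≠ 0)
    (b c d e f : ℂ) (h : seriesNorm q x y b c d e f ≠ 0) (k : ℕ) :
    firstTerm q x y b c d e f k * seriesNorm q x y b c d e f
      = wpTerm q x 3 ![b / y, c / y, d / y, e / y, f / y, x * y] k := by
  have hxy := mul_ne_zero hx hy
  unfold seriesNorm at h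
  simp only [mul_ne_zero_iff] at h
  obtain ⟨⟨⟨⟨⟨⟨-, nb⟩, -, nc⟩, -, nd⟩, -, ne⟩, -, nf⟩, -, ny⟩ := h
  have dv : ∀ p : ℂ, p / y / x = p / (x * y) := fun p => by rw [div_div, mul_comm]
  have w : ∀ p : ℂ, qFacInf q (p / (x * y)) ≠ 0 → wpFactor q x (p / y) k
      = qFac q ((q ^ k)⁻¹ * p / y) k / qFac q (p / (x * y)) (k + 1)
        * (qFacInf q (p / y) * qFacInf q (p / (x * y))) := by
    intro p hp
    rw [← dv p] at hp
    rw [wpFactor_natCast hq0 hq1 hp, dv, mul_div_assoc]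
  have wg : wpFactor q x (x * y) k * (∏ i ∈ Finset.range k, q ^ i)
      = qFac q (q / (x * y)) k * (-(x * y / q)) ^ k / qFac q y (k + 1)
        * (qFacInf q (x * y) * qFacInf q y) := by
    have h2 := qFacInf_eq_qFac_mul hq1 y (k + 1)
    have h3 := ny
    rw [h2] at h3
    have h4 := left_ne_zero_of_mul h3
    have h5 := qFacInf_shift_down hq0 hq1 (div_ne_zero hq0 hxy) k
    rw [div_div_cancel₀ hq0, show -1 / (q / (x * y)) = -(x * y / q) by field_simp] at h5
    unfold wpFactor
    rw [h2, zpow_neg, zpow_natCast, ← Nat.cast_succ, zpow_natCast,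
      show x * y * q ^ (k + 1) / x = y * q ^ (k + 1) by field_simp, mul_right_comm, h5]
    field_simp
  have hT := Finset.sum_range_id_mul_two k
  have hQ : (∏ i ∈ Finset.range k, q ^ i) = q ^ (∑ i ∈ Finset.range k, i) :=
    Finset.prod_pow_eq_pow_sum _ _ _
  obtain ⟨T, hTdef⟩ : ∃ T, T = ∑ i ∈ Finset.range k, i := ⟨_, rfl⟩
  rw [← hTdef] at hT hQ
  rw [hQ] at wg
  have hkk : k * k = 2 * T + k := by
    rcases k with _ | k
    · simp at hT; omega
    · simp at hT; nlinarith
  -- With `T = k(k-1)/2` the division in the exponent is exact.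
  have hexp : k * (5 * k + 3) / 2 = 5 * T + 4 * k := by
    rw [show k * (5 * k + 3) = 2 * (5 * T + 4 * k) by nlinarith]; simp
  have hpow : q ^ (((3 : ℕ) : ℤ) * (k * (k + 1)) - k) = q ^ (5 * T + 4 * k) * (q ^ k * q ^ T) := by
    rw [← pow_add, ← pow_add, ← zpow_natCast]
    congr 1
    have : (k : ℤ) * k = 2 * T + k := by exact_mod_cast hkk
    push_cast
    linarith
  have hxp : x ^ (-(((3 : ℕ) : ℤ) * k)) * (-(x * y / q)) ^ k * q ^ k = (-y / x ^ 2) ^ k := by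
    rw [zpow_neg, zpow_mul, zpow_natCast, zpow_natCast, ← inv_pow, ← mul_pow, ← mul_pow]
    congr 1; field_simp
  unfold firstTerm wpTerm qFacs seriesNorm
  simp only [Fin.prod_univ_six, Matrix.cons_val_zero, Matrix.cons_val_one, Matrix.cons_val,
    List.map_cons, List.map_nil, List.prod_cons, List.prod_nil, mul_one]
  rw [w b nb, w c nc, w d nd, w e ne, w f nf, hpow, hexp, ← hxp,
    show q ^ (2 * (k : ℤ) + 1) = q ^ (2 * k + 1) by exact_mod_cast zpow_natCast q (2 * k + 1)]
  generalize x ^ (-(((3 : ℕ) : ℤ) * k)) = X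
  generalize (-(x * y / q)) ^ k = Z at *
  generalize wpFactor q x (x * y) k = G at *
  generalize qFac q (q / (x * y)) k = A1 at *
  generalize qFac q y (k + 1) = A2 at *
  linear_combination (-(1 - q ^ (2 * k + 1) / x) * q ^ (5 * T + 4 * k) * q ^ k * X
    * (qFac q ((q ^ k)⁻¹ * b / y) k / qFac q (b / (x * y)) (k + 1)
        * (qFacInf q (b / y) * qFacInf q (b / (x * y))))
    * (qFac q ((q ^ k)⁻¹ * c / y) k / qFac q (c / (x * y)) (k + 1)
        * (qFacInf q (c / y) * qFacInf q (c / (x * y))))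
    * (qFac q ((q ^ k)⁻¹ * d / y) k / qFac q (d / (x * y)) (k + 1)
        * (qFacInf q (d / y) * qFacInf q (d / (x * y))))
    * (qFac q ((q ^ k)⁻¹ * e / y) k / qFac q (e / (x * y)) (k + 1)
        * (qFacInf q (e / y) * qFacInf q (e / (x * y))))
    * (qFac q ((q ^ k)⁻¹ * f / y) k / qFac q (f / (x * y)) (k + 1)
        * (qFacInf q (f / y) * qFacInf q (f / (x * y))))) * wg

/-- The substitution `x ↦ x⁻¹`, `y ↦ x * y` is the reflection of `wpTerm_neg` in the original
variables; it also fixes `seriesNorm`. -/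
theorem secondTerm_eq {x : ℂ} (hx : x ≠ 0) (q y b c d e f : ℂ) (k : ℕ) :
    secondTerm q x y b c d e f k = firstTerm q x⁻¹ (x * y) b c d e f k := by
  unfold secondTerm firstTerm
  rw [inv_mul_cancel_left₀ hx, div_inv_eq_mul]
  congr 2
  field_simp

theorem seriesNorm_inv {x : ℂ} (hx : x ≠ 0) (q y b c d e f : ℂ) :
    seriesNorm q x⁻¹ (x * y) b c d e f = seriesNorm q x y b c d e f := by
  unfold seriesNorm
  rw [inv_mul_cancel_left₀ hx]
  ring

theorem norm_prod_par {x y : ℂ} (hx : x ≠ 0) (hy : y ≠ 0) {q b c d e f : ℂ}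
    (h : ‖b * c * d * e * f / (q * x ^ 2 * y ^ 4)‖ < 1) :
    ‖(∏ i, ![b / y, c / y, d / y, e / y, f / y, x * y] i) / (q * x ^ 3)‖ < 1 := by
  simp only [Fin.prod_univ_six, Matrix.cons_val_zero, Matrix.cons_val_one, Matrix.cons_val]
  convert h using 2
  field_simp

theorem summable_firstTerm {q : ℂ} (hq0 : q ≠ 0) (hq1 : ‖q‖ < 1) {x y : ℂ} (hx : x ≠ 0)
    (hy : y ≠ 0) {b c d e f : ℂ} (hn : seriesNorm q x y b c d e f ≠ 0)
    (h : ‖b * c * d * e * f / (q * x ^ 2 * y ^ 4)‖ < 1) : Summable (firstTerm q x y b c d e f) := by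
  have := summable_wpTerm_nat hq0 hq1 hx (r := 3) (n := 6) (by norm_num) _ (norm_prod_par hx hy h)
  simp only [← firstTerm_mul hq0 hq1 hx hy b c d e f hn] at this
  exact (summable_mul_right_iff hn).1 this

theorem tsum_firstTerm_sub {q : ℂ} (hq0 : q ≠ 0) (hq1 : ‖q‖ < 1) {x y : ℂ} (hx : x ≠ 0)
    (hy : y ≠ 0) {b c d e f : ℂ} (hn : seriesNorm q x y b c d e f ≠ 0)
    (h : ‖b * c * d * e * f / (q * x ^ 2 * y ^ 4)‖ < 1) :
    ((∑' k : ℕ, firstTerm q x y b c d e f k) - x ^ 2 * ∑' k : ℕ, secondTerm q x y b c d e f k)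
      * seriesNorm q x y b c d e f
      = wpSum q x 3 ![b / y, c / y, d / y, e / y, f / y, x * y] := by
  have hn' := hn
  rw [← seriesNorm_inv hx] at hn'
  rw [wpSum_eq hq0 hq1 hx (by norm_num) _ (norm_prod_par hx hy h), sub_mul, mul_assoc,
    ← tsum_mul_right, ← tsum_mul_right]
  congr 1
  · exact tsum_congr fun k => firstTerm_mul hq0 hq1 hx hy b c d e f hn k
  · congr 1
    refine tsum_congr fun k => ?_
    rw [secondTerm_eq hx, ← seriesNorm_inv hx,
      firstTerm_mul hq0 hq1 (inv_ne_zero hx) (mul_ne_zero hx hy) b c d e f hn' k]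
    congr 1
    funext i
    fin_cases i <;> simp [div_div, mul_comm, hx]

/-! ### The `₈φ₇`-series and prefactors of `S`. -/

theorem one_sub_mul_qFac (q a : ℂ) (k : ℕ) :
    (1 - a) * qFac q (q * a) k = qFac q a k * (1 - a * q ^ k) := by
  rw [← qFac_succ, qFac, qFac, Finset.prod_range_succ', pow_zero, mul_one, mul_comm]
  congr 1
  refine Finset.prod_congr rfl fun i _ => ?_
  ring

/-- The quotient telescopes to an expression in `s ^ 2`, so the choice of square root is immaterial.
-/
theorem qFac_very_well_poised (q s : ℂ) (k : ℕ)
    (h : ∏ i ∈ Finset.range k, (1 - s ^ 2 * q ^ (2 * i)) ≠ 0) :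
    (1 - s ^ 2) * (qFac q (q * s) k * qFac q (-(q * s)) k / (qFac q s k * qFac q (-s) k))
      = 1 - s ^ 2 * (q ^ k) ^ 2 := by
  have s1 := one_sub_mul_qFac q s k
  have s2 := one_sub_mul_qFac q (-s) k
  rw [mul_neg] at s2
  have ns : qFac q s k * qFac q (-s) k ≠ 0 := by
    convert h using 1
    unfold qFac
    rw [← Finset.prod_mul_distrib]
    refine Finset.prod_congr rfl fun i _ => ?_
    ring
  rw [← mul_div_assoc, div_eq_iff ns]
  linear_combination (1 + s) * qFac q (-(q * s)) k * s1 + qFac q s k * (1 - s * q ^ k) * s2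

theorem csqrt_sq (a : ℂ) : csqrt a ^ 2 = a := by
  unfold csqrt
  rw [one_div]
  exact Complex.cpow_nat_inv_pow a (by norm_num)

theorem prod_vwpRatio {q : ℂ} {x y b c e : ℂ} (hx : x ≠ 0) (hy : y ≠ 0) (hb : b ≠ 0) (hc : c ≠ 0)
    (he : e ≠ 0) (d f : ℂ) (k : ℕ) :
    ∏ i ∈ Finset.range k,
        vwpRatio q x (b / y) (c / y) (d / y) (e / y) (f / y) (x * y) (q ^ i)
      = qFac q (d * f / e) k * qFac q d k * qFac q f k * qFac q (d * f / (x * y ^ 2)) k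
        * qFac q (q * x * y ^ 2 / (b * e)) k * qFac q (q * x * y ^ 2 / (c * e)) k
        / (qFac q q k * qFac q (q * f / e) k) * (b * c / (x * y ^ 2)) ^ k := by
  have e1 : d / y * (f / y) * (x * y) / (e / y * x) = d * f / e := by field_simp
  have e2 : d / y * (x * y) / x = d := by field_simp
  have e3 : f / y * (x * y) / x = f := by field_simp
  have e4 : d / y * (f / y) / x = d * f / (x * y ^ 2) := by field_simp
  have e5 : q * (f / y) / (e / y) = q * f / e := by field_simp
  have e6 : ∀ s : ℂ, (q * s - b / y * (e / y / x)) * (q * s - c / y * (e / y / x)) * (x / (e / y) ^ 2)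
      = (1 - q * x * y ^ 2 / (b * e) * s) * (1 - q * x * y ^ 2 / (c * e) * s)
        * (b * c / (x * y ^ 2)) := by
    intro s
    field_simp
    ring
  unfold vwpRatio
  simp only [e1, e2, e3, e4, e5, e6]
  simp only [Finset.prod_mul_distrib, Finset.prod_div_distrib, Finset.prod_const,
    Finset.card_range, qFac]
  ring

theorem phiTerm_eq (q x y b c d e f z : ℂ) (k : ℕ) :
    phiTerm (upperPar q x y b c d e f) (lowerPar q x y b c d e f) q z k
      = qFac q (q * csqrt (d * f / e)) k * qFac q (-(q * csqrt (d * f / e))) k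
          / (qFac q (csqrt (d * f / e)) k * qFac q (-csqrt (d * f / e)) k)
        * (qFac q (d * f / e) k * qFac q d k * qFac q f k * qFac q (d * f / (x * y ^ 2)) k
          * qFac q (q * x * y ^ 2 / (b * e)) k * qFac q (q * x * y ^ 2 / (c * e)) k
          / (qFac q q k * qFac q (q * f / e) k) * z ^ k)
        / (qFac q (q * d / e) k * qFac q (q * x * y ^ 2 / e) k
          * qFac q (b * d * f / (x * y ^ 2)) k * qFac q (c * d * f / (x * y ^ 2)) k) := by
  unfold phiTerm upperPar lowerPar qFacs
  simp only [List.map_cons, List.map_nil, List.prod_cons, List.prod_nil, mul_one, List.length_cons,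
    List.length_nil]
  have hlen : (((0 + 1 + 1 + 1 + 1 + 1 + 1 + 1 : ℕ) : ℤ)
      - (((0 + 1 + 1 + 1 + 1 + 1 + 1 + 1 + 1 : ℕ) : ℤ) - 1)) = 0 := by norm_num
  rw [hlen, zpow_zero, mul_one]
  have comb : ∀ a1 a2 a3 a4 a5 a6 a7 a8 b1 b2 b3 b4 b5 b6 b7 b8 Z : ℂ,
      a1 * (a2 * (a3 * (a4 * (a5 * (a6 * (a7 * a8))))))
        / (b1 * (b2 * (b3 * (b4 * (b5 * (b6 * (b7 * b8))))))) * Z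
      = a2 * a3 / (b2 * b3) * (a1 * a4 * a5 * a6 * a7 * a8 / (b1 * b4) * Z)
        / (b5 * b6 * b7 * b8) := by
    intros
    simp only [div_eq_mul_inv, mul_inv]
    ring
  exact comb _ _ _ _ _ _ _ _ _ _ _ _ _ _ _ _ _

theorem phiTerm_mul {q : ℂ} (hq1 : ‖q‖ < 1) {x y b c e : ℂ} (hx : x ≠ 0) (hy : y ≠ 0)
    (hb : b ≠ 0) (hc : c ≠ 0) (he : e ≠ 0) {d f : ℂ} (h1 : qFacInf q (d * f / e) ≠ 0)
    (h2 : qFacInf q (q * d / e) ≠ 0) (h3 : qFacInf q (q * x * y ^ 2 / e) ≠ 0)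
    (h4 : qFacInf q (b * d * f / (x * y ^ 2)) ≠ 0) (h5 : qFacInf q (c * d * f / (x * y ^ 2)) ≠ 0)
    (k : ℕ) :
    (1 - d * f / e) * (qFacInf q (q * d / e) * qFacInf q (q * x * y ^ 2 / e)
        * (qFacInf q (b * d * f / (x * y ^ 2)) * qFacInf q (c * d * f / (x * y ^ 2))))
      * phiTerm (upperPar q x y b c d e f) (lowerPar q x y b c d e f) q (b * c / (x * y ^ 2)) k
      = (1 - d * f / e * (q ^ k) ^ 2)
        * (qFacInf q (q * d / e * q ^ k) * qFacInf q (q * x * y ^ 2 / e * q ^ k)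
          * (qFacInf q (b * d * f / (x * y ^ 2) * q ^ k)
            * qFacInf q (c * d * f / (x * y ^ 2) * q ^ k)))
        * ∏ i ∈ Finset.range k,
          vwpRatio q x (b / y) (c / y) (d / y) (e / y) (f / y) (x * y) (q ^ i) := by
  rw [prod_vwpRatio hx hy hb hc he]
  have nz : ∀ {z : ℂ}, qFacInf q z ≠ 0 → qFac q z k ≠ 0 := fun {z} hz h0 => by
    rw [qFacInf_eq_qFac_mul hq1 z k, h0, zero_mul] at hz
    exact hz rfl
  have n2 := nz h2
  have n3 := nz h3
  have n4 := nz h4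
  have n5 := nz h5
  have hs := csqrt_sq (d * f / e)
  have key := qFac_very_well_poised q (csqrt (d * f / e)) k (fun h0 => (by
    rw [Finset.prod_eq_zero_iff] at h0
    obtain ⟨i, -, hi⟩ := h0
    -- The denominators coming from the two square roots multiply to the even-indexed factors of
    -- `(df/e; q)_∞`.
    apply (qFacInf_ne_zero_iff hq1).1 h1 (2 * i)
    rw [hs] at hi
    exact (sub_eq_zero.1 hi).symm))
  rw [hs] at key
  rw [phiTerm_eq, ← key, qFacInf_eq_qFac_mul hq1 (q * d / e) k,
    qFacInf_eq_qFac_mul hq1 (q * x * y ^ 2 / e) k,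
    qFacInf_eq_qFac_mul hq1 (b * d * f / (x * y ^ 2)) k,
    qFacInf_eq_qFac_mul hq1 (c * d * f / (x * y ^ 2)) k]
  have cancel : ∀ R F E A1 A2 A3 A4 B1 B2 B3 B4 : ℂ, A1 ≠ 0 → A2 ≠ 0 → A3 ≠ 0 → A4 ≠ 0 →
      E * (A1 * B1 * (A2 * B2) * (A3 * B3 * (A4 * B4))) * (R * F / (A1 * A2 * A3 * A4))
        = E * R * (B1 * B2 * (B3 * B4)) * F := by
    intros
    field_simp
  exact cancel _ _ _ _ _ _ _ _ _ _ _ n2 n3 n4 n5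

theorem summable_phiTerm {q : ℂ} (hq1 : ‖q‖ < 1) {x y b c e : ℂ} (hx : x ≠ 0) (hy : y ≠ 0)
    (hb : b ≠ 0) (hc : c ≠ 0) (he : e ≠ 0) {d f : ℂ} (h1 : qFacInf q (d * f / e) ≠ 0)
    (h2 : qFacInf q (q * d / e) ≠ 0) (h3 : qFacInf q (q * x * y ^ 2 / e) ≠ 0)
    (h4 : qFacInf q (b * d * f / (x * y ^ 2)) ≠ 0) (h5 : qFacInf q (c * d * f / (x * y ^ 2)) ≠ 0)
    (h : ‖b * c / (x * y ^ 2)‖ < 1) :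
    Summable (phiTerm (upperPar q x y b c d e f) (lowerPar q x y b c d e f) q
      (b * c / (x * y ^ 2))) := by
  have hP := (differentiable_qFacInf hq1).continuous
  have ha : 1 - d * f / e ≠ 0 := by
    have := (qFacInf_ne_zero_iff hq1).1 h1 0
    rw [pow_zero, mul_one] at this
    exact sub_ne_zero.2 this.symm
  refine (summable_mul_left_iff (mul_ne_zero ha (mul_ne_zero (mul_ne_zero h2 h3)
    (mul_ne_zero h4 h5)))).1 ?_
  simp only [phiTerm_mul hq1 hx hy hb hc he h1 h2 h3 h4 h5]
  refine summable_ratio hq1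
    (ρ := vwpRatio q x (b / y) (c / y) (d / y) (e / y) (f / y) (x * y))
    (g := fun s => (1 - d * f / e * s ^ 2)
        * (qFacInf q (q * d / e * s) * qFacInf q (q * x * y ^ 2 / e * s)
          * (qFacInf q (b * d * f / (x * y ^ 2) * s)
            * qFacInf q (c * d * f / (x * y ^ 2) * s)))) ?_ ?_ ?_
  · exact continuousAt_vwpRatio (b := fun _ => b / y) (c := fun _ => c / y) (d := fun _ => d / y)
      (e := fun _ => e / y) (f := fun _ => f / y) (g := fun _ => x * y) (s := fun s => s) hx
      continuousAt_const continuousAt_const continuousAt_const continuousAt_const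
      continuousAt_const continuousAt_const continuousAt_id (div_ne_zero he hy) rfl
  · rw [vwpRatio_zero hx (div_ne_zero he hy)]
    convert h using 2
    field_simp
  · exact Continuous.continuousAt (by fun_prop)

theorem vwpSum_eq_phi {q : ℂ} (hq1 : ‖q‖ < 1) {x y b c e : ℂ} (hx : x ≠ 0) (hy : y ≠ 0)
    (hb : b ≠ 0) (hc : c ≠ 0) (he : e ≠ 0) {d f : ℂ} (h1 : qFacInf q (d * f / e) ≠ 0)
    (h2 : qFacInf q (q * d / e) ≠ 0) (h3 : qFacInf q (q * x * y ^ 2 / e) ≠ 0)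
    (h4 : qFacInf q (b * d * f / (x * y ^ 2)) ≠ 0)
    (h5 : qFacInf q (c * d * f / (x * y ^ 2)) ≠ 0) :
    vwpSum q x (b / y) (c / y) (d / y) (e / y) (f / y) (x * y)
      = (1 - d * f / e) * (qFacInf q (q * d / e) * qFacInf q (q * x * y ^ 2 / e)
          * (qFacInf q (b * d * f / (x * y ^ 2)) * qFacInf q (c * d * f / (x * y ^ 2))))
        * (qFacInf q (b * e / (x * y ^ 2)) * qFacInf q (c * e / (x * y ^ 2)))
        * phi (upperPar q x y b c d e f) (lowerPar q x y b c d e f) q (b * c / (x * y ^ 2)) := by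
  unfold vwpSum phi
  rw [← tsum_mul_left]
  refine tsum_congr fun k => ?_
  rw [mul_right_comm _ (qFacInf q (b * e / (x * y ^ 2)) * _),
    phiTerm_mul hq1 hx hy hb hc he h1 h2 h3 h4 h5]
  unfold vwpHead
  rw [show d / y * (f / y) * (x * y) / (e / y * x) = d * f / e by field_simp,
    show q * (d / y) / (e / y) = q * d / e by field_simp,
    show q * (x * y) / (e / y) = q * x * y ^ 2 / e by field_simp,
    show b / y * (d / y * (f / y) * (x * y) / x ^ 2) = b * d * f / (x * y ^ 2) by field_simp,
    show c / y * (d / y * (f / y) * (x * y) / x ^ 2) = c * d * f / (x * y ^ 2) by field_simp,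
    show b / y * (e / y / x) = b * e / (x * y ^ 2) by field_simp,
    show c / y * (e / y / x) = c * e / (x * y ^ 2) by field_simp]
  ring

theorem vwpPart_rescale {q x y e f : ℂ} (hx : x ≠ 0) (hy : y ≠ 0) (he : e ≠ 0) (hf : f ≠ 0)
    (b c d : ℂ) : vwpPart q x (b / y) (c / y) (d / y) (e / y) (f / y) (x * y)
      = x ^ 2 * y / f * (qFacInf q q * (qFacInf q (1 / x) * qFacInf q (q * x))
          * (qFacInf q e * qFacInf q (d * e / (x * y ^ 2)))
          * (qFacInf q (f / y) * qFacInf q (q * y / f)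
            * (qFacInf q (f / (x * y)) * qFacInf q (q * x * y / f))))
        / (qFacInf q (e / f) * qFacInf q (d * f / e) * qFacInf q (q * x * y ^ 2 / (e * f)))
        * (qFacInf q (b * c / (x * y ^ 2))
          / qFacInf q (b * c * d * e * f / (q * x ^ 2 * y ^ 4)))
        * vwpSum q x (b / y) (c / y) (d / y) (e / y) (f / y) (x * y) := by
  unfold vwpPart vwpConst qTheta
  rw [show d / y * (f / y) * (x * y) / (e / y * x) = d * f / e by field_simp,
    show q / (1 / x) = q * x by field_simp,
    show b / y * (c / y) / x = b * c / (x * y ^ 2) by field_simp,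
    show b / y * (c / y) * (d / y) * (e / y) * (f / y) * (x * y) / (q * x ^ 3)
      = b * c * d * e * f / (q * x ^ 2 * y ^ 4) by field_simp,
    show e / y / (f / y) = e / f by field_simp,
    show q * x / (e / y * (f / y)) = q * x * y ^ 2 / (e * f) by field_simp,
    show e / y * (x * y) / x = e by field_simp,
    show d / y * (e / y) / x = d * e / (x * y ^ 2) by field_simp,
    show q / (f / y) = q * y / f by field_simp,
    show f / y / x = f / (x * y) by field_simp,
    show q / (f / (x * y)) = q * x * y / f by field_simp,
    show x ^ 2 / (f / y) = x ^ 2 * y / f by field_simp]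

/-- `seriesNorm` cancels the denominators of `S` in `y, xy, b, c, d, e`. Its two products in `f`
complete `(qy/f, qxy/f; q)_∞` to the thetas of `vwpConst`, and the head factor `1 - df/e` turns
`(qdf/e; q)_∞` into `(df/e; q)_∞`. -/
theorem S_mul_seriesNorm {q : ℂ} (hq1 : ‖q‖ < 1) {x y b c e : ℂ} (hx : x ≠ 0)
    (hy : y ≠ 0) (hb : b ≠ 0) (hc : c ≠ 0) (he : e ≠ 0) {d f : ℂ} (hf : f ≠ 0)
    (hn : seriesNorm q x y b c d e f ≠ 0) (h1 : qFacInf q (d * f / e) ≠ 0)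
    (h2 : qFacInf q (q * d / e) ≠ 0) (h3 : qFacInf q (q * x * y ^ 2 / e) ≠ 0)
    (h4 : qFacInf q (b * d * f / (x * y ^ 2)) ≠ 0)
    (h5 : qFacInf q (c * d * f / (x * y ^ 2)) ≠ 0) :
    S q x y b c d e f * seriesNorm q x y b c d e f
      = vwpPart q x (b / y) (c / y) (d / y) (e / y) (f / y) (x * y) := by
  have ha : qFacInf q (d * f / e) = (1 - d * f / e) * qFacInf q (q * d * f / e) := by
    rw [qFacInf_eq hq1 (d * f / e), show d * f / e * q = q * d * f / e by ring]
  have ha' := h1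
  rw [ha] at ha'
  rw [vwpPart_rescale hx hy he hf, vwpSum_eq_phi hq1 hx hy hb hc he h1 h2 h3 h4 h5, ha]
  unfold seriesNorm at hn ⊢
  simp only [mul_ne_zero_iff] at hn
  obtain ⟨⟨⟨⟨⟨⟨nb, nb'⟩, nc, nc'⟩, nd, nd'⟩, ne, ne'⟩, nf, nf'⟩, ng, ng'⟩ := hn
  have cancel : ∀ Z n1 n2 n3 n4 n5 m1 m2 m3 m4 m5 m6 m7 m8 m9 b1 b2 c1 c2 d1 d2 e1 e2 f1 f2 g1 g2
      t1 t2 t3 t4 A Φ : ℂ, b1 ≠ 0 → b2 ≠ 0 → c1 ≠ 0 → c2 ≠ 0 → d1 ≠ 0 → d2 ≠ 0 → e1 ≠ 0 → e2 ≠ 0 →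
      g1 ≠ 0 → g2 ≠ 0 → A ≠ 0 →
      Z * ((n1 * (n2 * (n3 * (n4 * n5)))) / (g2 * (b1 * (c1 * (d1 * e1)))))
        * ((m1 * (m2 * (m3 * (m4 * (m5 * (m6 * (m7 * (m8 * m9))))))))
          / (g1 * (b2 * (c2 * (d2 * (e2 * (t1 * (t2 * (t3 * t4)))))))))
        * Φ * ((b1 * b2) * (c1 * c2) * (d1 * d2) * (e1 * e2) * (f1 * f2) * (g1 * g2))
      = Z * (n1 * (n3 * n2) * (n4 * m7) * (f1 * m1 * (f2 * m2))) / (t1 * (A * t2) * t3) * (m4 / t4)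
        * (A * (n5 * m3 * (m8 * m9)) * (m5 * m6) * Φ) := by
    intros Z n1 n2 n3 n4 n5 m1 m2 m3 m4 m5 m6 m7 m8 m9 b1 b2 c1 c2 d1 d2 e1 e2 f1 f2 g1 g2
      t1 t2 t3 t4 A Φ
    intros
    have l1 : Z * ((n1 * (n2 * (n3 * (n4 * n5)))) / (g2 * (b1 * (c1 * (d1 * e1)))))
        * ((m1 * (m2 * (m3 * (m4 * (m5 * (m6 * (m7 * (m8 * m9))))))))
          / (g1 * (b2 * (c2 * (d2 * (e2 * (t1 * (t2 * (t3 * t4)))))))))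
        * Φ * ((b1 * b2) * (c1 * c2) * (d1 * d2) * (e1 * e2) * (f1 * f2) * (g1 * g2))
      = (b1 / b1) * (b2 / b2) * (c1 / c1) * (c2 / c2) * (d1 / d1) * (d2 / d2) * (e1 / e1) * (e2 / e2)
        * (g1 / g1) * (g2 / g2) * (Z * (n1 * n2 * n3 * n4 * n5) * (m1 * m2 * m3 * m4 * m5 * m6 * m7
        * m8 * m9) * f1 * f2 * Φ / (t1 * t2 * t3 * t4)) := by
      simp only [div_eq_mul_inv, mul_inv]
      ring
    have l2 : Z * (n1 * (n3 * n2) * (n4 * m7) * (f1 * m1 * (f2 * m2))) / (t1 * (A * t2) * t3)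
        * (m4 / t4) * (A * (n5 * m3 * (m8 * m9)) * (m5 * m6) * Φ)
      = (A / A) * (Z * (n1 * n2 * n3 * n4 * n5) * (m1 * m2 * m3 * m4 * m5 * m6 * m7
        * m8 * m9) * f1 * f2 * Φ / (t1 * t2 * t3 * t4)) := by
      simp only [div_eq_mul_inv, mul_inv]
      ring
    rw [l1, l2]
    simp only [div_self, ne_eq, not_false_eq_true, one_mul, *]
  unfold S qFacsInf
  simp only [List.map_cons, List.map_nil, List.prod_cons, List.prod_nil, mul_one]
  exact cancel _ _ _ _ _ _ _ _ _ _ _ _ _ _ _ _ _ _ _ _ _ _ _ _ _ _ _ _ _ _ _ _ _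
    nb nb' nc nc' nd nd' ne ne' ng ng' (left_ne_zero_of_mul ha')

end

theorem theorem2p4 (q x y b c d e f : ℂ)
    (hq0 : q ≠ 0) (hq1 : ‖q‖ < 1)
    (hx : x ≠ 0) (hy : y ≠ 0) (hb : b ≠ 0) (hc : c ≠ 0) (he : e ≠ 0) (hf : f ≠ 0)
    (hmax : max ‖b * c * d * e * f / (q * x ^ 2 * y ^ 4)‖ ‖b * c / (x * y ^ 2)‖ < 1)
    -- no zero factor in a denominator of the two series on the left-hand side
    (hleft : ∀ a ∈ [y, x * y, b / y, c / y, d / y, e / y, f / y,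
        b / (x * y), c / (x * y), d / (x * y), e / (x * y), f / (x * y)],
      ∀ n : ℕ, a * q ^ n ≠ 1)
    -- no zero factor in a denominator of the infinite products and the `₈φ₇`-series
    (hright : ∀ a ∈ [e / f, f / e, d * f / e, d * e / f, q * x * y ^ 2 / (e * f),
        q * d / e, q * d / f, q * x * y ^ 2 / e, q * x * y ^ 2 / f,
        b * d * f / (x * y ^ 2), c * d * f / (x * y ^ 2),
        b * d * e / (x * y ^ 2), c * d * e / (x * y ^ 2)],
      ∀ n : ℕ, a * q ^ n ≠ 1) :
    Summable (firstTerm q x y b c d e f) ∧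
    Summable (secondTerm q x y b c d e f) ∧
    Summable (phiTerm (upperPar q x y b c d e f) (lowerPar q x y b c d e f) q
      (b * c / (x * y ^ 2))) ∧
    Summable (phiTerm (upperPar q x y b c d f e) (lowerPar q x y b c d f e) q
      (b * c / (x * y ^ 2))) ∧
    (∑' k : ℕ, firstTerm q x y b c d e f k) - x ^ 2 * ∑' k : ℕ, secondTerm q x y b c d e f k
      = S q x y b c d e f + S q x y b c d f e := by
  have hm1 : ‖b * c * d * e * f / (q * x ^ 2 * y ^ 4)‖ < 1 := (le_max_left _ _).trans_lt hmax
  have hm2 : ‖b * c / (x * y ^ 2)‖ < 1 := (le_max_right _ _).trans_lt hmax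
  replace hleft : ∀ a ∈ _, qFacInf q a ≠ 0 := fun a ha => qFacInf_ne_zero hq1 (hleft a ha)
  replace hright : ∀ a ∈ _, qFacInf q a ≠ 0 := fun a ha => qFacInf_ne_zero hq1 (hright a ha)
  simp only [List.mem_cons, List.not_mem_nil, or_false, forall_eq_or_imp, forall_eq] at hleft hright
  obtain ⟨l1, l2, l3, l4, l5, l6, l7, l8, l9, l10, l11, l12⟩ := hleft
  obtain ⟨r1, r2, r3, r4, r5, r6, r7, r8, r9, r10, r11, r12, r13⟩ := hright
  have hn : seriesNorm q x y b c d e f ≠ 0 := by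
    unfold seriesNorm
    simp only [mul_ne_zero_iff]
    exact ⟨⟨⟨⟨⟨⟨l3, l8⟩, l4, l9⟩, l5, l10⟩, l6, l11⟩, l7, l12⟩, l2, l1⟩
  have hcomm : seriesNorm q x y b c d f e = seriesNorm q x y b c d e f := by
    unfold seriesNorm; ring
  have hxy := mul_ne_zero hx hy
  refine ⟨summable_firstTerm hq0 hq1 hx hy hn hm1, ?_,
    summable_phiTerm hq1 hx hy hb hc he r3 r6 r8 r10 r11 hm2,
    summable_phiTerm hq1 hx hy hb hc hf r4 r7 r9 r12 r13 hm2, ?_⟩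
  · have h := summable_firstTerm hq0 hq1 (inv_ne_zero hx) hxy (b := b) (c := c) (d := d) (e := e)
      (f := f) (by rwa [seriesNorm_inv hx]) (by convert hm1 using 2; field_simp)
    exact h.congr fun k => (secondTerm_eq hx q y b c d e f k).symm
  -- The sixth parameter is specialized to `g = x * y` and the others are divided by `y`.
  · have hD := defect_eq_zero hq0 hq1 (x := x) (b := b / y) (c := c / y) (d := d / y) (e := e / y)
      (f := f / y) (g := x * y) hx (div_ne_zero he hy) (div_ne_zero hf hy) hxy
      (by convert hm2 using 2; field_simp) (by convert hm1 using 2; field_simp)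
      (by convert r1 using 2; field_simp) (by convert r2 using 2; field_simp)
      (by convert r3 using 2; field_simp) (by convert r4 using 2; field_simp)
      (by convert r5 using 2; field_simp)
    apply mul_right_cancel₀ hn
    rw [tsum_firstTerm_sub hq0 hq1 hx hy hn hm1, add_mul,
      S_mul_seriesNorm hq1 hx hy hb hc he hf hn r3 r6 r8 r10 r11, ← hcomm,
      S_mul_seriesNorm hq1 hx hy hb hc hf he (by rwa [hcomm]) r4 r7 r9 r12 r13]
    unfold defect at hD
    linear_combination hD
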